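/- Let $\Bbbk$ be a field, $\delta\in\Bbbk$ and $k\ge 0$. A partial Brauer $k$-diagram is a set partition, with all blocks of size at most $2$, of the $2k$ vertices $1,\dots,k$ (top row of a rectangle) and $1',\dots,k'$ (bottom row); blocks of size $2$ are called edges, and an edge is a cup (cap) if both its endpoints are in the top (bottom) row. The algebra $\mathrm{PB}_k(\delta)=\mathrm{PB}_k(\delta,1)$ has these diagrams as a basis, with $d_1d_2=\delta^{N}\,(d_1\circ d_2)$, where $d_1\circ d_2$ is obtained by placing $d_1$ above $d_2$, identifying the middle vertices and restricting the connected components to the outer rows, and $N$ is the number of closed loops in the middle row. Let $\mathrm{TL}_n(\delta)\subseteq \mathrm{PB}_n(\delta)$ be the Temperley–Lieb algebra, spanned by the planar diagrams without isolated vertices. Let $\mathcal D(k)$ be the set of balanced Motzkin $k$-diagrams, i.e. planar partial Brauer $k$-diagrams with as many cups as caps, and $\mathcal D_n(k)$ the subset of those with exactly $n$ edges. For a diagram $d$ put $\bar d=\sum_{d'\le d}(-1)^{\beta(d)-\beta(d')}d'$, where $\beta$ is the number of blocks and $d'\le d$ means that every block of $d'$ is contained in a block of $d$. Let $p_i$ be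 the diagram with $i,i'$ isolated and $j$ joined to $j'$ for all $j\ne i$, and let $\tilde d=\prod_{i}(1-p_i)\; d\;\prod_{j}(1-p_j)$, where $i$ (resp. $j$) runs over the endpoints of the cups (resp. caps) of $d$. The partial Temperley–Lieb algebra $\mathrm{PTL}_k(\delta)$ is the subalgebra of $\mathrm{PB}_k(\delta)$ spanned by the $\tilde d$ with $d\in\mathcal D(k)$, and, for $0\le n\le k$, $X(n)$ is its two-sided ideal spanned by the $\bar d$ with $d\in\mathcal D_n(k)$; it is an algebra with an identity element of its own. Let $Q_n$ be the $\Bbbk$-vector space with basis the $n$-element subsets of $\{1,\dots,k\}$. For a $\mathrm{TL}_n(\delta-1)$-module $N$, the algebra $X(n)$ acts on $Q_n\otimes_{\Bbbk} N$ by $$\bar d\cdot(C\otimes v)=\begin{cases}A\otimes tv & \text{if } C=B,\\ 0&\text{otherwise,}\end{cases}$$ where $A$ (resp. $B$) is the set of indices of the non-isolated vertices in the top (resp. bottom) row of $d\in\mathcal D_n(k)$ and $t$ is the Temperley–Lieb diagram on $2n$ vertices obtained from $d$ by deleting the isolated vertices. Then the following hold. (a) For $0\le n\le k$, the algebra $X(n)$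 is semisimple if and only if $\mathrm{TL}_n(\delta-1)$ is semisimple. (b) If $0\le n\le k$ and $X(n)$ is semisimple, then its simple modules are, up to isomorphism, exactly the modules $Q_n\otimes S$, where $S$ is a simple $\mathrm{TL}_n(\delta-1)$-module: every simple $X(n)$-module is isomorphic to some such $Q_n\otimes S$, and for every simple $S$ the formula above makes $Q_n\otimes S$ a simple $X(n)$-module. (c) If $\mathrm{TL}_n(\delta-1)$ is semisimple for all $n=0,1,\dots,k$, then $\mathrm{PTL}_k(\delta)$ is semisimple. -/

import Mathlib

/- Main definitions, in order of appearance: `Diagram` (partial Brauer diagrams), `Diagram.comp` and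
`Diagram.numLoops` (product of diagrams and number of closed loops), `Diagram.IsPlanar`,
`Diagram.balancedMotzkin`, `Diagram.balancedMotzkinEdges`, `Diagram.temperleyLieb`, `PB` (the partial
Brauer algebra with parameters `δ` and `1`), `PB.bar`, `PB.tilde`, `TL`, `PTL`, `X`, `Q`,
`Diagram.core` and `inflationAction`. All other facts serve to prove that the products are associative
and that the spans in question are closed under multiplication and planar diagrams under composition. -/

namespace PartialTL

section Involutions

variable {V : Type*} {S T : Equiv.Perm V}

/-- `R` is the finest equivalence relation relating `y` with `S y` and with `T y`, for all `y`. -/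
def IsGen (S T : Equiv.Perm V) (R : Setoid V) : Prop :=
  (∀ y, R y (S y)) ∧ (∀ y, R y (T y)) ∧
    ∀ R' : Setoid V, (∀ y, R' y (S y)) → (∀ y, R' y (T y)) → R ≤ R'

theorem IsGen.symm {R : Setoid V} (h : IsGen S T R) : IsGen T S R :=
  ⟨h.2.1, h.1, fun R' h1 h2 => h.2.2 R' h2 h1⟩

theorem S_zpow (hS : S * S = 1) (hT : T * T = 1) {x : V} (hx : S x = x) (j : ℤ) :
    S (((S * T) ^ j) x) = ((S * T) ^ (-j)) x := by
  have hconj : S * (S * T) ^ j = (S * T) ^ (-j) * S := by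
    have : S * (S * T) * S⁻¹ = (S * T)⁻¹ := by
      have e1 : S⁻¹ = S := inv_eq_of_mul_eq_one_left hS
      have e2 : T⁻¹ = T := inv_eq_of_mul_eq_one_left hT
      rw [mul_inv_rev, e1, e2, ← mul_assoc, hS, one_mul]
    have h2 := conj_zpow (a := S) (b := S * T) (i := j)
    rw [this, inv_zpow'] at h2
    rw [h2]; group
  have := congrArg (fun f : Equiv.Perm V => f x) hconj
  simpa [hx] using this

theorem T_zpow (hS : S * S = 1) (hT : T * T = 1) {x : V} (hx : S x = x) (j : ℤ) :
    T (((S * T) ^ j) x) = ((S * T) ^ (-(j + 1))) x := by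
  rw [← S_zpow hS hT hx (j + 1), add_comm, zpow_add, zpow_one]
  have : ∀ y, S (S y) = y := fun y => congrArg (fun f : Equiv.Perm V => f y) hS
  simp [this]

/-- If `x` is fixed by `S`, the vertices connected to `x` are the `(S T)^j x`. -/
theorem exists_zpow_of_rel (hS : S * S = 1) (hT : T * T = 1)
    {R : Setoid V} (hR : IsGen S T R) {x y : V} (hx : S x = x) (hxy : R x y) :
    ∃ j : ℤ, y = ((S * T) ^ j) x := by
  have hSS : ∀ y, S (S y) = y := fun y => congrArg (fun f : Equiv.Perm V => f y) hS
  have hTT : ∀ y, T (T y) = y := fun y => congrArg (fun f : Equiv.Perm V => f y) hT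
  let R' : Setoid V :=
    { r := fun a b => (∃ j : ℤ, a = ((S * T) ^ j) x) ↔ (∃ j : ℤ, b = ((S * T) ^ j) x)
      iseqv := ⟨fun _ => Iff.rfl, fun h => h.symm, fun h h' => h.trans h'⟩ }
  have h1 : ∀ y, R' y (S y) := by
    intro y
    constructor
    · rintro ⟨j, rfl⟩; exact ⟨_, S_zpow hS hT hx j⟩
    · rintro ⟨j, h⟩; exact ⟨-j, by rw [← S_zpow hS hT hx j, ← h, hSS y]⟩
  have h2 : ∀ y, R' y (T y) := by
    intro y
    constructor
    · rintro ⟨j, rfl⟩; exact ⟨_, T_zpow hS hT hx j⟩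
    · rintro ⟨j, h⟩; exact ⟨-(j + 1), by rw [← T_zpow hS hT hx j, ← h, hTT y]⟩
  exact (hR.2.2 R' h1 h2 hxy).1 ⟨0, by simp⟩

theorem zpow_eq_iff (x : V) : ∃ n : ℤ, ∀ i j : ℤ,
    ((S * T) ^ i) x = ((S * T) ^ j) x ↔ n ∣ i - j := by
  let P : AddSubgroup ℤ :=
    { carrier := {i | ((S * T) ^ i) x = x}
      zero_mem' := by simp
      add_mem' := by
        intro a b ha hb
        simp only [Set.mem_ofPred_eq] at *
        rw [zpow_add, Equiv.Perm.mul_apply, hb, ha]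
      neg_mem' := by
        intro a ha
        simp only [Set.mem_ofPred_eq] at *
        rw [zpow_neg, Equiv.Perm.inv_eq_iff_eq, ha] }
  obtain ⟨n, hn⟩ := Int.subgroup_cyclic P
  refine ⟨n, fun i j => ?_⟩
  rw [← Int.mem_zmultiples_iff, AddSubgroup.zmultiples_eq_closure, ← hn]
  change _ ↔ ((S * T) ^ (i - j)) x = x
  have : i = j + (i - j) := by ring
  conv_lhs => rw [this, zpow_add, Equiv.Perm.mul_apply]
  exact (Equiv.injective _).eq_iff

/-- At most one other end of the first kind. -/
theorem ends_SS (hS : S * S = 1) (hT : T * T = 1) {R : Setoid V} (hR : IsGen S T R) {x y z : V}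
    (hx : S x = x) (hy : S y = y) (hz : S z = z) (hxy : R x y) (hxz : R x z) (h1 : y ≠ x)
    (h2 : z ≠ x) : y = z := by
  obtain ⟨i, rfl⟩ := exists_zpow_of_rel hS hT hR hx hxy
  obtain ⟨j, rfl⟩ := exists_zpow_of_rel hS hT hR hx hxz
  obtain ⟨n, hn⟩ := zpow_eq_iff (S := S) (T := T) x
  rw [S_zpow hS hT hx, hn] at hy hz
  have h1' : ¬ n ∣ i := fun h => h1 (by simpa using (hn i 0).2 (by simpa using h))
  have h2' : ¬ n ∣ j := fun h => h2 (by simpa using (hn j 0).2 (by simpa using h))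
  rw [hn]
  obtain ⟨a, ha⟩ := hy
  obtain ⟨b, hb⟩ := hz
  have ha' : ¬ (2 ∣ a) := by
    rintro ⟨c, rfl⟩; exact h1' ⟨-c, by linarith⟩
  have hb' : ¬ (2 ∣ b) := by
    rintro ⟨c, rfl⟩; exact h2' ⟨-c, by linarith⟩
  obtain ⟨c, hc⟩ : (2 : ℤ) ∣ b - a := by omega
  exact ⟨c, by have : n * (b - a) = n * (2 * c) := by rw [hc]
               linarith⟩

/-- At most one end of the second kind. -/
theorem ends_TT (hS : S * S = 1) (hT : T * T = 1) {R : Setoid V} (hR : IsGen S T R) {x y z : V}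
    (hx : S x = x) (hy : T y = y) (hz : T z = z) (hxy : R x y) (hxz : R x z) : y = z := by
  obtain ⟨i, rfl⟩ := exists_zpow_of_rel hS hT hR hx hxy
  obtain ⟨j, rfl⟩ := exists_zpow_of_rel hS hT hR hx hxz
  obtain ⟨n, hn⟩ := zpow_eq_iff (S := S) (T := T) x
  rw [T_zpow hS hT hx, hn] at hy hz
  rw [hn]
  obtain ⟨a, ha⟩ := hy
  obtain ⟨b, hb⟩ := hz
  have hodd : ∀ c, -(i + 1) - i = n * c → ¬ (2 ∣ c) := by
    rintro c hc ⟨e, rfl⟩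
    have : n * (2 * e) = 2 * (n * e) := by ring
    omega
  have hodd2 : ∀ c, -(j + 1) - j = n * c → ¬ (2 ∣ c) := by
    rintro c hc ⟨e, rfl⟩
    have : n * (2 * e) = 2 * (n * e) := by ring
    omega
  have ha' := hodd a ha
  have hb' := hodd2 b hb
  obtain ⟨c, hc⟩ : (2 : ℤ) ∣ b - a := by omega
  exact ⟨c, by have : n * (b - a) = n * (2 * c) := by rw [hc]
               linarith⟩

/-- There are no ends of both kinds apart from the given one. -/
theorem ends_ST (hS : S * S = 1) (hT : T * T = 1) {R : Setoid V} (hR : IsGen S T R) {x y z : V}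
    (hx : S x = x) (hy : S y = y) (hz : T z = z) (hxy : R x y) (hxz : R x z) : y = x := by
  obtain ⟨i, rfl⟩ := exists_zpow_of_rel hS hT hR hx hxy
  obtain ⟨j, rfl⟩ := exists_zpow_of_rel hS hT hR hx hxz
  obtain ⟨n, hn⟩ := zpow_eq_iff (S := S) (T := T) x
  rw [S_zpow hS hT hx, hn] at hy
  rw [T_zpow hS hT hx, hn] at hz
  have : n ∣ i - 0 := by
    obtain ⟨a, ha⟩ := hy
    obtain ⟨b, hb⟩ := hz
    have hn2 : ¬ 2 ∣ n := by
      rintro ⟨e, rfl⟩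
      have : 2 * e * b = 2 * (e * b) := by ring
      omega
    have ha2 : 2 ∣ a := by
      have h2 : (2 : ℤ) ∣ n * a := ⟨-i, by linarith⟩
      exact (Int.prime_two.dvd_or_dvd h2).resolve_left hn2
    obtain ⟨c, rfl⟩ := ha2
    exact ⟨-c, by linarith⟩
  simpa using (hn i 0).2 this

/-- A finite component with one end has a second end. -/
theorem exists_end [Finite V] (hS : S * S = 1) (hT : T * T = 1) {R : Setoid V} (hR : IsGen S T R)
    {x : V} (hx : S x = x) : ∃ y, R x y ∧ ((y ≠ x ∧ S y = y) ∨ T y = y) := by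
  have hmem : ∀ j : ℕ, R x (((S * T) ^ j) x) := by
    intro j
    induction j with
    | zero => simp
    | succ j ih =>
      rw [pow_succ']
      exact R.trans (R.trans ih (hR.2.1 _)) (hR.1 _)
  obtain ⟨n, hn⟩ := zpow_eq_iff (S := S) (T := T) x
  have hn0 : n ≠ 0 := by
    rintro rfl
    obtain ⟨i, j, hij, h⟩ := Finite.exists_ne_map_eq_of_infinite (fun j : ℤ => ((S * T) ^ j) x)
    exact hij (by simpa [sub_eq_zero] using (hn i j).1 h)
  have hdvd : ∀ m : ℕ, n ∣ m ↔ n.natAbs ∣ m := fun m => Int.natAbs_dvd_natAbs.symm.trans (by simp)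
  rcases Nat.even_or_odd' n.natAbs with ⟨m, hm | hm⟩
  · refine ⟨_, hmem m, Or.inl ⟨?_, ?_⟩⟩
    · intro h
      have h3 := (hn m 0).1 (by simpa using h)
      rw [sub_zero, hdvd] at h3
      have := Nat.le_of_dvd (by omega) h3
      omega
    · have := S_zpow hS hT hx m
      rw [zpow_natCast] at this
      rw [this, ← zpow_natCast, hn]
      have h4 : (-(m : ℤ) - m) = -((2 * m : ℕ) : ℤ) := by push_cast; ring
      rw [h4, dvd_neg, hdvd, hm]
  · refine ⟨_, hmem m, Or.inr ?_⟩
    have := T_zpow hS hT hx m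
    rw [zpow_natCast] at this
    rw [this, ← zpow_natCast, hn]
    have h4 : (-((m : ℤ) + 1) - m) = -((2 * m + 1 : ℕ) : ℤ) := by push_cast; ring
    rw [h4, dvd_neg, hdvd, hm]

/-- `x` is an end of the first or of the second kind. -/
def IsEnd (S T : Equiv.Perm V) (x : V) (b : Bool) : Prop := bif b then S x = x else T x = x

theorem three_ends (hS : S * S = 1) (hT : T * T = 1) {R : Setoid V} (hR : IsGen S T R) {x y z : V}
    {a b c : Bool} (hx : IsEnd S T x a) (hy : IsEnd S T y b) (hz : IsEnd S T z c) (hxy : R x y)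
    (hxz : R x z) : (x, a) = (y, b) ∨ (x, a) = (z, c) ∨ (y, b) = (z, c) := by
  by_contra! h
  obtain ⟨h1, h2, h3⟩ := h
  cases a <;> cases b <;> cases c <;> simp only [IsEnd, cond_true, cond_false] at hx hy hz
  · exact h3 (by rw [ends_SS hT hS hR.symm hx hy hz hxy hxz (by grind) (by grind)])
  · exact h1 (by rw [ends_ST hT hS hR.symm hx hy hz hxy hxz])
  · exact h2 (by rw [ends_ST hT hS hR.symm hx hz hy hxz hxy])
  · exact h3 (by rw [ends_TT hT hS hR.symm hx hy hz hxy hxz])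
  · exact h3 (by rw [ends_TT hS hT hR hx hy hz hxy hxz])
  · exact h2 (by rw [ends_ST hS hT hR hx hz hy hxz hxy])
  · exact h1 (by rw [ends_ST hS hT hR hx hy hz hxy hxz])
  · exact h3 (by rw [ends_SS hS hT hR hx hy hz hxy hxz (by grind) (by grind)])

theorem second_end [Finite V] (hS : S * S = 1) (hT : T * T = 1) {R : Setoid V} (hR : IsGen S T R)
    {x : V} {a : Bool} (hx : IsEnd S T x a) :
    ∃ y b, R x y ∧ IsEnd S T y b ∧ (y, b) ≠ (x, a) := by
  cases a <;> simp only [IsEnd, cond_true, cond_false] at hx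
  · obtain ⟨y, h, h' | h'⟩ := exists_end hT hS hR.symm hx
    · exact ⟨y, false, h, h'.2, by grind⟩
    · exact ⟨y, true, h, h', by grind⟩
  · obtain ⟨y, h, h' | h'⟩ := exists_end hS hT hR hx
    · exact ⟨y, true, h, h'.2, by grind⟩
    · exact ⟨y, false, h, h', by grind⟩

end Involutions

/-- The `2k` vertices of a `k`-diagram: `inl i` is the `i`-th vertex of the top row and `inr j` the
`j`-th vertex of the bottom row. -/
abbrev Vert (k : ℕ) : Type := Fin k ⊕ Fin k

/-- The column of a vertex. -/
def col {k : ℕ} : Vert k → Fin k := Sum.elim (fun i => i) (fun i => i)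

/-- A partial Brauer `k`-diagram: a set partition (equivalence relation) of the `2k` vertices all of
whose blocks have at most two elements. -/
@[ext]
structure Diagram (k : ℕ) : Type where
  rel : Setoid (Vert k)
  block_le_two : ∀ u v w, rel u v → rel u w → u = v ∨ u = w ∨ v = w

namespace Diagram

variable {k : ℕ}

/-- The vertex `v` is isolated in `d`: its block is `{v}`. -/
def Isolated (d : Diagram k) (v : Vert k) : Prop := ∀ w, d.rel v w → w = v

/-- The identity diagram: in every column the top vertex is joined to the bottom vertex. -/
def one (k : ℕ) : Diagram k where
  rel := Setoid.ker col
  block_le_two := by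
    rintro (u | u) (v | v) (w | w) <;> simp [Setoid.ker_def, col] <;> grind

/-- The diagram `p_i`: both vertices of the `i`-th column are isolated, and in every other column
the top vertex is joined to the bottom vertex. -/
def p (i : Fin k) : Diagram k where
  rel :=
    { r := fun v w => v = w ∨ (col v = col w ∧ col v ≠ i)
      iseqv := ⟨fun _ => Or.inl rfl, by grind, by grind⟩ }
  block_le_two := by
    intro u v w h1 h2
    change _ ∨ _ at h1
    change _ ∨ _ at h2
    rcases u with u | u <;> rcases v with v | v <;> rcases w with w | w <;> simp [col] at h1 h2 ⊢ <;>
      grind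

/-- Vertices of the composite configuration: top row, middle row, bottom row. -/
abbrev Vert3 (k : ℕ) : Type := Fin k ⊕ (Fin k ⊕ Fin k)

/-- The inclusion of the vertices of the upper diagram. -/
def upper : Vert k → Vert3 k := Sum.elim Sum.inl (fun j => Sum.inr (Sum.inl j))

/-- The inclusion of the vertices of the lower diagram. -/
def lower : Vert k → Vert3 k := Sum.inr

/-- The inclusion of the top and bottom rows. -/
def outer : Vert k → Vert3 k := Sum.elim Sum.inl (fun j => Sum.inr (Sum.inr j))

/-- The partition into connected components of the composite configuration, obtained by placing `d₁`
above `d₂` and identifying the bottom row of `d₁` with the top row of `d₂`. -/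
def stack (d₁ d₂ : Diagram k) : Setoid (Vert3 k) :=
  Setoid.map d₁.rel upper ⊔ Setoid.map d₂.rel lower

/-- The components of the composite configuration that are closed loops in the middle row: they
contain only vertices of the middle row, each of which has an edge in both diagrams. -/
def loops (d₁ d₂ : Diagram k) : Set (Set (Vert3 k)) :=
  {c | c ∈ (stack d₁ d₂).classes ∧ ∀ x ∈ c, ∃ j : Fin k, x = Sum.inr (Sum.inl j) ∧
    ¬ d₁.Isolated (Sum.inr j) ∧ ¬ d₂.Isolated (Sum.inl j)}

/-- The number of closed loops in the middle row of the composite configuration. -/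
noncomputable def numLoops (d₁ d₂ : Diagram k) : ℕ := (loops d₁ d₂).ncard

open scoped Classical in
/-- The other vertex of the block of `v`, or `v` itself if `v` is isolated. -/
noncomputable def partner (d : Diagram k) (v : Vert k) : Vert k :=
  if h : ∃ w, d.rel v w ∧ w ≠ v then h.choose else v

theorem rel_partner (d : Diagram k) (v : Vert k) : d.rel v (d.partner v) := by
  unfold partner
  split_ifs with h
  · exact h.choose_spec.1
  · exact d.rel.refl v

theorem rel_iff (d : Diagram k) (v w : Vert k) : d.rel v w ↔ w = v ∨ w = d.partner v := by
  constructor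
  · intro h
    by_contra! hc
    have hp : d.partner v ≠ v := by
      unfold partner
      rw [dif_pos ⟨w, h, hc.1⟩]
      exact (Exists.choose_spec (⟨w, h, hc.1⟩ : ∃ w, d.rel v w ∧ w ≠ v)).2
    have := d.block_le_two v w _ h (d.rel_partner v)
    grind
  · rintro (rfl | rfl)
    · exact d.rel.refl _
    · exact d.rel_partner v

theorem isolated_iff (d : Diagram k) (v : Vert k) : d.Isolated v ↔ d.partner v = v := by
  constructor
  · intro h; exact h _ (d.rel_partner v)
  · intro h w hw
    rw [rel_iff, h] at hw
    grind

theorem partner_partner (d : Diagram k) (v : Vert k) : d.partner (d.partner v) = v := by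
  by_cases h : d.partner v = v
  · rw [h, h]
  · have := (d.rel_iff (d.partner v) v).1 (d.rel.symm (d.rel_partner v))
    grind

/-- The involution of the vertices of the composite configuration given by the upper diagram. -/
noncomputable def upPerm (d : Diagram k) : Equiv.Perm (Vert3 k) :=
  Function.Involutive.toPerm
    (fun x : Vert3 k => match x with
      | Sum.inl i => upper (d.partner (Sum.inl i))
      | Sum.inr (Sum.inl j) => upper (d.partner (Sum.inr j))
      | Sum.inr (Sum.inr l) => Sum.inr (Sum.inr l))
    (by
      rintro (i | j | l)
      · have := d.partner_partner (Sum.inl i)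
        rcases h : d.partner (Sum.inl i) with a | a <;> rw [h] at this <;> simp [upper, this, h]
      · have := d.partner_partner (Sum.inr j)
        rcases h : d.partner (Sum.inr j) with a | a <;> rw [h] at this <;> simp [upper, this, h]
      · rfl)

theorem upPerm_upper (d : Diagram k) (v : Vert k) : d.upPerm (upper v) = upper (d.partner v) := by
  rcases v with v | v <;> rfl

theorem upPerm_bot (d : Diagram k) (l : Fin k) :
    d.upPerm (Sum.inr (Sum.inr l)) = Sum.inr (Sum.inr l) := rfl

/-- The involution of the vertices of the composite configuration given by the lower diagram. -/
noncomputable def lowPerm (d : Diagram k) : Equiv.Perm (Vert3 k) :=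
  Function.Involutive.toPerm
    (fun x : Vert3 k => match x with
      | Sum.inl i => Sum.inl i
      | Sum.inr v => lower (d.partner v))
    (by
      rintro (i | v)
      · rfl
      · simp [lower, d.partner_partner v])

theorem lowPerm_lower (d : Diagram k) (v : Vert k) : d.lowPerm (lower v) = lower (d.partner v) := rfl

theorem lowPerm_top (d : Diagram k) (i : Fin k) : d.lowPerm (Sum.inl i) = Sum.inl i := rfl

theorem upPerm_sq (d : Diagram k) : d.upPerm * d.upPerm = 1 :=
  Equiv.ext fun x => Function.Involutive.toPerm_involutive _ x

theorem lowPerm_sq (d : Diagram k) : d.lowPerm * d.lowPerm = 1 :=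
  Equiv.ext fun x => Function.Involutive.toPerm_involutive _ x

theorem upper_injective : Function.Injective (upper (k := k)) := by
  rintro (a | a) (b | b) <;> simp [upper]

theorem outer_injective : Function.Injective (outer (k := k)) := by
  rintro (a | a) (b | b) <;> simp [outer]

theorem lower_injective : Function.Injective (lower (k := k)) := Sum.inr_injective

theorem stack_upper (d₁ d₂ : Diagram k) {v w : Vert k} (h : d₁.rel v w) :
    stack d₁ d₂ (upper v) (upper w) :=
  (le_sup_left : Setoid.map d₁.rel upper ≤ stack d₁ d₂) (Relation.EqvGen.rel _ _ ⟨v, w, h, rfl, rfl⟩)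

theorem stack_lower (d₁ d₂ : Diagram k) {v w : Vert k} (h : d₂.rel v w) :
    stack d₁ d₂ (lower v) (lower w) :=
  (le_sup_right : Setoid.map d₂.rel lower ≤ stack d₁ d₂) (Relation.EqvGen.rel _ _ ⟨v, w, h, rfl, rfl⟩)

theorem stack_le (d₁ d₂ : Diagram k) (R : Setoid (Vert3 k))
    (h1 : ∀ v w, d₁.rel v w → R (upper v) (upper w))
    (h2 : ∀ v w, d₂.rel v w → R (lower v) (lower w)) : stack d₁ d₂ ≤ R := by
  refine sup_le (Setoid.eqvGen_le ?_) (Setoid.eqvGen_le ?_)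
  · rintro _ _ ⟨v, w, h, rfl, rfl⟩; exact h1 v w h
  · rintro _ _ ⟨v, w, h, rfl, rfl⟩; exact h2 v w h

theorem isGen_stack (d₁ d₂ : Diagram k) : IsGen d₁.upPerm d₂.lowPerm (stack d₁ d₂) := by
  refine ⟨?_, ?_, ?_⟩
  · have key : ∀ v, stack d₁ d₂ (upper v) (d₁.upPerm (upper v)) := fun v => by
      rw [upPerm_upper]; exact stack_upper d₁ d₂ (d₁.rel_partner v)
    rintro (i | j | l)
    · exact key (Sum.inl i)
    · exact key (Sum.inr j)
    · exact (stack d₁ d₂).refl _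
  · rintro (i | v)
    · exact (stack d₁ d₂).refl _
    · exact stack_lower d₁ d₂ (d₂.rel_partner v)
  · intro R h1 h2
    refine stack_le d₁ d₂ R ?_ ?_
    · intro v w h
      rcases (d₁.rel_iff v w).1 h with rfl | rfl
      · exact R.refl _
      · rw [← upPerm_upper]; exact h1 _
    · intro v w h
      rcases (d₂.rel_iff v w).1 h with rfl | rfl
      · exact R.refl _
      · exact h2 (lower v)

/-- `y` is a vertex of the composite configuration which is isolated in one of the diagrams. -/
def DeadEnd (d₁ d₂ : Diagram k) (y : Vert3 k) (b : Bool) : Prop :=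
  bif b then ∃ v, y = upper v ∧ d₁.Isolated v else ∃ v, y = lower v ∧ d₂.Isolated v

theorem isEnd_iff (d₁ d₂ : Diagram k) (y : Vert3 k) (b : Bool) :
    IsEnd d₁.upPerm d₂.lowPerm y b ↔
      DeadEnd d₁ d₂ y b ∨ ∃ v, y = outer v ∧ v.isRight = b := by
  have e1 : ∀ v, d₁.upPerm (upper v) = upper v ↔ d₁.Isolated v := fun v => by
    rw [upPerm_upper, upper_injective.eq_iff, isolated_iff]
  have e2 : ∀ v, d₂.lowPerm (Sum.inr v) = Sum.inr v ↔ d₂.Isolated v := fun v => by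
    change d₂.lowPerm (lower v) = lower v ↔ _
    rw [lowPerm_lower, lower_injective.eq_iff, isolated_iff]
  rcases b
  · rcases y with i | v
    · simp [IsEnd, DeadEnd, lowPerm_top, outer]
    · have := e2 v
      simp [IsEnd, DeadEnd, lower, outer, this]
  · rcases y with i | j | l
    · have := e1 (Sum.inl i)
      simp only [upper, Sum.elim_inl] at this
      simp [IsEnd, DeadEnd, upper, outer, this]
    · have := e1 (Sum.inr j)
      simp only [upper, Sum.elim_inr] at this
      simp [IsEnd, DeadEnd, upper, outer, this]
    · simp [IsEnd, DeadEnd, upPerm_bot, outer]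

theorem outer_isEnd (d₁ d₂ : Diagram k) (v : Vert k) :
    IsEnd d₁.upPerm d₂.lowPerm (outer v) v.isRight :=
  (isEnd_iff d₁ d₂ _ _).2 (Or.inr ⟨v, rfl, rfl⟩)

/-- The product of the partition monoid: the connected components of the composite configuration,
restricted to the top and the bottom row. -/
def comp (d₁ d₂ : Diagram k) : Diagram k where
  rel := Setoid.comap outer (stack d₁ d₂)
  block_le_two := by
    intro u v w huv huw
    have := three_ends d₁.upPerm_sq d₂.lowPerm_sq (isGen_stack d₁ d₂) (outer_isEnd d₁ d₂ u)
      (outer_isEnd d₁ d₂ v) (outer_isEnd d₁ d₂ w) huv huw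
    simp only [Prod.mk.injEq, outer_injective.eq_iff] at this
    tauto

theorem comp_rel (d₁ d₂ : Diagram k) (v w : Vert k) :
    (comp d₁ d₂).rel v w ↔ stack d₁ d₂ (outer v) (outer w) := Iff.rfl

theorem deadEnd_ne {d₁ d₂ : Diagram k} {y : Vert3 k} {b : Bool} (h : DeadEnd d₁ d₂ y b)
    (v : Vert k) : (y, b) ≠ (outer v, v.isRight) := by
  rintro he
  simp only [Prod.mk.injEq] at he
  obtain ⟨rfl, rfl⟩ := he
  rcases v with v | v <;> simp [DeadEnd, outer, lower, upper] at h

/-- A component with a dead end has at most one outer vertex. -/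
theorem isolated_of_deadEnd {d₁ d₂ : Diagram k} {y : Vert3 k} {b : Bool} {v : Vert k}
    (h : DeadEnd d₁ d₂ y b) (hy : stack d₁ d₂ (outer v) y) : (comp d₁ d₂).Isolated v := by
  intro w hw
  by_contra hne
  have := three_ends d₁.upPerm_sq d₂.lowPerm_sq (isGen_stack d₁ d₂) (outer_isEnd d₁ d₂ v)
    (outer_isEnd d₁ d₂ w) ((isEnd_iff d₁ d₂ y b).2 (Or.inl h)) hw hy
  rcases this with h' | h' | h'
  · simp only [Prod.mk.injEq, outer_injective.eq_iff] at h'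
    exact hne h'.1.symm
  · exact deadEnd_ne h v h'.symm
  · exact deadEnd_ne h w h'.symm

/-- An isolated vertex of the composite is connected to a dead end. -/
theorem exists_deadEnd {d₁ d₂ : Diagram k} {v : Vert k} (h : (comp d₁ d₂).Isolated v) :
    ∃ y b, DeadEnd d₁ d₂ y b ∧ stack d₁ d₂ (outer v) y := by
  obtain ⟨y, b, hy, he, hne⟩ := second_end d₁.upPerm_sq d₂.lowPerm_sq (isGen_stack d₁ d₂)
    (outer_isEnd d₁ d₂ v)
  rcases (isEnd_iff d₁ d₂ y b).1 he with hd | ⟨w, rfl, rfl⟩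
  · exact ⟨y, b, hd, hy⟩
  · exact absurd (by rw [h w hy]) hne

/-- Colourings of the vertices which are constant on blocks and trivial on isolated vertices. -/
def Compat (d : Diagram k) (F : Vert k → Prop) : Prop :=
  (∀ v w, d.rel v w → (F v ↔ F w)) ∧ ∀ v, d.Isolated v → ¬ F v

theorem ext_of_compat {d e : Diagram k} (h : ∀ F, Compat d F ↔ Compat e F) : d = e := by
  have key : ∀ (d : Diagram k) (v w : Vert k), d.rel v w ↔
      v = w ∨ ((∀ F, Compat d F → (F v ↔ F w)) ∧ ∃ F, Compat d F ∧ F v) := by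
    intro d v w
    have hc : ¬ d.Isolated v → Compat d (fun x => d.rel v x) := fun hv =>
      ⟨fun a b hab => ⟨fun h => d.rel.trans h hab, fun h => d.rel.trans h (d.rel.symm hab)⟩,
        fun a ha hva => hv (by rw [← ha v (d.rel.symm hva)] at ha; exact ha)⟩
    constructor
    · intro hvw
      by_cases hne : v = w
      · exact Or.inl hne
      · have hv : ¬ d.Isolated v := fun hi => hne (hi w hvw).symm
        exact Or.inr ⟨fun F hF => hF.1 v w hvw, _, hc hv, d.rel.refl v⟩
    · rintro (rfl | ⟨h1, F, hF, hv⟩)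
      · exact d.rel.refl v
      · exact (h1 _ (hc fun hi => hF.2 v hi hv)).1 (d.rel.refl v)
  ext v w
  rw [key d, key e]
  simp only [h]

open scoped Classical in
/-- The matrix of a diagram acting on colourings of the rows. -/
noncomputable def tens (d : Diagram k) : Matrix (Fin k → Prop) (Fin k → Prop) ℕ :=
  fun f g => if Compat d (Sum.elim f g) then 1 else 0

/-- The middle vertex of index `j`. -/
abbrev mid (j : Fin k) : Vert3 k := Sum.inr (Sum.inl j)

theorem mem_loops_iff (d₁ d₂ : Diagram k) (c : Set (Vert3 k)) : c ∈ loops d₁ d₂ ↔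
    c ∈ (stack d₁ d₂).classes ∧ (∀ v, outer v ∉ c) ∧ ∀ y b, DeadEnd d₁ d₂ y b → y ∉ c := by
  constructor
  · rintro ⟨h1, h2⟩
    refine ⟨h1, fun v hv => ?_, fun y b hy hyc => ?_⟩
    · obtain ⟨j, hj, -⟩ := h2 _ hv
      rcases v with v | v <;> simp [outer] at hj
    · obtain ⟨j, rfl, hj1, hj2⟩ := h2 _ hyc
      cases b
      · obtain ⟨v, hv, hi⟩ := hy
        simp only [lower, Sum.inr.injEq] at hv
        exact hj2 (hv ▸ hi)
      · obtain ⟨v, hv, hi⟩ := hy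
        rcases v with v | v <;> simp [upper] at hv
        exact hj1 (hv ▸ hi)
  · rintro ⟨h1, h2, h3⟩
    refine ⟨h1, fun x hx => ?_⟩
    rcases x with i | j | l
    · exact absurd hx (h2 (Sum.inl i))
    · exact ⟨j, rfl, fun hi => h3 (mid j) true ⟨Sum.inr j, rfl, hi⟩ hx,
        fun hi => h3 (mid j) false ⟨Sum.inl j, rfl, hi⟩ hx⟩
    · exact absurd hx (h2 (Sum.inr l))

theorem mem_of_rel {R : Setoid (Vert3 k)} {c : Set (Vert3 k)} (hc : c ∈ R.classes) {x y : Vert3 k}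
    (hx : x ∈ c) (h : R x y) : y ∈ c := by
  obtain ⟨z, rfl⟩ := hc
  exact R.trans (R.symm h) hx

theorem compat_stack {d₁ d₂ : Diagram k} {f h g : Fin k → Prop} (h1 : Compat d₁ (Sum.elim f h))
    (h2 : Compat d₂ (Sum.elim h g)) :
    (∀ x y, stack d₁ d₂ x y → (Sum.elim f (Sum.elim h g) x ↔ Sum.elim f (Sum.elim h g) y)) ∧
      ∀ y b, DeadEnd d₁ d₂ y b → ¬ Sum.elim f (Sum.elim h g) y := by
  have e1 : ∀ v, Sum.elim f (Sum.elim h g) (upper v) = Sum.elim f h v := by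
    rintro (v | v) <;> rfl
  have e2 : ∀ v, Sum.elim f (Sum.elim h g) (lower v) = Sum.elim h g v := fun v => rfl
  constructor
  · intro x y hxy
    refine stack_le d₁ d₂ ⟨fun x y => (Sum.elim f (Sum.elim h g) x ↔ Sum.elim f (Sum.elim h g) y),
      ⟨fun _ => Iff.rfl, Iff.symm, Iff.trans⟩⟩ ?_ ?_ hxy
    · intro v w hvw
      change _ ↔ _
      rw [e1, e1]; exact h1.1 v w hvw
    · intro v w hvw
      exact h2.1 v w hvw
  · rintro y (_ | _) ⟨v, rfl, hv⟩
    · exact h2.2 v hv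
    · rw [e1]; exact h1.2 v hv

theorem elim_outer (f h g : Fin k → Prop) (v : Vert k) :
    Sum.elim f (Sum.elim h g) (outer v) = Sum.elim f g v := by
  rcases v with v | v <;> rfl

theorem compat_comp {d₁ d₂ : Diagram k} {f h g : Fin k → Prop} (h1 : Compat d₁ (Sum.elim f h))
    (h2 : Compat d₂ (Sum.elim h g)) : Compat (comp d₁ d₂) (Sum.elim f g) := by
  obtain ⟨h3, h4⟩ := compat_stack h1 h2
  constructor
  · intro v w hvw
    have := h3 _ _ hvw
    rwa [elim_outer, elim_outer] at this
  · intro v hv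
    obtain ⟨y, b, hy, hvy⟩ := exists_deadEnd hv
    have := h4 y b hy
    rwa [← h3 _ _ hvy, elim_outer] at this

theorem ncard_compat {d₁ d₂ : Diagram k} {f g : Fin k → Prop}
    (hfg : Compat (comp d₁ d₂) (Sum.elim f g)) :
    {h | Compat d₁ (Sum.elim f h) ∧ Compat d₂ (Sum.elim h g)}.ncard = 2 ^ numLoops d₁ d₂ := by
  rw [numLoops, ← Set.ncard_powerset]
  symm
  set G : Set (Set (Vert3 k)) → Vert3 k → Prop := fun χ x =>
    (∃ c ∈ χ, x ∈ c) ∨ ∃ v, stack d₁ d₂ (outer v) x ∧ Sum.elim f g v with hG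
  have Grel : ∀ χ ⊆ loops d₁ d₂, ∀ x y, stack d₁ d₂ x y → G χ x → G χ y := by
    rintro χ hχ x y hxy (⟨c, hc, hx⟩ | ⟨v, hv, hv2⟩)
    · exact Or.inl ⟨c, hc, mem_of_rel (hχ hc).1 hx hxy⟩
    · exact Or.inr ⟨v, (stack d₁ d₂).trans hv hxy, hv2⟩
  have Grel2 : ∀ χ ⊆ loops d₁ d₂, ∀ x y, stack d₁ d₂ x y → (G χ x ↔ G χ y) := fun χ hχ x y h =>
    ⟨Grel χ hχ x y h, Grel χ hχ y x ((stack d₁ d₂).symm h)⟩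
  have Gout : ∀ χ ⊆ loops d₁ d₂, ∀ v, G χ (outer v) ↔ Sum.elim f g v := by
    intro χ hχ v
    constructor
    · rintro (⟨c, hc, hx⟩ | ⟨w, hw, hw2⟩)
      · exact absurd hx (((mem_loops_iff _ _ _).1 (hχ hc)).2.1 v)
      · exact (hfg.1 w v hw).1 hw2
    · exact fun h => Or.inr ⟨v, (stack d₁ d₂).refl _, h⟩
  have Gdead : ∀ χ ⊆ loops d₁ d₂, ∀ y b, DeadEnd d₁ d₂ y b → ¬ G χ y := by
    rintro χ hχ y b hy (⟨c, hc, hx⟩ | ⟨w, hw, hw2⟩)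
    · exact ((mem_loops_iff _ _ _).1 (hχ hc)).2.2 y b hy hx
    · exact hfg.2 w (isolated_of_deadEnd hy hw) hw2
  refine Set.ncard_congr (fun χ _ j => G χ (mid j)) ?_ ?_ ?_
  · intro χ hχ
    have eu : ∀ v, Sum.elim f (fun j => G χ (mid j)) v ↔ G χ (upper v) := by
      rintro (v | v)
      · exact (Gout χ hχ (Sum.inl v)).symm
      · exact Iff.rfl
    have el : ∀ v, Sum.elim (fun j => G χ (mid j)) g v ↔ G χ (lower v) := by
      rintro (v | v)
      · exact Iff.rfl
      · exact (Gout χ hχ (Sum.inr v)).symm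
    refine ⟨⟨fun v w h => ?_, fun v hv => ?_⟩, ⟨fun v w h => ?_, fun v hv => ?_⟩⟩
    · rw [eu, eu]; exact Grel2 χ hχ _ _ (stack_upper d₁ d₂ h)
    · rw [eu]; exact Gdead χ hχ _ true ⟨v, rfl, hv⟩
    · rw [el, el]; exact Grel2 χ hχ _ _ (stack_lower d₁ d₂ h)
    · rw [el]; exact Gdead χ hχ _ false ⟨v, rfl, hv⟩
  · intro χ χ' hχ hχ' heq
    have aux : ∀ χ χ' : Set (Set (Vert3 k)), χ ⊆ loops d₁ d₂ → χ' ⊆ loops d₁ d₂ →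
        (fun j => G χ (mid j)) = (fun j => G χ' (mid j)) → χ ⊆ χ' := by
      intro χ χ' hχ hχ' heq c hc
      have hcl := hχ hc
      obtain ⟨x, hx⟩ : c.Nonempty := by
        obtain ⟨z, rfl⟩ := hcl.1
        exact ⟨z, (stack d₁ d₂).refl z⟩
      obtain ⟨j, rfl, -⟩ := hcl.2 x hx
      have hj : G χ' (mid j) := by
        rw [← congrFun heq j]; exact Or.inl ⟨c, hc, hx⟩
      rcases hj with ⟨c', hc', hx'⟩ | ⟨v, hv, -⟩
      · rwa [Setoid.eq_of_mem_classes hcl.1 hx (hχ' hc').1 hx']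
      · exact absurd (mem_of_rel hcl.1 hx ((stack d₁ d₂).symm hv))
          (((mem_loops_iff _ _ _).1 hcl).2.1 v)
    exact (aux χ χ' hχ hχ' heq).antisymm (aux χ' χ hχ' hχ heq.symm)
  · rintro h ⟨h1, h2⟩
    obtain ⟨h3, h4⟩ := compat_stack h1 h2
    refine ⟨{c | c ∈ loops d₁ d₂ ∧ ∃ x ∈ c, Sum.elim f (Sum.elim h g) x}, fun c hc => hc.1, ?_⟩
    funext j
    refine propext ⟨?_, fun hj => ?_⟩
    · rintro (⟨c, ⟨hc, x, hx, hx2⟩, hj⟩ | ⟨v, hv, hv2⟩)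
      · have hrel : stack d₁ d₂ x (mid j) := by
          obtain ⟨z, rfl⟩ := hc.1
          exact (stack d₁ d₂).trans hx ((stack d₁ d₂).symm hj)
        exact (h3 _ _ hrel).1 hx2
      · rw [← elim_outer f h g] at hv2
        exact (h3 _ _ hv).1 hv2
    · by_cases hv : ∃ v, stack d₁ d₂ (outer v) (mid j)
      · obtain ⟨v, hv⟩ := hv
        refine Or.inr ⟨v, hv, ?_⟩
        rw [← elim_outer f h g, h3 _ _ hv]
        exact hj
      · left
        refine ⟨{y | stack d₁ d₂ y (mid j)}, ⟨(mem_loops_iff _ _ _).2 ⟨⟨_, rfl⟩, ?_, ?_⟩, ?_⟩, ?_⟩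
        · exact fun v hv' => hv ⟨v, hv'⟩
        · intro y b hy hy2
          exact h4 y b hy ((h3 _ _ hy2).2 hj)
        · exact ⟨mid j, (stack d₁ d₂).refl _, hj⟩
        · exact (stack d₁ d₂).refl _

theorem tens_mul (d₁ d₂ : Diagram k) :
    tens d₁ * tens d₂ = 2 ^ numLoops d₁ d₂ • tens (comp d₁ d₂) := by
  classical
  ext f g
  have : (tens d₁ * tens d₂) f g =
      {h | Compat d₁ (Sum.elim f h) ∧ Compat d₂ (Sum.elim h g)}.ncard := by
    rw [Matrix.mul_apply, Set.ncard_eq_toFinset_card', Finset.card_eq_sum_ones,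
      Set.toFinset_ofPred, Finset.sum_filter]
    refine Finset.sum_congr rfl fun h _ => ?_
    simp only [tens]
    split_ifs <;> simp_all
  rw [this, Matrix.smul_apply]
  simp only [tens]
  split_ifs with hfg
  · rw [ncard_compat hfg]; simp
  · rw [smul_zero, Set.ncard_eq_zero]
    ext h
    simp only [Set.mem_ofPred_eq, Set.mem_empty_iff_false, iff_false]
    rintro ⟨h1, h2⟩
    exact hfg (compat_comp h1 h2)

theorem compat_false (d : Diagram k) :
    Compat d (Sum.elim (fun _ : Fin k => False) (fun _ : Fin k => False)) := by
  have : ∀ v, ¬ (Sum.elim (fun _ : Fin k => False) (fun _ : Fin k => False)) v := by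
    rintro (v | v) <;> simp
  exact ⟨fun v w _ => by simp [this], fun v _ => this v⟩

/-- A diagram and a power of the loop parameter can be read off from the matrix. -/
theorem tens_inj {d e : Diagram k} {m n : ℕ} (h : 2 ^ m • tens d = 2 ^ n • tens e) :
    m = n ∧ d = e := by
  have h0 := congrFun (congrFun h (fun _ => False)) (fun _ => False)
  simp only [Matrix.smul_apply, tens, compat_false, if_true, smul_eq_mul, mul_one] at h0
  have hmn := Nat.pow_right_injective (le_refl 2) h0
  refine ⟨hmn, ext_of_compat fun F => ?_⟩
  subst hmn
  have h1 := congrFun (congrFun h (fun i => F (Sum.inl i))) (fun i => F (Sum.inr i))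
  have hF : Sum.elim (fun i => F (Sum.inl i)) (fun i => F (Sum.inr i)) = F := by
    ext (v | v) <;> rfl
  simp only [Matrix.smul_apply, tens, hF, smul_eq_mul] at h1
  have h2 := Nat.eq_of_mul_eq_mul_left (by positivity) h1
  split_ifs at h2 <;> simp_all

theorem comp_assoc (a b c : Diagram k) :
    numLoops a b + numLoops (comp a b) c = numLoops b c + numLoops a (comp b c) ∧
      comp (comp a b) c = comp a (comp b c) := by
  refine tens_inj ?_
  have := mul_assoc (tens a) (tens b) (tens c)
  rw [tens_mul, tens_mul, smul_mul_assoc, mul_smul_comm, tens_mul, tens_mul, smul_smul, smul_smul,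
    ← pow_add, ← pow_add] at this
  exact this

open scoped Classical in
theorem tens_one : tens (one k) = 1 := by
  ext f g
  have : Compat (one k) (Sum.elim f g) ↔ f = g := by
    constructor
    · intro h
      funext i
      exact propext (h.1 (Sum.inl i) (Sum.inr i) rfl)
    · rintro rfl
      constructor
      · rintro (v | v) (w | w) h <;> obtain rfl : v = w := h <;> rfl
      · rintro (v | v) h
        · exact absurd (h (Sum.inr v) rfl) (by simp)
        · exact absurd (h (Sum.inl v) rfl) (by simp)
  simp only [tens, this, Matrix.one_apply]

theorem one_comp (d : Diagram k) : numLoops (one k) d = 0 ∧ comp (one k) d = d := by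
  classical
  refine tens_inj ?_
  rw [← tens_mul, tens_one, one_mul, pow_zero, one_smul]

theorem comp_one (d : Diagram k) : numLoops d (one k) = 0 ∧ comp d (one k) = d := by
  classical
  refine tens_inj ?_
  rw [← tens_mul, tens_one, mul_one, pow_zero, one_smul]

/-- The diagram obtained from `d` by removing the edge at `v`, if there is one. -/
def cut (d : Diagram k) (v : Vert k) : Diagram k where
  rel :=
    { r := fun a b => a = b ∨ (d.rel a b ∧ ¬ d.rel a v)
      iseqv := ⟨fun _ => Or.inl rfl,
        fun {a b} h => h.elim (fun h => Or.inl h.symm) fun h => Or.inr ⟨d.rel.symm h.1,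
          fun h2 => h.2 (d.rel.trans h.1 h2)⟩,
        fun {a b c} h h' => by
          rcases h with rfl | h
          · exact h'
          · rcases h' with rfl | h'
            · exact Or.inr h
            · exact Or.inr ⟨d.rel.trans h.1 h'.1, h.2⟩⟩ }
  block_le_two := by
    rintro a b c (h | h) (h' | h')
    · exact Or.inl h
    · exact Or.inl h
    · exact Or.inr (Or.inl h')
    · exact d.block_le_two a b c h.1 h'.1

theorem cut_rel (d : Diagram k) (v a b : Vert k) :
    (d.cut v).rel a b ↔ a = b ∨ (d.rel a b ∧ ¬ d.rel a v) := Iff.rfl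

theorem compat_cut (d : Diagram k) (v : Vert k) (F : Vert k → Prop) :
    Compat (d.cut v) F ↔ Compat d F ∧ ¬ F v := by
  have iso : ∀ a, d.rel a v → (d.cut v).Isolated a := by
    rintro a ha b (h | h)
    · exact h.symm
    · exact absurd ha h.2
  constructor
  · rintro ⟨h1, h2⟩
    refine ⟨⟨fun a b hab => ?_, fun a ha => h2 a fun b hb => ?_⟩, h2 v (iso v (d.rel.refl v))⟩
    · by_cases hv : d.rel a v
      · exact iff_of_false (h2 a (iso a hv)) (h2 b (iso b (d.rel.trans (d.rel.symm hab) hv)))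
      · exact h1 a b (Or.inr ⟨hab, hv⟩)
    · rcases hb with hb | hb
      · exact hb.symm
      · exact ha b hb.1
  · rintro ⟨⟨h1, h2⟩, h3⟩
    refine ⟨fun a b hab => ?_, fun a ha => ?_⟩
    · rcases hab with rfl | hab
      · rfl
      · exact h1 a b hab.1
    · by_cases hv : d.rel a v
      · rwa [h1 a v hv]
      · exact h2 a fun b hb => ha b (Or.inr ⟨hb, hv⟩)

theorem compat_p (i : Fin k) (f g : Fin k → Prop) :
    Compat (p i) (Sum.elim f g) ↔ f = g ∧ ¬ f i := by
  have hiso : ∀ v : Vert k, col v = i → (p i).Isolated v := by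
    rintro v hv w (h | h)
    · exact h.symm
    · exact absurd hv h.2
  constructor
  · intro h
    have h1 := h.2 (Sum.inl i) (hiso _ rfl)
    have h2 := h.2 (Sum.inr i) (hiso _ rfl)
    refine ⟨funext fun a => propext ?_, h1⟩
    by_cases ha : a = i
    · subst ha; exact iff_of_false h1 h2
    · exact h.1 (Sum.inl a) (Sum.inr a) (Or.inr ⟨rfl, ha⟩)
  · rintro ⟨rfl, hi⟩
    have hf : ∀ v, Sum.elim f f v = f (col v) := by rintro (v | v) <;> rfl
    refine ⟨fun v w h => ?_, fun v hv => ?_⟩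
    · rcases h with rfl | h
      · rfl
      · rw [hf, hf, h.1]
    · rw [hf]
      by_cases hc : col v = i
      · rwa [hc]
      · rcases v with v | v
        · exact absurd (hv (Sum.inr v) (Or.inr ⟨rfl, hc⟩)) (by simp)
        · exact absurd (hv (Sum.inl v) (Or.inr ⟨rfl, hc⟩)) (by simp)

theorem p_comp (i : Fin k) (d : Diagram k) :
    numLoops (p i) d = 0 ∧ comp (p i) d = d.cut (Sum.inl i) := by
  classical
  refine tens_inj ?_
  rw [← tens_mul, pow_zero, one_smul]
  ext f g
  rw [Matrix.mul_apply, Finset.sum_eq_single f]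
  · simp only [tens, compat_p, compat_cut, Sum.elim_inl]
    split_ifs <;> simp_all
  · intro h _ hne
    simp [tens, compat_p, hne.symm]
  · simp

theorem comp_p (i : Fin k) (d : Diagram k) :
    numLoops d (p i) = 0 ∧ comp d (p i) = d.cut (Sum.inr i) := by
  classical
  refine tens_inj ?_
  rw [← tens_mul, pow_zero, one_smul]
  ext f g
  rw [Matrix.mul_apply, Finset.sum_eq_single g]
  · simp only [tens, compat_p, compat_cut, Sum.elim_inr]
    split_ifs <;> simp_all
  · intro h _ hne
    simp [tens, compat_p, hne]
  · simp

/-- The position of a vertex on the boundary of the rectangle, run through clockwise starting from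
the top left corner: the top row from left to right, then the bottom row from right to left. -/
def pos : Vert k → ℕ := Sum.elim (fun i => i) (fun j => 2 * k - 1 - j)

/-- A diagram is planar if it can be drawn in the rectangle without intersections: no two different
blocks interleave along the boundary. -/
def IsPlanar (d : Diagram k) : Prop :=
  ∀ a b c e : Vert k, pos a < pos b → pos b < pos c → pos c < pos e →
    d.rel a c → d.rel b e → d.rel a b

theorem pos_injective : Function.Injective (pos (k := k)) := by
  rintro (a | a) (b | b) h <;> simp [pos] at h ⊢ <;> omega

theorem pos_inl_lt_inl (a b : Fin k) : pos (Sum.inl a : Vert k) < pos (Sum.inl b : Vert k) ↔ a < b := by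
  simp [pos]

theorem pos_inr_lt_inr (a b : Fin k) : pos (Sum.inr a : Vert k) < pos (Sum.inr b : Vert k) ↔ b < a := by
  simp [pos]; omega

theorem pos_inl_lt_inr (a b : Fin k) : pos (Sum.inl a : Vert k) < pos (Sum.inr b : Vert k) := by
  simp [pos]; omega

theorem pos_inr_not_lt_inl (a b : Fin k) :
    ¬ pos (Sum.inr a : Vert k) < pos (Sum.inl b : Vert k) := by
  simp [pos]; omega

/-- The number modulo two of pairs `(x, y)` in `P × Q` such that `y` comes before `x`. -/
def cross (P Q : Finset (Vert k)) : ZMod 2 :=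
  ∑ x ∈ P, ∑ y ∈ Q, if pos y < pos x then 1 else 0

/-- The number modulo two of pairs `(i, j)` in `P × Q` such that `j < i`. -/
def inv (P Q : Finset (Fin k)) : ZMod 2 := ∑ x ∈ P, ∑ y ∈ Q, if y < x then 1 else 0

theorem cross_disjSum (A B C D : Finset (Fin k)) :
    cross (A.disjSum B) (C.disjSum D) = inv A C + B.card * C.card + inv D B := by
  have : inv D B = ∑ x ∈ B, ∑ y ∈ D, if x < y then 1 else 0 := Finset.sum_comm
  rw [this]
  simp only [cross, inv, Finset.sum_disjSum, pos_inl_lt_inl, pos_inr_lt_inr, pos_inl_lt_inr,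
    pos_inr_not_lt_inl, if_true, if_false, Finset.sum_const_zero, Finset.sum_add_distrib,
    Finset.sum_const, nsmul_eq_mul, mul_one]
  ring

theorem inv_add_inv (A B : Finset (Fin k)) (h : Disjoint A B) :
    inv A B + inv B A = A.card * B.card := by
  have : inv B A = ∑ x ∈ A, ∑ y ∈ B, if x < y then 1 else 0 := Finset.sum_comm
  rw [this, inv, ← Finset.sum_add_distrib]
  have : ∀ x ∈ A, ((∑ y ∈ B, if y < x then 1 else 0) + (∑ y ∈ B, if x < y then 1 else 0) : ZMod 2)
      = B.card := by
    intro x hx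
    rw [← Finset.sum_add_distrib, Finset.card_eq_sum_ones, Nat.cast_sum]
    refine Finset.sum_congr rfl fun y hy => ?_
    have hne : x ≠ y := fun h' => Finset.disjoint_left.1 h hx (h' ▸ hy)
    rcases lt_or_gt_of_ne hne with hl | hl <;> simp [hl, hl.le]
  rw [Finset.sum_congr rfl this, Finset.sum_const, nsmul_eq_mul]

theorem card_even {d : Diagram k} {A B : Finset (Fin k)}
    (h : ∀ v ∈ A.disjSum B, d.partner v ∈ A.disjSum B ∧ d.partner v ≠ v) :
    (A.card + B.card : ZMod 2) = 0 := by
  have : ∑ v ∈ A.disjSum B, (1 : ZMod 2) = 0 := by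
    refine Finset.sum_involution (fun v _ => d.partner v) ?_ ?_ ?_ ?_
    · intro v _; decide
    · intro v hv _; exact (h v hv).2
    · intro v hv; exact (h v hv).1
    · intro v _; exact d.partner_partner v
  rw [Finset.sum_const, Finset.card_disjSum] at this
  simpa using this

theorem no_cross {a b c e : ℕ} (n1 : a ≠ b) (n2 : a ≠ e) (n3 : c ≠ b) (n4 : c ≠ e)
    (h1 : ¬ (a < b ∧ b < c ∧ c < e)) (h2 : ¬ (a < e ∧ e < c ∧ c < b))
    (h3 : ¬ (c < b ∧ b < a ∧ a < e)) (h4 : ¬ (c < e ∧ e < a ∧ a < b))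
    (h5 : ¬ (b < a ∧ a < e ∧ e < c)) (h6 : ¬ (b < c ∧ c < e ∧ e < a))
    (h7 : ¬ (e < a ∧ a < b ∧ b < c)) (h8 : ¬ (e < c ∧ c < b ∧ b < a)) :
    (((if b < a then 1 else 0) + (if b < c then 1 else 0)) +
      ((if e < a then 1 else 0) + (if e < c then 1 else 0)) : ZMod 2) = 0 := by
  split_ifs <;> first | decide | grind

theorem cross_eq_zero {d : Diagram k} (hd : d.IsPlanar) {P Q : Finset (Vert k)}
    (hP : ∀ v ∈ P, d.partner v ∈ P ∧ d.partner v ≠ v)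
    (hQ : ∀ v ∈ Q, d.partner v ∈ Q ∧ d.partner v ≠ v) (hPQ : Disjoint P Q) : cross P Q = 0 := by
  refine Finset.sum_involution (fun v _ => d.partner v) ?_ ?_ ?_ ?_
  · intro x hx
    rw [← Finset.sum_add_distrib]
    refine Finset.sum_involution (fun v _ => d.partner v) ?_ ?_ ?_ ?_
    · intro y hy
      have n : ∀ a ∈ P, ∀ b ∈ Q, pos a ≠ pos b := fun a ha b hb h =>
        Finset.disjoint_left.1 hPQ ha (pos_injective h ▸ hb)
      have n1 := n x hx y hy
      have n2 := n x hx _ (hQ y hy).1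
      have n3 := n _ (hP x hx).1 y hy
      have n4 := n _ (hP x hx).1 _ (hQ y hy).1
      have r1 := d.rel_partner x
      have r2 := d.rel.symm r1
      have r3 := d.rel_partner y
      have r4 := d.rel.symm r3
      have nr : ¬ d.rel x y := by
        intro h
        rcases (d.rel_iff x y).1 h with rfl | rfl
        · exact n1 rfl
        · exact n3 rfl
      have m1 : ¬ d.rel x (d.partner y) := fun h => nr (d.rel.trans h r4)
      have m2 : ¬ d.rel (d.partner x) y := fun h => nr (d.rel.trans r1 h)
      have m3 : ¬ d.rel (d.partner x) (d.partner y) := fun h => m2 (d.rel.trans h r4)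
      exact no_cross n1 n2 n3 n4
        (fun h => nr (hd x y (d.partner x) (d.partner y) h.1 h.2.1 h.2.2 r1 r3))
        (fun h => m1 (hd x (d.partner y) (d.partner x) y h.1 h.2.1 h.2.2 r1 r4))
        (fun h => m2 (hd (d.partner x) y x (d.partner y) h.1 h.2.1 h.2.2 r2 r3))
        (fun h => m3 (hd (d.partner x) (d.partner y) x y h.1 h.2.1 h.2.2 r2 r4))
        (fun h => nr (d.rel.symm (hd y x (d.partner y) (d.partner x) h.1 h.2.1 h.2.2 r3 r1)))
        (fun h => m2 (d.rel.symm (hd y (d.partner x) (d.partner y) x h.1 h.2.1 h.2.2 r3 r2)))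
        (fun h => m1 (d.rel.symm (hd (d.partner y) x y (d.partner x) h.1 h.2.1 h.2.2 r4 r1)))
        (fun h => m3 (d.rel.symm (hd (d.partner y) (d.partner x) y x h.1 h.2.1 h.2.2 r4 r2)))
    · intro y hy _; exact (hQ y hy).2
    · intro y hy; exact (hQ y hy).1
    · intro y _; exact d.partner_partner y
  · intro x hx _; exact (hP x hx).2
  · intro x hx; exact (hP x hx).1
  · intro x _; exact d.partner_partner x

theorem one_isPlanar : (one k).IsPlanar := by
  intro a b c e h1 h2 h3 h4 h5
  change col a = col c at h4
  change col b = col e at h5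
  change col a = col b
  rcases a with a | a <;> rcases b with b | b <;> rcases c with c | c <;> rcases e with e | e <;>
    simp [pos, col, Fin.ext_iff] at * <;> grind

open scoped Classical in
theorem comp_isPlanar {d₁ d₂ : Diagram k} (h₁ : d₁.IsPlanar) (h₂ : d₂.IsPlanar) :
    (comp d₁ d₂).IsPlanar := by
  intro a b c e hab hbc hce hac hbe
  by_contra hn
  set R := stack d₁ d₂ with hR
  let K : Vert k → Vert3 k → Prop := fun v x => R (outer v) x
  let KA : Vert k → Finset (Fin k) := fun v => {i | K v (Sum.inl i)}
  let KB : Vert k → Finset (Fin k) := fun v => {i | K v (Sum.inr (Sum.inl i))}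
  let KC : Vert k → Finset (Fin k) := fun v => {i | K v (Sum.inr (Sum.inr i))}
  have hAB : ∀ v x, x ∈ (KA v).disjSum (KB v) ↔ K v (upper x) := by
    rintro v (x | x) <;> simp [KA, KB, upper]
  have hBC : ∀ v x, x ∈ (KB v).disjSum (KC v) ↔ K v (lower x) := by
    rintro v (x | x) <;> simp [KC, KB, lower]
  have hAC : ∀ v x, x ∈ (KA v).disjSum (KC v) ↔ (comp d₁ d₂).rel v x := by
    rintro v (x | x)
    · simp only [KA, Finset.inl_mem_disjSum, Finset.mem_filter_univ]; rfl
    · simp only [KC, Finset.inr_mem_disjSum, Finset.mem_filter_univ]; rfl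
  have nodead : ∀ v w, v ≠ w → (comp d₁ d₂).rel v w → ∀ y b, K v y → ¬ DeadEnd d₁ d₂ y b :=
    fun v w hvw hr y b hy hdead => hvw ((isolated_of_deadEnd hdead hy) w hr).symm
  have p1 : ∀ v w, v ≠ w → (comp d₁ d₂).rel v w → ∀ x ∈ (KA v).disjSum (KB v),
      d₁.partner x ∈ (KA v).disjSum (KB v) ∧ d₁.partner x ≠ x := by
    intro v w hvw hr x hx
    rw [hAB] at hx ⊢
    refine ⟨R.trans hx (stack_upper d₁ d₂ (d₁.rel_partner x)), fun h => ?_⟩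
    exact nodead v w hvw hr _ true hx ⟨x, rfl, (d₁.isolated_iff x).2 h⟩
  have p2 : ∀ v w, v ≠ w → (comp d₁ d₂).rel v w → ∀ x ∈ (KB v).disjSum (KC v),
      d₂.partner x ∈ (KB v).disjSum (KC v) ∧ d₂.partner x ≠ x := by
    intro v w hvw hr x hx
    rw [hBC] at hx ⊢
    refine ⟨R.trans hx (stack_lower d₁ d₂ (d₂.rel_partner x)), fun h => ?_⟩
    exact nodead v w hvw hr _ false hx ⟨x, rfl, (d₂.isolated_iff x).2 h⟩
  have hdisj : ∀ x, K a x → K b x → False := fun x h1 h2 => hn (R.trans h1 (R.symm h2))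
  have dAB : Disjoint ((KA a).disjSum (KB a)) ((KA b).disjSum (KB b)) := by
    rw [Finset.disjoint_left]; intro x h1 h2
    rw [hAB] at h1 h2; exact hdisj _ h1 h2
  have dBC : Disjoint ((KB a).disjSum (KC a)) ((KB b).disjSum (KC b)) := by
    rw [Finset.disjoint_left]; intro x h1 h2
    rw [hBC] at h1 h2; exact hdisj _ h1 h2
  have dB : Disjoint (KB a) (KB b) := by
    rw [Finset.disjoint_left]; intro x h1 h2
    simp only [KB, Finset.mem_filter_univ] at h1 h2
    exact hdisj _ h1 h2
  have hac' : a ≠ c := by rintro rfl; omega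
  have hbe' : b ≠ e := by rintro rfl; omega
  have c1 := cross_eq_zero h₁ (p1 a c hac' hac) (p1 b e hbe' hbe) dAB
  have c2 := cross_eq_zero h₂ (p2 a c hac' hac) (p2 b e hbe' hbe) dBC
  have e1 := card_even (p1 a c hac' hac)
  have e2 := card_even (p2 a c hac' hac)
  have e3 := card_even (p1 b e hbe' hbe)
  have e4 := card_even (p2 b e hbe' hbe)
  have hB := inv_add_inv _ _ dB
  rw [cross_disjSum] at c1 c2
  have c3 : cross ((KA a).disjSum (KC a)) ((KA b).disjSum (KC b)) = 0 := by
    rw [cross_disjSum]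
    generalize (inv (KA a) (KA b)) = x1 at *
    generalize (inv (KB a) (KB b)) = x2 at *
    generalize (inv (KB b) (KB a)) = x3 at *
    generalize (inv (KC b) (KC a)) = x4 at *
    generalize ((KA a).card : ZMod 2) = y1 at *
    generalize ((KB a).card : ZMod 2) = y2 at *
    generalize ((KC a).card : ZMod 2) = y3 at *
    generalize ((KA b).card : ZMod 2) = z1 at *
    generalize ((KB b).card : ZMod 2) = z2 at *
    generalize ((KC b).card : ZMod 2) = z3 at *
    clear * - c1 c2 e1 e2 e3 e4 hB
    have two : (2 : ZMod 2) = 0 := by decide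
    linear_combination c1 + c2 - hB + (z1 - z2) * e2 - y2 * z1 * two
  have s1 : (KA a).disjSum (KC a) = {a, c} := by
    ext x
    rw [hAC]
    constructor
    · intro hx
      have := (comp d₁ d₂).block_le_two a c x hac hx
      simp only [Finset.mem_insert, Finset.mem_singleton]
      exact this.elim (fun h => absurd h hac') (Or.imp Eq.symm Eq.symm)
    · simp only [Finset.mem_insert, Finset.mem_singleton]
      rintro (rfl | rfl)
      · exact (comp d₁ d₂).rel.refl _
      · exact hac
  have s2 : (KA b).disjSum (KC b) = {b, e} := by
    ext x
    rw [hAC]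
    constructor
    · intro hx
      have := (comp d₁ d₂).block_le_two b e x hbe hx
      simp only [Finset.mem_insert, Finset.mem_singleton]
      exact this.elim (fun h => absurd h hbe') (Or.imp Eq.symm Eq.symm)
    · simp only [Finset.mem_insert, Finset.mem_singleton]
      rintro (rfl | rfl)
      · exact (comp d₁ d₂).rel.refl _
      · exact hbe
  rw [s1, s2, cross, Finset.sum_pair hac', Finset.sum_pair hbe', Finset.sum_pair hbe'] at c3
  rw [if_neg (by omega), if_neg (by omega), if_pos (by omega), if_neg (by omega)] at c3
  revert c3
  decide

/-- Diagrams are ordered by refinement: `d ≤ e` if each block of `d` is contained in a block of `e`,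
that is, if `d` is obtained from `e` by removing edges. -/
instance : PartialOrder (Diagram k) :=
  PartialOrder.lift Diagram.rel fun _ _ h => Diagram.ext h

theorem le_iff (d e : Diagram k) : d ≤ e ↔ ∀ v w, d.rel v w → e.rel v w := Iff.rfl

instance : Finite (Diagram k) :=
  Finite.of_injective (fun (d : Diagram k) (v w : Vert k) => d.rel v w) fun d e h => by
    ext v w
    exact iff_of_eq (congrFun (congrFun h v) w)

noncomputable instance : Fintype (Diagram k) := Fintype.ofFinite _

/-- The number of blocks of a diagram. -/
noncomputable def numBlocks (d : Diagram k) : ℕ := d.rel.classes.ncard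

open scoped Classical in
/-- The indices of the non-isolated vertices of the top row. -/
noncomputable def topFrame (d : Diagram k) : Finset (Fin k) := {i | ¬ d.Isolated (Sum.inl i)}

open scoped Classical in
/-- The indices of the non-isolated vertices of the bottom row. -/
noncomputable def botFrame (d : Diagram k) : Finset (Fin k) := {i | ¬ d.Isolated (Sum.inr i)}

open scoped Classical in
/-- The indices of the end points of horizontal edges in the top row. -/
noncomputable def topFrameH (d : Diagram k) : Finset (Fin k) :=
  {i | ∃ j, j ≠ i ∧ d.rel (Sum.inl i) (Sum.inl j)}

open scoped Classical in
/-- The indices of the end points of horizontal edges in the bottom row. -/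
noncomputable def botFrameH (d : Diagram k) : Finset (Fin k) :=
  {i | ∃ j, j ≠ i ∧ d.rel (Sum.inr i) (Sum.inr j)}

open scoped Classical in
/-- The cups: the edges with both end points in the top row. -/
noncomputable def cups (d : Diagram k) : Finset (Fin k × Fin k) :=
  {e | e.1 < e.2 ∧ d.rel (Sum.inl e.1) (Sum.inl e.2)}

open scoped Classical in
/-- The caps: the edges with both end points in the bottom row. -/
noncomputable def caps (d : Diagram k) : Finset (Fin k × Fin k) :=
  {e | e.1 < e.2 ∧ d.rel (Sum.inr e.1) (Sum.inr e.2)}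

open scoped Classical in
/-- The vertical edges, which join a vertex of the top row and a vertex of the bottom row. -/
noncomputable def verticals (d : Diagram k) : Finset (Fin k × Fin k) :=
  {e | d.rel (Sum.inl e.1) (Sum.inr e.2)}

/-- The number of edges. -/
noncomputable def numEdges (d : Diagram k) : ℕ :=
  d.verticals.card + d.cups.card + d.caps.card

/-- The set `𝒟(k)` of balanced Motzkin `k`-diagrams: the planar partial Brauer diagrams with the
same number of cups as caps. -/
def balancedMotzkin (k : ℕ) : Set (Diagram k) :=
  {d | d.IsPlanar ∧ d.cups.card = d.caps.card}

/-- The set `𝒟_n(k)` of balanced Motzkin `k`-diagrams with exactly `n` edges. -/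
def balancedMotzkinEdges (k n : ℕ) : Set (Diagram k) :=
  {d | d ∈ balancedMotzkin k ∧ d.numEdges = n}

/-- The set of Temperley-Lieb `n`-diagrams: the planar diagrams all of whose blocks have exactly two
elements. -/
def temperleyLieb (n : ℕ) : Set (Diagram n) :=
  {d | d.IsPlanar ∧ ∀ v, ¬ d.Isolated v}

theorem isPlanar_of_le {d e : Diagram k} (h : d ≤ e) (he : e.IsPlanar) : d.IsPlanar := by
  intro a b c f hab hbc hcf hac hbf
  have hr := he a b c f hab hbc hcf (h hac) (h hbf)
  rcases e.block_le_two a b c hr (h hac) with rfl | rfl | rfl <;> omega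

theorem isolated_of_le {d e : Diagram k} (h : d ≤ e) {v : Vert k} (hv : e.Isolated v) :
    d.Isolated v := fun w hw => hv w (h hw)

theorem not_isolated_iff (d : Diagram k) (v : Vert k) : ¬ d.Isolated v ↔ ∃ w, w ≠ v ∧ d.rel v w := by
  simp only [Isolated, not_forall, exists_prop, and_comm]

/-- A general count: the elements that are an end point of a pair. -/
theorem card_frame (c : Fin k → Fin k → Prop) (q : Fin k → Prop) [DecidableRel c] [DecidablePred q]
    (hsymm : ∀ i j, c i j → c j i) (huniq : ∀ i j l, c i j → c i l → j = l)
    (hirr : ∀ i, ¬ c i i) (hq : ∀ i j, c i j → ¬ q i) :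
    (Finset.univ.filter fun i => q i ∨ ∃ j, c i j).card =
      (Finset.univ.filter q).card +
        2 * (Finset.univ.filter fun e : Fin k × Fin k => e.1 < e.2 ∧ c e.1 e.2).card := by
  classical
  set C := Finset.univ.filter fun e : Fin k × Fin k => e.1 < e.2 ∧ c e.1 e.2 with hC
  have h1 : (C.image Prod.fst).card = C.card := Finset.card_image_of_injOn (by
    rintro ⟨a, b⟩ h ⟨a', b'⟩ h' (rfl : a = a')
    simp only [hC, Finset.coe_filter, Finset.mem_univ, true_and, Set.mem_ofPred_eq] at h h'
    rw [huniq _ _ _ h.2 h'.2])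
  have h2 : (C.image Prod.snd).card = C.card := Finset.card_image_of_injOn (by
    rintro ⟨a, b⟩ h ⟨a', b'⟩ h' (rfl : b = b')
    simp only [hC, Finset.coe_filter, Finset.mem_univ, true_and, Set.mem_ofPred_eq] at h h'
    rw [huniq _ _ _ (hsymm _ _ h.2) (hsymm _ _ h'.2)])
  have hd1 : Disjoint (C.image Prod.fst) (C.image Prod.snd) := by
    rw [Finset.disjoint_left]
    intro i hi hi'
    simp only [hC, Finset.mem_image, Finset.mem_filter_univ, Prod.exists] at hi hi'
    obtain ⟨a, b, h, rfl⟩ := hi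
    obtain ⟨a', b', h', rfl⟩ := hi'
    obtain rfl := huniq _ _ _ h.2 (hsymm _ _ h'.2)
    exact absurd (h.1.trans h'.1) (lt_irrefl _)
  have hd2 : Disjoint (Finset.univ.filter q) (C.image Prod.fst ∪ C.image Prod.snd) := by
    rw [Finset.disjoint_left]
    intro i hi hi'
    simp only [hC, Finset.mem_union, Finset.mem_image, Finset.mem_filter_univ, Prod.exists] at hi hi'
    rcases hi' with ⟨a, b, h, rfl⟩ | ⟨a, b, h, rfl⟩
    · exact hq _ _ h.2 hi
    · exact hq _ _ (hsymm _ _ h.2) hi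
  have hcard : (Finset.univ.filter q ∪ (C.image Prod.fst ∪ C.image Prod.snd)).card =
      (Finset.univ.filter q).card + 2 * C.card := by
    rw [Finset.card_union_of_disjoint hd2, Finset.card_union_of_disjoint hd1, h1, h2, two_mul]
  rw [← hcard]
  congr 1
  ext i
  simp only [hC, Finset.mem_union, Finset.mem_image, Finset.mem_filter_univ, Prod.exists]
  constructor
  · rintro (h | ⟨j, h⟩)
    · exact Or.inl h
    · right
      rcases lt_trichotomy i j with hij | rfl | hij
      · exact Or.inl ⟨i, j, ⟨hij, h⟩, rfl⟩
      · exact absurd h (hirr i)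
      · exact Or.inr ⟨j, i, ⟨hij, hsymm _ _ h⟩, rfl⟩
  · rintro (h | ⟨a, b, h, rfl⟩ | ⟨a, b, h, rfl⟩)
    · exact Or.inl h
    · exact Or.inr ⟨b, h.2⟩
    · exact Or.inr ⟨a, hsymm _ _ h.2⟩

theorem card_topFrame (d : Diagram k) : d.topFrame.card = d.verticals.card + 2 * d.cups.card := by
  classical
  have hv : d.verticals.card =
      (Finset.univ.filter fun i => ∃ j, d.rel (Sum.inl i) (Sum.inr j)).card := by
    rw [← Finset.card_image_of_injOn (s := d.verticals) (f := Prod.fst)]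
    · congr 1
      ext i
      simp [verticals]
    · rintro ⟨a, b⟩ h ⟨a', b'⟩ h' (rfl : a = a')
      simp only [verticals, Finset.coe_filter, Finset.mem_univ, true_and, Set.mem_ofPred_eq] at h h'
      have := d.block_le_two _ _ _ h h'
      simp at this
      rw [this]
  have := card_frame (fun i j => j ≠ i ∧ d.rel (Sum.inl i) (Sum.inl j))
    (fun i => ∃ j, d.rel (Sum.inl i) (Sum.inr j))
    (fun i j h => ⟨h.1.symm, d.rel.symm h.2⟩)
    (fun i j l h h' => by
      have := d.block_le_two _ _ _ h.2 h'.2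
      simp only [Sum.inl.injEq] at this
      exact (this.resolve_left h.1.symm).resolve_left h'.1.symm)
    (fun i h => h.1 rfl)
    (fun i j h ⟨l, h'⟩ => by
      have := d.block_le_two _ _ _ h.2 h'
      simp only [Sum.inl.injEq, reduceCtorEq, or_false] at this
      exact h.1 this.symm)
  rw [hv, cups]
  have hc : (Finset.univ.filter fun e : Fin k × Fin k => e.1 < e.2 ∧ d.rel (Sum.inl e.1) (Sum.inl e.2))
      = Finset.univ.filter fun e : Fin k × Fin k =>
        e.1 < e.2 ∧ e.2 ≠ e.1 ∧ d.rel (Sum.inl e.1) (Sum.inl e.2) := by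
    ext e
    simp only [Finset.mem_filter_univ]
    exact ⟨fun h => ⟨h.1, h.1.ne', h.2⟩, fun h => ⟨h.1, h.2.2⟩⟩
  rw [hc, ← this]
  congr 1
  ext i
  simp only [topFrame, Finset.mem_filter_univ, not_isolated_iff]
  constructor
  · rintro ⟨w | w, hw, hr⟩
    · exact Or.inr ⟨w, fun h => hw (h ▸ rfl), hr⟩
    · exact Or.inl ⟨w, hr⟩
  · rintro (⟨j, h⟩ | ⟨j, h⟩)
    · exact ⟨_, by simp, h⟩
    · exact ⟨Sum.inl j, by simpa using h.1, h.2⟩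

theorem card_botFrame (d : Diagram k) : d.botFrame.card = d.verticals.card + 2 * d.caps.card := by
  classical
  have hv : d.verticals.card =
      (Finset.univ.filter fun i => ∃ j, d.rel (Sum.inr i) (Sum.inl j)).card := by
    rw [← Finset.card_image_of_injOn (s := d.verticals) (f := Prod.snd)]
    · congr 1
      ext i
      simp only [verticals, Finset.mem_image, Finset.mem_filter_univ, Prod.exists]
      constructor
      · rintro ⟨a, b, h, rfl⟩; exact ⟨a, d.rel.symm h⟩
      · rintro ⟨a, h⟩; exact ⟨a, i, d.rel.symm h, rfl⟩
    · rintro ⟨a, b⟩ h ⟨a', b'⟩ h' (rfl : b = b')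
      simp only [verticals, Finset.coe_filter, Finset.mem_univ, true_and, Set.mem_ofPred_eq] at h h'
      have := d.block_le_two _ _ _ (d.rel.symm h) (d.rel.symm h')
      simp at this
      rw [this]
  have := card_frame (fun i j => j ≠ i ∧ d.rel (Sum.inr i) (Sum.inr j))
    (fun i => ∃ j, d.rel (Sum.inr i) (Sum.inl j))
    (fun i j h => ⟨h.1.symm, d.rel.symm h.2⟩)
    (fun i j l h h' => by
      have := d.block_le_two _ _ _ h.2 h'.2
      simp only [Sum.inr.injEq] at this
      exact (this.resolve_left h.1.symm).resolve_left h'.1.symm)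
    (fun i h => h.1 rfl)
    (fun i j h ⟨l, h'⟩ => by
      have := d.block_le_two _ _ _ h.2 h'
      simp only [Sum.inr.injEq, reduceCtorEq, or_false] at this
      exact h.1 this.symm)
  rw [hv, caps]
  have hc : (Finset.univ.filter fun e : Fin k × Fin k => e.1 < e.2 ∧ d.rel (Sum.inr e.1) (Sum.inr e.2))
      = Finset.univ.filter fun e : Fin k × Fin k =>
        e.1 < e.2 ∧ e.2 ≠ e.1 ∧ d.rel (Sum.inr e.1) (Sum.inr e.2) := by
    ext e
    simp only [Finset.mem_filter_univ]
    exact ⟨fun h => ⟨h.1, h.1.ne', h.2⟩, fun h => ⟨h.1, h.2.2⟩⟩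
  rw [hc, ← this]
  congr 1
  ext i
  simp only [botFrame, Finset.mem_filter_univ, not_isolated_iff]
  constructor
  · rintro ⟨w | w, hw, hr⟩
    · exact Or.inl ⟨w, hr⟩
    · exact Or.inr ⟨w, fun h => hw (h ▸ rfl), hr⟩
  · rintro (⟨j, h⟩ | ⟨j, h⟩)
    · exact ⟨_, by simp, h⟩
    · exact ⟨Sum.inr j, by simpa using h.1, h.2⟩

theorem mem_balancedMotzkin_iff (d : Diagram k) :
    d ∈ balancedMotzkin k ↔ d.IsPlanar ∧ d.topFrame.card = d.botFrame.card := by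
  rw [card_topFrame, card_botFrame]
  simp only [balancedMotzkin, Set.mem_ofPred_eq]
  constructor <;> rintro ⟨h1, h2⟩ <;> exact ⟨h1, by omega⟩

theorem mem_balancedMotzkinEdges_iff (d : Diagram k) (n : ℕ) :
    d ∈ balancedMotzkinEdges k n ↔ d.IsPlanar ∧ d.topFrame.card = n ∧ d.botFrame.card = n := by
  rw [card_topFrame, card_botFrame]
  simp only [balancedMotzkinEdges, balancedMotzkin, numEdges, Set.mem_ofPred_eq]
  constructor
  · rintro ⟨⟨h1, h2⟩, h3⟩; exact ⟨h1, by omega, by omega⟩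
  · rintro ⟨h1, h2, h3⟩; exact ⟨⟨h1, by omega⟩, by omega⟩

theorem comp_mem_temperleyLieb {d e : Diagram k} (hd : d ∈ temperleyLieb k)
    (he : e ∈ temperleyLieb k) : comp d e ∈ temperleyLieb k := by
  refine ⟨comp_isPlanar hd.1 he.1, fun v hv => ?_⟩
  obtain ⟨y, b, hy, -⟩ := exists_deadEnd hv
  cases b
  · obtain ⟨w, -, hw⟩ := hy; exact he.2 w hw
  · obtain ⟨w, -, hw⟩ := hy; exact hd.2 w hw

theorem one_not_isolated (v : Vert k) : ¬ (one k).Isolated v := by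
  rw [not_isolated_iff]
  rcases v with v | v
  · exact ⟨Sum.inr v, by simp, rfl⟩
  · exact ⟨Sum.inl v, by simp, rfl⟩

theorem one_mem_temperleyLieb : one k ∈ temperleyLieb k := ⟨one_isPlanar, one_not_isolated⟩

theorem one_mem_balancedMotzkin : one k ∈ balancedMotzkin k := by
  refine (mem_balancedMotzkin_iff _).2 ⟨one_isPlanar, ?_⟩
  classical
  simp [topFrame, botFrame, one_not_isolated]

theorem cut_le (d : Diagram k) (v : Vert k) : d.cut v ≤ d := by
  rintro a b (rfl | h)
  · exact d.rel.refl _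
  · exact h.1

theorem cut_isolated (d : Diagram k) (v : Vert k) : (d.cut v).Isolated v := by
  rintro a (h | h)
  · exact h.symm
  · exact absurd (d.rel.refl v) h.2

theorem cut_of_isolated {d : Diagram k} {v : Vert k} (h : d.Isolated v) : d.cut v = d := by
  refine le_antisymm (d.cut_le v) fun a b hab => ?_
  by_cases hav : d.rel a v
  · have := h a (d.rel.symm hav); subst this
    exact Or.inl (h b hab).symm
  · exact Or.inr ⟨hab, hav⟩

theorem numBlocks_cut {d : Diagram k} {v : Vert k} (h : ¬ d.Isolated v) :
    (d.cut v).numBlocks = d.numBlocks + 1 := by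
  obtain ⟨w, hwv, hw⟩ := (not_isolated_iff d v).1 h
  have hB : ∀ x, d.rel x v ↔ x = v ∨ x = w := by
    intro x
    constructor
    · intro hx
      have := d.block_le_two v w x hw (d.rel.symm hx)
      grind
    · rintro (rfl | rfl)
      · exact d.rel.refl _
      · exact d.rel.symm hw
  have key : (d.cut v).rel.classes = insert {v} (insert {w} (d.rel.classes \ {{x | d.rel x v}})) := by
    ext c
    simp only [Set.mem_insert_iff, Set.mem_sdiff, Set.mem_singleton_iff]
    have hsing : ∀ a, d.rel a v → {x | (d.cut v).rel x a} = {a} := by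
      intro a ha
      ext x
      simp only [Set.mem_ofPred_eq, Set.mem_singleton_iff, cut_rel]
      exact ⟨fun hx => hx.elim (fun e => e) fun e => absurd (d.rel.trans e.1 ha) e.2, Or.inl⟩
    have hother : ∀ a, ¬ d.rel a v → {x | (d.cut v).rel x a} = {x | d.rel x a} := by
      intro a ha
      ext x
      simp only [Set.mem_ofPred_eq, cut_rel]
      refine ⟨fun hx => hx.elim (fun e => e ▸ d.rel.refl _) And.left, fun hx => Or.inr ⟨hx, ?_⟩⟩
      exact fun h' => ha (d.rel.trans (d.rel.symm hx) h')
    constructor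
    · rintro ⟨a, rfl⟩
      by_cases ha : d.rel a v
      · rw [hsing a ha]
        rcases (hB a).1 ha with rfl | rfl
        · exact Or.inl rfl
        · exact Or.inr (Or.inl rfl)
      · rw [hother a ha]
        refine Or.inr (Or.inr ⟨⟨a, rfl⟩, fun heq => ha ?_⟩)
        have : a ∈ {x | d.rel x a} := d.rel.refl a
        rw [heq] at this
        exact this
    · rintro (rfl | rfl | ⟨⟨a, rfl⟩, hne⟩)
      · exact ⟨v, (hsing v (d.rel.refl v)).symm⟩
      · exact ⟨w, (hsing w (d.rel.symm hw)).symm⟩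
      · refine ⟨a, (hother a fun ha => hne ?_).symm⟩
        ext x
        exact ⟨fun hx => d.rel.trans hx ha, fun hx => d.rel.trans hx (d.rel.symm ha)⟩
  have hmem : ∀ u c, c ∈ d.rel.classes → u ∈ c → d.rel u v → c = {x | d.rel x v} :=
    fun u c hc hu hu' => Setoid.eq_of_mem_classes hc hu (d.rel.mem_classes v) hu'
  have hone : ∀ u, {u} ∈ d.rel.classes \ {{x | d.rel x v}} → d.rel u v → False := by
    intro u hu hu'
    exact hu.2 (hmem u _ hu.1 rfl hu')
  rw [numBlocks, key, Set.ncard_insert_of_notMem, Set.ncard_insert_of_notMem, numBlocks,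
    Set.ncard_sdiff_singleton_add_one (d.rel.mem_classes v)]
  · exact fun hu => hone w hu (d.rel.symm hw)
  · rw [Set.mem_insert_iff]
    rintro (hu | hu)
    · exact hwv (Set.singleton_injective hu).symm
    · exact hone v hu (d.rel.refl v)

/-- For `d ≤ e`: the diagram obtained from `d` by adding the edge of `e` at `v`. -/
def glue (e : Diagram k) (v : Vert k) (d : Diagram k) (h : d ≤ e) : Diagram k where
  rel :=
    { r := fun a b => d.rel a b ∨ (e.rel a v ∧ e.rel b v)
      iseqv := ⟨fun a => Or.inl (d.rel.refl a),
        fun {a b} h' => h'.elim (fun h' => Or.inl (d.rel.symm h')) fun h' => Or.inr ⟨h'.2, h'.1⟩,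
        fun {a b c} h1 h2 => by
          rcases h1 with h1 | h1 <;> rcases h2 with h2 | h2
          · exact Or.inl (d.rel.trans h1 h2)
          · exact Or.inr ⟨e.rel.trans (h h1) h2.1, h2.2⟩
          · exact Or.inr ⟨h1.1, e.rel.trans (e.rel.symm (h h2)) h1.2⟩
          · exact Or.inr ⟨h1.1, h2.2⟩⟩ }
  block_le_two := by
    have : ∀ a b, (d.rel a b ∨ (e.rel a v ∧ e.rel b v)) → e.rel a b := by
      rintro a b (h' | h')
      · exact h h'
      · exact e.rel.trans h'.1 (e.rel.symm h'.2)
    intro a b c h1 h2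
    exact e.block_le_two a b c (this _ _ h1) (this _ _ h2)

theorem glue_le {e d : Diagram k} {v : Vert k} (h : d ≤ e) : e.glue v d h ≤ e := by
  rintro a b (h' | h')
  · exact h h'
  · exact e.rel.trans h'.1 (e.rel.symm h'.2)

theorem glue_not_isolated {e d : Diagram k} {v : Vert k} (h : d ≤ e) (hv : ¬ e.Isolated v) :
    ¬ (e.glue v d h).Isolated v := by
  obtain ⟨w, hwv, hw⟩ := (not_isolated_iff e v).1 hv
  exact fun hi => hwv (hi w (Or.inr ⟨e.rel.refl v, e.rel.symm hw⟩))

theorem cut_glue {e d : Diagram k} {v : Vert k} (h : d ≤ e) (hv : d.Isolated v) :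
    (e.glue v d h).cut v = d := by
  apply le_antisymm
  · rintro a b (rfl | ⟨h1 | h1, h2⟩)
    · exact d.rel.refl _
    · exact h1
    · exact absurd (Or.inr ⟨h1.1, e.rel.refl v⟩) h2
  · intro a b hab
    by_cases hne : a = b
    · exact Or.inl hne
    · refine Or.inr ⟨Or.inl hab, ?_⟩
      have hav : a ≠ v := by rintro rfl; exact hne (hv b hab).symm
      have hbv : b ≠ v := by rintro rfl; exact hne (hv a (d.rel.symm hab))
      rintro (h' | h')
      · exact hav (hv a (d.rel.symm h'))
      · rcases e.block_le_two a b v (h hab) h'.1 with h'' | h'' | h''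
        · exact hne h''
        · exact hav h''
        · exact hbv h''

theorem glue_cut {e d : Diagram k} {v : Vert k} (h : d ≤ e) (hv : ¬ d.Isolated v)
    (h' : d.cut v ≤ e) : e.glue v (d.cut v) h' = d := by
  obtain ⟨w, hwv, hw⟩ := (not_isolated_iff d v).1 hv
  have key : ∀ a, e.rel a v → d.rel a v := by
    intro a ha
    rcases e.block_le_two v w a (h hw) (e.rel.symm ha) with h1 | h1 | h1
    · exact absurd h1.symm hwv
    · exact h1 ▸ d.rel.refl _
    · exact h1 ▸ d.rel.symm hw
  apply le_antisymm
  · rintro a b (h1 | h1)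
    · exact cut_le d v h1
    · exact d.rel.trans (key a h1.1) (d.rel.symm (key b h1.2))
  · intro a b hab
    by_cases ha : d.rel a v
    · exact Or.inr ⟨h ha, h (d.rel.trans (d.rel.symm hab) ha)⟩
    · exact Or.inl (Or.inr ⟨hab, ha⟩)

end Diagram

/-- The partial Brauer algebra `PB_k(δ, 1)`: the free module on the partial Brauer `k`-diagrams. -/
def PB {K : Type*} [CommRing K] (_δ : K) (k : ℕ) : Type _ := Diagram k →₀ K

namespace PB

variable {K : Type*} [CommRing K] {δ : K} {k : ℕ}

noncomputable instance : AddCommGroup (PB δ k) := inferInstanceAs (AddCommGroup (Diagram k →₀ K))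

noncomputable instance : Module K (PB δ k) := inferInstanceAs (Module K (Diagram k →₀ K))

/-- A diagram as an element of the partial Brauer algebra. -/
noncomputable def diag (δ : K) (d : Diagram k) : PB δ k := Finsupp.single d (1 : K)

/-- The linear map with given values on the diagrams. -/
noncomputable def lift {M : Type*} [AddCommGroup M] [Module K M] (φ : Diagram k → M) :
    PB δ k →ₗ[K] M := Finsupp.linearCombination K φ

theorem lift_diag {M : Type*} [AddCommGroup M] [Module K M] (φ : Diagram k → M) (d : Diagram k) :
    lift φ (diag δ d) = φ d := by
  exact (Finsupp.linearCombination_single K (1 : K) d).trans (one_smul K (φ d))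

theorem span_diag : Submodule.span K (Set.range (diag δ (k := k))) = ⊤ := by
  rw [eq_top_iff]
  rintro x -
  induction x using Finsupp.induction_linear with
  | zero => exact Submodule.zero_mem _
  | add x y hx hy => exact Submodule.add_mem _ hx hy
  | single d a =>
    have : (Finsupp.single d a : Diagram k →₀ K) = a • Finsupp.single d 1 := by simp
    rw [this]
    exact Submodule.smul_mem _ _ (Submodule.subset_span ⟨d, rfl⟩)

theorem ext_diag {M : Type*} [AddCommGroup M] [Module K M] {φ ψ : PB δ k →ₗ[K] M}
    (h : ∀ d, φ (diag δ d) = ψ (diag δ d)) : φ = ψ :=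
  LinearMap.ext_on_range span_diag h

/-- The multiplication of the partial Brauer algebra: the bilinear extension of the rule
`d₁ d₂ = δ ^ N (d₁ ∘ d₂)`, where `N` is the number of closed loops (interior paths are weighted by the
second parameter, which is `1`). -/
noncomputable def mulMap (δ : K) (k : ℕ) : PB δ k →ₗ[K] PB δ k →ₗ[K] PB δ k :=
  lift fun d₁ => lift fun d₂ => δ ^ Diagram.numLoops d₁ d₂ • diag δ (Diagram.comp d₁ d₂)

noncomputable instance : Mul (PB δ k) := ⟨fun x y => mulMap δ k x y⟩

noncomputable instance : One (PB δ k) := ⟨diag δ (Diagram.one k)⟩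

theorem mul_def (x y : PB δ k) : x * y = mulMap δ k x y := rfl

theorem one_def : (1 : PB δ k) = diag δ (Diagram.one k) := rfl

theorem diag_mul (d e : Diagram k) :
    diag δ d * diag δ e = δ ^ Diagram.numLoops d e • diag δ (Diagram.comp d e) := by
  rw [mul_def, mulMap, lift_diag, lift_diag]

theorem mul_assoc_aux (x y z : PB δ k) : x * y * z = x * (y * z) := by
  have key : ((mulMap δ k).compr₂ (mulMap δ k)) =
      ((LinearMap.llcomp K (PB δ k) (PB δ k) (PB δ k)).compl₁₂ (mulMap δ k) (mulMap δ k)) := by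
    refine ext_diag fun a => ext_diag fun b => ext_diag fun c => ?_
    simp only [LinearMap.compr₂_apply, LinearMap.compl₁₂_apply, LinearMap.llcomp_apply, ← mul_def,
      diag_mul]
    have e1 : ∀ (r : K) (u v : PB δ k), r • u * v = r • (u * v) := fun r u v => by
      simp only [mul_def, map_smul, LinearMap.smul_apply]
    have e2 : ∀ (r : K) (u v : PB δ k), u * r • v = r • (u * v) := fun r u v => by
      simp only [mul_def, map_smul]
    obtain ⟨h1, h2⟩ := Diagram.comp_assoc a b c
    rw [e1, e2, diag_mul, diag_mul, smul_smul, smul_smul, ← pow_add, ← pow_add, h1, h2]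
  exact LinearMap.congr_fun (LinearMap.congr_fun (LinearMap.congr_fun key x) y) z

noncomputable instance : Ring (PB δ k) :=
  { (inferInstance : AddCommGroup (PB δ k)) with
    mul := (· * ·)
    one := 1
    left_distrib := fun x y z => map_add (mulMap δ k x) y z
    right_distrib := fun x y z => LinearMap.map_add₂ (mulMap δ k) x y z
    zero_mul := fun x => LinearMap.map_zero₂ (mulMap δ k) x
    mul_zero := fun x => map_zero (mulMap δ k x)
    mul_assoc := mul_assoc_aux
    one_mul := fun x => by
      have : mulMap δ k 1 = LinearMap.id := ext_diag fun d => by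
        rw [← mul_def, one_def, diag_mul, (Diagram.one_comp d).1, (Diagram.one_comp d).2, pow_zero,
          one_smul]; rfl
      exact LinearMap.congr_fun this x
    mul_one := fun x => by
      have : (mulMap δ k).flip 1 = LinearMap.id := ext_diag fun d => by
        rw [LinearMap.flip_apply, ← mul_def, one_def, diag_mul, (Diagram.comp_one d).1,
          (Diagram.comp_one d).2, pow_zero, one_smul]; rfl
      exact LinearMap.congr_fun this x }

noncomputable instance : Algebra K (PB δ k) :=
  Algebra.ofModule (fun r x y => LinearMap.map_smul₂ (mulMap δ k) r x y)
    (fun r x y => map_smul (mulMap δ k x) r y)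

/-- The alternating element `d̄ = ∑_{d' ≤ d} (-1)^{β(d) - β(d')} d'`, where `β` is the number of blocks
(the sign only depends on the parity of `β(d) + β(d')`). -/
noncomputable def bar (δ : K) (d : Diagram k) : PB δ k :=
  open scoped Classical in
  ∑ e : Diagram k with e ≤ d, (-1 : K) ^ (d.numBlocks + e.numBlocks) • diag δ e

/-- The product of the `f i` for `i` in a set of indices, in increasing order of `i` (it is only used
for commuting elements). -/
noncomputable def prodOver (S : Finset (Fin k)) (f : Fin k → PB δ k) : PB δ k :=
  ((List.finRange k).map fun i => if i ∈ S then f i else 1).prod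

/-- The element `d̃`: the product of the `1 - p_i` for the end points `i` of horizontal edges in the top
row of `d`, of `d`, and of the `1 - p_i` for the end points `i` of horizontal edges in the bottom row
of `d`. -/
noncomputable def tilde (δ : K) (d : Diagram k) : PB δ k :=
  prodOver d.topFrameH (fun i => 1 - diag δ (Diagram.p i)) * diag δ d *
    prodOver d.botFrameH (fun i => 1 - diag δ (Diagram.p i))

/-- The linear map removing the edge at `v`. -/
noncomputable def cutMap (v : Vert k) : PB δ k →ₗ[K] PB δ k := lift fun d => diag δ (d.cut v)

theorem p_mul (i : Fin k) (x : PB δ k) : diag δ (Diagram.p i) * x = cutMap (Sum.inl i) x := by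
  have : mulMap δ k (diag δ (Diagram.p i)) = cutMap (Sum.inl i) := ext_diag fun d => by
    rw [← mul_def, diag_mul, (Diagram.p_comp i d).1, (Diagram.p_comp i d).2, pow_zero, one_smul,
      cutMap, lift_diag]
  exact LinearMap.congr_fun this x

theorem mul_p (i : Fin k) (x : PB δ k) : x * diag δ (Diagram.p i) = cutMap (Sum.inr i) x := by
  have : (mulMap δ k).flip (diag δ (Diagram.p i)) = cutMap (Sum.inr i) := ext_diag fun d => by
    rw [LinearMap.flip_apply, ← mul_def, diag_mul, (Diagram.comp_p i d).1, (Diagram.comp_p i d).2,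
      pow_zero, one_smul, cutMap, lift_diag]
  exact LinearMap.congr_fun this x

theorem cutMap_bar_of_isolated {d : Diagram k} {v : Vert k} (h : d.Isolated v) :
    cutMap v (bar δ d) = bar δ d := by
  classical
  rw [bar, map_sum]
  refine Finset.sum_congr rfl fun e he => ?_
  rw [map_smul, cutMap, lift_diag,
    Diagram.cut_of_isolated (Diagram.isolated_of_le (Finset.mem_filter.1 he).2 h)]

theorem cutMap_bar {d : Diagram k} {v : Vert k} (h : ¬ d.Isolated v) :
    cutMap v (bar δ d) = 0 := by
  classical
  rw [bar, map_sum]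
  have hle : ∀ e ∈ (Finset.univ.filter fun e : Diagram k => e ≤ d), e ≤ d := fun e he =>
    (Finset.mem_filter.1 he).2
  have hcl : ∀ e ∈ (Finset.univ.filter fun e : Diagram k => e ≤ d), e.cut v ≤ d := fun e he =>
    (e.cut_le v).trans (hle e he)
  have hsgn : ∀ (a b : ℕ), (-1 : K) ^ (a + b) + (-1) ^ (a + (b + 1)) = 0 := fun a b => by ring
  refine Finset.sum_involution
    (fun e he => if e.Isolated v then d.glue v e (hle e he) else e.cut v) ?_ ?_ ?_ ?_
  · intro e he
    simp only [map_smul, cutMap, lift_diag]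
    split_ifs with hi
    · rw [Diagram.cut_glue _ hi, Diagram.cut_of_isolated hi, ← add_smul]
      have := Diagram.numBlocks_cut (Diagram.glue_not_isolated (hle e he) h)
      rw [Diagram.cut_glue _ hi] at this
      rw [this, add_comm, hsgn, zero_smul]
    · rw [Diagram.cut_of_isolated (e.cut_isolated v), ← add_smul, Diagram.numBlocks_cut hi, hsgn,
        zero_smul]
  · intro e he _ heq
    split_ifs at heq with hi
    · exact Diagram.glue_not_isolated (hle e he) h (by rw [heq]; exact hi)
    · exact hi (heq ▸ e.cut_isolated v)
  · intro e he
    rw [Finset.mem_filter]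
    refine ⟨Finset.mem_univ _, ?_⟩
    split_ifs with hi
    · exact Diagram.glue_le _
    · exact hcl e he
  · intro e he
    by_cases hi : e.Isolated v
    · simp only [hi, if_true, if_neg (Diagram.glue_not_isolated (hle e he) h), Diagram.cut_glue _ hi]
    · simp only [hi, if_false, if_pos (e.cut_isolated v), Diagram.glue_cut (hle e he) hi]

theorem p_mul_bar (i : Fin k) (d : Diagram k) :
    diag δ (Diagram.p i) * bar δ d = if i ∈ d.topFrame then 0 else bar δ d := by
  rw [p_mul]
  split_ifs with h
  · exact cutMap_bar (by simpa [Diagram.topFrame] using h)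
  · exact cutMap_bar_of_isolated (by simpa [Diagram.topFrame] using h)

theorem bar_mul_p (i : Fin k) (d : Diagram k) :
    bar δ d * diag δ (Diagram.p i) = if i ∈ d.botFrame then 0 else bar δ d := by
  rw [mul_p]
  split_ifs with h
  · exact cutMap_bar (by simpa [Diagram.botFrame] using h)
  · exact cutMap_bar_of_isolated (by simpa [Diagram.botFrame] using h)

theorem list_prod_mul (l : List (Fin k)) (f : Fin k → PB δ k) (q : Fin k → Prop) [DecidablePred q]
    (x : PB δ k) (h : ∀ i, f i * x = if q i then x else 0) :
    (l.map f).prod * x = if ∀ i ∈ l, q i then x else 0 := by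
  induction l with
  | nil => simp
  | cons a l ih =>
    rw [List.map_cons, List.prod_cons, mul_assoc, ih]
    split_ifs with h1 h2 h2
    · rw [h, if_pos (h2 a (by simp))]
    · rw [h, if_neg fun ha => h2 (by simpa using ⟨ha, h1⟩)]
    · exact absurd (fun i hi => h2 i (by simp [hi])) h1
    · rw [mul_zero]

theorem mul_list_prod (l : List (Fin k)) (f : Fin k → PB δ k) (q : Fin k → Prop) [DecidablePred q]
    (x : PB δ k) (h : ∀ i, x * f i = if q i then x else 0) :
    x * (l.map f).prod = if ∀ i ∈ l, q i then x else 0 := by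
  induction l with
  | nil => simp
  | cons a l ih =>
    rw [List.map_cons, List.prod_cons, ← mul_assoc, h]
    by_cases ha : q a
    · rw [if_pos ha, ih]
      simp [ha]
    · rw [if_neg ha, zero_mul, if_neg fun h' => ha (h' a (by simp))]

theorem prodOver_mul_bar (S : Finset (Fin k)) (d : Diagram k) [Decidable (S ⊆ d.topFrame)] :
    prodOver S (fun i => 1 - diag δ (Diagram.p i)) * bar δ d =
      if S ⊆ d.topFrame then bar δ d else 0 := by
  classical
  rw [prodOver, list_prod_mul _ _ (fun i => i ∈ S → i ∈ d.topFrame)]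
  · simp [Finset.subset_iff]
  · intro i
    split_ifs with h1 h2 h2
    · rw [sub_mul, one_mul, p_mul_bar, if_pos (h2 h1), sub_zero]
    · rw [sub_mul, one_mul, p_mul_bar, if_neg fun h' => h2 fun _ => h', sub_self]
    · rw [one_mul]
    · exact absurd (fun h' => absurd h' h1) h2

theorem bar_mul_prodOver (S : Finset (Fin k)) (d : Diagram k) [Decidable (S ⊆ d.botFrame)] :
    bar δ d * prodOver S (fun i => 1 - diag δ (Diagram.p i)) =
      if S ⊆ d.botFrame then bar δ d else 0 := by
  classical
  rw [prodOver, mul_list_prod _ _ (fun i => i ∈ S → i ∈ d.botFrame)]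
  · simp [Finset.subset_iff]
  · intro i
    split_ifs with h1 h2 h2
    · rw [mul_sub, mul_one, bar_mul_p, if_pos (h2 h1), sub_zero]
    · rw [mul_sub, mul_one, bar_mul_p, if_neg fun h' => h2 fun _ => h', sub_self]
    · rw [mul_one]
    · exact absurd (fun h' => absurd h' h1) h2

/-- The idempotent which is the product of the `1 - p_i`, `i ∈ A`, and the `p_i`, `i ∉ A`. -/
noncomputable def eta (δ : K) (A : Finset (Fin k)) : PB δ k :=
  ((List.finRange k).map fun i =>
    if i ∈ A then 1 - diag δ (Diagram.p i) else diag δ (Diagram.p i)).prod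

theorem eta_mul_bar (A : Finset (Fin k)) (d : Diagram k) :
    eta δ A * bar δ d = if A = d.topFrame then bar δ d else 0 := by
  rw [eta, list_prod_mul _ _ (fun i => i ∈ A ↔ i ∈ d.topFrame)]
  · simp [Finset.ext_iff]
  · intro i
    by_cases h1 : i ∈ A <;> by_cases h2 : i ∈ d.topFrame <;>
      simp [h1, h2, sub_mul, p_mul_bar]

theorem bar_mul_eta (A : Finset (Fin k)) (d : Diagram k) :
    bar δ d * eta δ A = if A = d.botFrame then bar δ d else 0 := by
  rw [eta, mul_list_prod _ _ (fun i => i ∈ A ↔ i ∈ d.botFrame)]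
  · simp [Finset.ext_iff]
  · intro i
    by_cases h1 : i ∈ A <;> by_cases h2 : i ∈ d.botFrame <;>
      simp [h1, h2, mul_sub, bar_mul_p]

theorem diag_sub_bar_mem (d : Diagram k) :
    diag δ d - bar δ d ∈ Submodule.span K (bar δ '' {e | e < d}) := by
  classical
  induction d using WellFoundedLT.induction with
  | ind d ih =>
    have h1 : bar δ d = diag δ d +
        ∑ e ∈ (Finset.univ.filter fun e : Diagram k => e ≤ d).erase d,
          (-1 : K) ^ (d.numBlocks + e.numBlocks) • diag δ e := by
      rw [bar, ← Finset.add_sum_erase _ _ (a := d) (by simp), ← two_mul, pow_mul]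
      simp
    rw [h1, sub_add_cancel_left]
    refine Submodule.neg_mem _ (Submodule.sum_mem _ fun e he => Submodule.smul_mem _ _ ?_)
    have hlt : e < d := lt_of_le_of_ne (Finset.mem_filter.1 (Finset.mem_erase.1 he).2).2
      (Finset.mem_erase.1 he).1
    have h2 := ih e hlt
    have h3 : diag δ e = (diag δ e - bar δ e) + bar δ e := by abel
    rw [h3]
    refine Submodule.add_mem _ (Submodule.span_mono (Set.image_mono ?_) h2)
      (Submodule.subset_span ⟨e, hlt, rfl⟩)
    exact fun f hf => lt_trans hf hlt

theorem tilde_sub_bar_mem {d : Diagram k} (hd : d ∈ Diagram.balancedMotzkin k) :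
    tilde δ d - bar δ d ∈ Submodule.span K
      (bar δ '' {e | e < d ∧ e ∈ Diagram.balancedMotzkin k}) := by
  classical
  let Φ : PB δ k →ₗ[K] PB δ k :=
    LinearMap.mulRight K (prodOver d.botFrameH (fun i => 1 - diag δ (Diagram.p i))) ∘ₗ
      LinearMap.mulLeft K (prodOver d.topFrameH (fun i => 1 - diag δ (Diagram.p i)))
  have hΦ : ∀ e, Φ (bar δ e) =
      if d.topFrameH ⊆ e.topFrame ∧ d.botFrameH ⊆ e.botFrame then bar δ e else 0 := by
    intro e
    simp only [Φ, LinearMap.comp_apply, LinearMap.mulRight_apply, LinearMap.mulLeft_apply,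
      prodOver_mul_bar]
    by_cases h : d.topFrameH ⊆ e.topFrame
    · simp only [h, if_true, bar_mul_prodOver, true_and]
    · simp [h]
  have hd0 : Φ (bar δ d) = bar δ d := by
    rw [hΦ, if_pos]
    constructor
    · intro i hi
      simp only [Diagram.topFrameH, Diagram.topFrame, Finset.mem_filter_univ,
        Diagram.not_isolated_iff] at hi ⊢
      obtain ⟨j, hj, hr⟩ := hi
      exact ⟨Sum.inl j, by simpa using hj, hr⟩
    · intro i hi
      simp only [Diagram.botFrameH, Diagram.botFrame, Finset.mem_filter_univ,
        Diagram.not_isolated_iff] at hi ⊢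
      obtain ⟨j, hj, hr⟩ := hi
      exact ⟨Sum.inr j, by simpa using hj, hr⟩
  have h1 : tilde δ d - bar δ d = Φ (diag δ d - bar δ d) := by
    rw [map_sub, hd0]; rfl
  rw [h1]
  have h2 := diag_sub_bar_mem (δ := δ) d
  rw [← Submodule.mem_comap]
  refine (Submodule.span_le.2 ?_) h2
  rintro _ ⟨e, he, rfl⟩
  rw [SetLike.mem_coe, Submodule.mem_comap, hΦ]
  split_ifs with h
  · refine Submodule.subset_span ⟨e, ⟨he, Diagram.isPlanar_of_le he.le hd.1, ?_⟩, rfl⟩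
    have hle : ∀ v w, e.rel v w → d.rel v w := (Diagram.le_iff e d).1 (le_of_lt he)
    have hc : e.cups = d.cups := by
      ext ⟨i, j⟩
      simp only [Diagram.cups, Finset.mem_filter_univ]
      refine ⟨fun hh => ⟨hh.1, hle _ _ hh.2⟩, fun hh => ⟨hh.1, ?_⟩⟩
      have hi : i ∈ e.topFrame := h.1 (by
        simp only [Diagram.topFrameH, Finset.mem_filter_univ]
        exact ⟨j, hh.1.ne', hh.2⟩)
      simp only [Diagram.topFrame, Finset.mem_filter_univ, Diagram.not_isolated_iff] at hi
      obtain ⟨w, hw, hr⟩ := hi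
      rcases d.block_le_two _ _ _ hh.2 (hle _ _ hr) with h' | h' | h'
      · exact absurd (Sum.inl_injective h') hh.1.ne
      · exact absurd h'.symm hw
      · rwa [h']
    have hc2 : e.caps = d.caps := by
      ext ⟨i, j⟩
      simp only [Diagram.caps, Finset.mem_filter_univ]
      refine ⟨fun hh => ⟨hh.1, hle _ _ hh.2⟩, fun hh => ⟨hh.1, ?_⟩⟩
      have hi : i ∈ e.botFrame := h.2 (by
        simp only [Diagram.botFrameH, Finset.mem_filter_univ]
        exact ⟨j, hh.1.ne', hh.2⟩)
      simp only [Diagram.botFrame, Finset.mem_filter_univ, Diagram.not_isolated_iff] at hi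
      obtain ⟨w, hw, hr⟩ := hi
      rcases d.block_le_two _ _ _ hh.2 (hle _ _ hr) with h' | h' | h'
      · exact absurd (Sum.inr_injective h') hh.1.ne
      · exact absurd h'.symm hw
      · rwa [h']
    rw [hc, hc2]
    exact hd.2
  · exact Submodule.zero_mem _

theorem span_tilde : Submodule.span K (tilde δ '' Diagram.balancedMotzkin k) =
    Submodule.span K (bar δ '' Diagram.balancedMotzkin k) := by
  have sub : ∀ d : Diagram k, bar δ '' {e | e < d ∧ e ∈ Diagram.balancedMotzkin k} ⊆
      bar δ '' Diagram.balancedMotzkin k := fun d => Set.image_mono fun e he => he.2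
  apply le_antisymm
  · rw [Submodule.span_le]
    rintro _ ⟨d, hd, rfl⟩
    have h : tilde δ d = (tilde δ d - bar δ d) + bar δ d := by abel
    rw [SetLike.mem_coe, h]
    exact Submodule.add_mem _ (Submodule.span_mono (sub d) (tilde_sub_bar_mem hd))
      (Submodule.subset_span ⟨d, hd, rfl⟩)
  · rw [Submodule.span_le]
    rintro _ ⟨d, hd, rfl⟩
    induction d using WellFoundedLT.induction with
    | ind d ih =>
      have h : bar δ d = tilde δ d - (tilde δ d - bar δ d) := by abel
      rw [SetLike.mem_coe, h]
      refine Submodule.sub_mem _ (Submodule.subset_span ⟨d, hd, rfl⟩)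
        ((Submodule.span_le.2 ?_) (tilde_sub_bar_mem hd))
      rintro _ ⟨e, he, rfl⟩
      exact ih e he.1 he.2

theorem diag_mem_of_planar {d : Diagram k} (hd : d.IsPlanar) :
    diag δ d ∈ Submodule.span K (bar δ '' {e | e.IsPlanar}) := by
  have h : diag δ d = (diag δ d - bar δ d) + bar δ d := by abel
  rw [h]
  refine Submodule.add_mem _ (Submodule.span_mono (Set.image_mono ?_) (diag_sub_bar_mem d))
    (Submodule.subset_span ⟨d, hd, rfl⟩)
  exact fun e he => Diagram.isPlanar_of_le he.le hd

theorem bar_mul_bar_planar {d e : Diagram k} (hd : d.IsPlanar) (he : e.IsPlanar) :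
    bar δ d * bar δ e ∈ Submodule.span K (bar δ '' {e | e.IsPlanar}) := by
  classical
  rw [bar, bar, Finset.sum_mul_sum]
  refine Submodule.sum_mem _ fun d' hd' => Submodule.sum_mem _ fun e' he' => ?_
  rw [smul_mul_smul_comm, diag_mul]
  refine Submodule.smul_mem _ _ (Submodule.smul_mem _ _ (diag_mem_of_planar ?_))
  exact Diagram.comp_isPlanar (Diagram.isPlanar_of_le (Finset.mem_filter.1 hd').2 hd)
    (Diagram.isPlanar_of_le (Finset.mem_filter.1 he').2 he)

theorem eta_mul_mul_eta_mem (A B : Finset (Fin k)) {x : PB δ k}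
    (hx : x ∈ Submodule.span K (bar δ '' {e | e.IsPlanar})) :
    eta δ A * x * eta δ B ∈ Submodule.span K
      (bar δ '' {e | e.IsPlanar ∧ e.topFrame = A ∧ e.botFrame = B}) := by
  classical
  let Φ : PB δ k →ₗ[K] PB δ k := LinearMap.mulRight K (eta δ B) ∘ₗ LinearMap.mulLeft K (eta δ A)
  change Φ x ∈ _
  rw [← Submodule.mem_comap]
  refine (Submodule.span_le.2 ?_) hx
  rintro _ ⟨e, he, rfl⟩
  simp only [SetLike.mem_coe, Submodule.mem_comap, Φ, LinearMap.comp_apply,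
    LinearMap.mulRight_apply, LinearMap.mulLeft_apply, eta_mul_bar]
  split_ifs with h
  · rw [bar_mul_eta]
    split_ifs with h'
    · exact Submodule.subset_span ⟨e, ⟨he, h.symm, h'.symm⟩, rfl⟩
    · exact Submodule.zero_mem _
  · rw [zero_mul]; exact Submodule.zero_mem _

theorem bar_mul_bar_mem {d e : Diagram k} (hd : d.IsPlanar) (he : e.IsPlanar) :
    bar δ d * bar δ e ∈ Submodule.span K
      (bar δ '' {f | f.IsPlanar ∧ f.topFrame = d.topFrame ∧ f.botFrame = e.botFrame}) := by
  have := eta_mul_mul_eta_mem d.topFrame e.botFrame (bar_mul_bar_planar (δ := δ) hd he)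
  rwa [← mul_assoc, eta_mul_bar, if_pos rfl, mul_assoc, bar_mul_eta, if_pos rfl] at this

theorem bar_mul_bar_zero {d e : Diagram k} (h : d.botFrame ≠ e.topFrame) :
    bar δ d * bar δ e = 0 := by
  have h1 : bar δ d * eta δ d.botFrame * bar δ e = bar δ d * bar δ e := by
    rw [bar_mul_eta, if_pos rfl]
  rw [← h1, mul_assoc, eta_mul_bar, if_neg h, mul_zero]

end PB

section Algebras

variable {K : Type*} [CommRing K]

/-- The Temperley-Lieb algebra `TL_n(δ)`: the subalgebra spanned by the Temperley-Lieb diagrams. -/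
noncomputable def TL (δ : K) (n : ℕ) : Subalgebra K (PB δ n) :=
  (Submodule.span K (PB.diag δ '' Diagram.temperleyLieb n)).toSubalgebra
    (Submodule.subset_span ⟨_, Diagram.one_mem_temperleyLieb, rfl⟩)
    (fun x y hx hy => by
      refine Submodule.mul_le.1 ?_ x hx y hy
      rw [Submodule.span_mul_span, Submodule.span_le]
      rintro _ ⟨_, ⟨d, hd, rfl⟩, _, ⟨e, he, rfl⟩, rfl⟩
      change PB.diag δ d * PB.diag δ e ∈ _
      rw [PB.diag_mul]
      exact Submodule.smul_mem _ _
        (Submodule.subset_span ⟨_, Diagram.comp_mem_temperleyLieb hd he, rfl⟩))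

/-- The partial Temperley-Lieb algebra `PTL_k(δ)`: the subalgebra spanned by the elements `d̃` for the
balanced Motzkin diagrams `d`. -/
noncomputable def PTL (δ : K) (k : ℕ) : Subalgebra K (PB δ k) :=
  (Submodule.span K (PB.tilde δ '' Diagram.balancedMotzkin k)).toSubalgebra
    (Submodule.subset_span ⟨Diagram.one k, Diagram.one_mem_balancedMotzkin, by
      have h1 : (Diagram.one k).topFrameH = ∅ := by
        classical
        ext i
        simp only [Diagram.topFrameH, Finset.mem_filter_univ, Finset.notMem_empty, iff_false]
        rintro ⟨j, hj, h⟩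
        exact hj (Eq.symm h)
      have h2 : (Diagram.one k).botFrameH = ∅ := by
        classical
        ext i
        simp only [Diagram.botFrameH, Finset.mem_filter_univ, Finset.notMem_empty, iff_false]
        rintro ⟨j, hj, h⟩
        exact hj (Eq.symm h)
      simp [PB.tilde, PB.prodOver, h1, h2, PB.one_def.symm]⟩)
    (fun x y hx hy => by
      rw [PB.span_tilde] at hx hy ⊢
      refine Submodule.mul_le.1 ?_ x hx y hy
      rw [Submodule.span_mul_span, Submodule.span_le]
      rintro _ ⟨_, ⟨d, hd, rfl⟩, _, ⟨e, he, rfl⟩, rfl⟩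
      change PB.bar δ d * PB.bar δ e ∈ _
      rw [Diagram.mem_balancedMotzkin_iff] at hd he
      by_cases h : d.botFrame = e.topFrame
      · refine Submodule.span_mono (Set.image_mono ?_) (PB.bar_mul_bar_mem hd.1 he.1)
        rintro f ⟨h1, h2, h3⟩
        refine (Diagram.mem_balancedMotzkin_iff f).2 ⟨h1, ?_⟩
        rw [h2, h3, hd.2, h, he.2]
      · rw [PB.bar_mul_bar_zero h]
        exact Submodule.zero_mem _)

/-- The ideal `X(n)` of `PTL_k(δ)`: the span of the elements `d̄` for the balanced Motzkin
`k`-diagrams `d` with exactly `n` edges. -/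
noncomputable def X (δ : K) (k n : ℕ) : NonUnitalSubalgebra K (PB δ k) :=
  { Submodule.span K (PB.bar δ '' Diagram.balancedMotzkinEdges k n) with
    mul_mem' := by
      intro x y hx hy
      refine Submodule.mul_le.1 ?_ x hx y hy
      rw [Submodule.span_mul_span]
      refine Submodule.span_le.2 ?_
      rintro _ ⟨_, ⟨d, hd, rfl⟩, _, ⟨e, he, rfl⟩, rfl⟩
      change PB.bar δ d * PB.bar δ e ∈ _
      rw [Diagram.mem_balancedMotzkinEdges_iff] at hd he
      refine Submodule.span_mono (Set.image_mono ?_) (PB.bar_mul_bar_mem hd.1 he.1)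
      rintro f ⟨h1, h2, h3⟩
      refine (Diagram.mem_balancedMotzkinEdges_iff f n).2 ⟨h1, ?_, ?_⟩
      · rw [h2, hd.2.1]
      · rw [h3, he.2.2] }

namespace X

variable {δ : K} {k n : ℕ}

theorem mem_iff (x : PB δ k) : x ∈ X δ k n ↔
    x ∈ Submodule.span K (PB.bar δ '' Diagram.balancedMotzkinEdges k n) := Iff.rfl

/-- The identity element of `X(n)`. -/
noncomputable def unit (δ : K) (k n : ℕ) : PB δ k :=
  ∑ A ∈ Finset.powersetCard n (Finset.univ : Finset (Fin k)), PB.eta δ A * PB.eta δ A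

theorem unit_mem : unit δ k n ∈ X δ k n := by
  rw [mem_iff]
  refine Submodule.sum_mem _ fun A hA => ?_
  have hcard : A.card = n := (Finset.mem_powersetCard.1 hA).2
  have h := PB.eta_mul_mul_eta_mem A A
    (PB.diag_mem_of_planar (δ := δ) (Diagram.one_isPlanar (k := k)))
  rw [← PB.one_def, mul_one] at h
  refine Submodule.span_mono (Set.image_mono ?_) h
  rintro f ⟨h1, h2, h3⟩
  exact (Diagram.mem_balancedMotzkinEdges_iff f n).2 ⟨h1, h2 ▸ hcard, h3 ▸ hcard⟩

theorem unit_mul {x : PB δ k} (hx : x ∈ X δ k n) : unit δ k n * x = x := by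
  change LinearMap.mulLeft K (unit δ k n) x = (LinearMap.id : PB δ k →ₗ[K] PB δ k) x
  refine LinearMap.eqOn_span' ?_ hx
  rintro _ ⟨d, hd, rfl⟩
  have hd' := ((Diagram.mem_balancedMotzkinEdges_iff d n).1 hd).2.1
  rw [LinearMap.mulLeft_apply, LinearMap.id_apply, unit, Finset.sum_mul,
    Finset.sum_eq_single d.topFrame]
  · rw [mul_assoc, PB.eta_mul_bar, if_pos rfl, PB.eta_mul_bar, if_pos rfl]
  · intro A _ hA
    rw [mul_assoc, PB.eta_mul_bar, if_neg hA, mul_zero]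
  · intro h
    exact absurd (Finset.mem_powersetCard.2 ⟨Finset.subset_univ _, hd'⟩) h

theorem mul_unit {x : PB δ k} (hx : x ∈ X δ k n) : x * unit δ k n = x := by
  change LinearMap.mulRight K (unit δ k n) x = (LinearMap.id : PB δ k →ₗ[K] PB δ k) x
  refine LinearMap.eqOn_span' ?_ hx
  rintro _ ⟨d, hd, rfl⟩
  have hd' := ((Diagram.mem_balancedMotzkinEdges_iff d n).1 hd).2.2
  rw [LinearMap.mulRight_apply, LinearMap.id_apply, unit, Finset.mul_sum,
    Finset.sum_eq_single d.botFrame]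
  · rw [← mul_assoc, PB.bar_mul_eta, if_pos rfl, PB.bar_mul_eta, if_pos rfl]
  · intro A _ hA
    rw [← mul_assoc, PB.bar_mul_eta, if_neg hA, zero_mul]
  · intro h
    exact absurd (Finset.mem_powersetCard.2 ⟨Finset.subset_univ _, hd'⟩) h

/-- `X(n)` is a ring with identity element. -/
noncomputable instance : Ring (X δ k n) :=
  { (inferInstance : NonUnitalRing (X δ k n)) with
    one := ⟨unit δ k n, unit_mem⟩
    one_mul := fun x => Subtype.ext (unit_mul x.2)
    mul_one := fun x => Subtype.ext (mul_unit x.2) }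

noncomputable instance : Algebra K (X δ k n) :=
  Algebra.ofModule (fun r x y => smul_mul_assoc r x y) (fun r x y => mul_smul_comm r x y)

/-- The element `d̄` of `X(n)`, for a balanced Motzkin `k`-diagram `d` with exactly `n` edges. -/
noncomputable def bar (δ : K) (d : Diagram.balancedMotzkinEdges k n) : X δ k n :=
  ⟨PB.bar δ d.1, Submodule.subset_span ⟨d.1, d.2, rfl⟩⟩

end X

section Inflation

variable {k n : ℕ}

/-- The index set of the basis of `Q_n`: the subsets of `{1, …, k}` of cardinality `n`. -/
abbrev Subsets (k n : ℕ) : Type := {A : Finset (Fin k) // A.card = n}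

/-- The free module `Q_n` on the set of all subsets of `{1, …, k}` of cardinality `n`. -/
abbrev Q (K : Type*) [CommRing K] (k n : ℕ) : Type _ := Subsets k n →₀ K

/-- The matrix unit of `End(Q_n)` sending the basis element `B` to `A` and all others to `0`. -/
noncomputable def matrixUnit (K : Type*) [CommRing K] (A B : Subsets k n) : Q K k n →ₗ[K] Q K k n :=
  Finsupp.lsingle A ∘ₗ Finsupp.lapply B

namespace Diagram

theorem mem_topFrame (d : Diagram k) (i : Fin k) : i ∈ d.topFrame ↔ ¬ d.Isolated (Sum.inl i) := by
  simp only [topFrame, Finset.mem_filter_univ]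

theorem mem_botFrame (d : Diagram k) (i : Fin k) : i ∈ d.botFrame ↔ ¬ d.Isolated (Sum.inr i) := by
  simp only [botFrame, Finset.mem_filter_univ]

/-- The set `A` of the non-isolated vertices of the top row. -/
noncomputable def topSet (d : balancedMotzkinEdges k n) : Subsets k n :=
  ⟨d.1.topFrame, ((mem_balancedMotzkinEdges_iff d.1 n).1 d.2).2.1⟩

/-- The set `B` of the non-isolated vertices of the bottom row. -/
noncomputable def botSet (d : balancedMotzkinEdges k n) : Subsets k n :=
  ⟨d.1.botFrame, ((mem_balancedMotzkinEdges_iff d.1 n).1 d.2).2.2⟩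

/-- The order preserving numbering of the non-isolated vertices in each row. -/
noncomputable def frameEmb (d : balancedMotzkinEdges k n) : Vert n → Vert k :=
  Sum.map ((topSet d).1.orderEmbOfFin (topSet d).2) ((botSet d).1.orderEmbOfFin (botSet d).2)

theorem frameEmb_injective (d : balancedMotzkinEdges k n) : Function.Injective (frameEmb d) :=
  Sum.map_injective.2 ⟨RelEmbedding.injective _, RelEmbedding.injective _⟩

/-- The diagram `t` on `2n` vertices obtained by deleting the isolated vertices of `d`. -/
noncomputable def core (d : balancedMotzkinEdges k n) : Diagram n where
  rel := Setoid.comap (frameEmb d) d.1.rel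
  block_le_two := fun u v w huv huw => by
    have := d.1.block_le_two _ _ _ huv huw
    simpa only [(frameEmb_injective d).eq_iff] using this

theorem core_mem (d : balancedMotzkinEdges k n) : core d ∈ temperleyLieb n := by
  have hpos : ∀ a b, pos a < pos b → pos (frameEmb d a) < pos (frameEmb d b) := by
    rintro (a | a) (b | b) h
    · simp only [frameEmb, Sum.map_inl, pos_inl_lt_inl] at h ⊢
      exact (OrderEmbedding.lt_iff_lt _).2 h
    · exact pos_inl_lt_inr _ _
    · exact absurd h (pos_inr_not_lt_inl _ _)
    · simp only [frameEmb, Sum.map_inr, pos_inr_lt_inr] at h ⊢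
      exact (OrderEmbedding.lt_iff_lt _).2 h
  have hmem : ∀ v, ¬ d.1.Isolated (frameEmb d v) := by
    rintro (v | v)
    · exact (mem_topFrame d.1 _).1 ((topSet d).1.orderEmbOfFin_mem (topSet d).2 v)
    · exact (mem_botFrame d.1 _).1 ((botSet d).1.orderEmbOfFin_mem (botSet d).2 v)
  have hsurj : ∀ w, ¬ d.1.Isolated w → ∃ v, frameEmb d v = w := by
    rintro (w | w) hw
    · have : w ∈ Set.range ((topSet d).1.orderEmbOfFin (topSet d).2) := by
        rw [Finset.range_orderEmbOfFin]
        exact (mem_topFrame d.1 w).2 hw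
      obtain ⟨v, rfl⟩ := this
      exact ⟨Sum.inl v, rfl⟩
    · have : w ∈ Set.range ((botSet d).1.orderEmbOfFin (botSet d).2) := by
        rw [Finset.range_orderEmbOfFin]
        exact (mem_botFrame d.1 w).2 hw
      obtain ⟨v, rfl⟩ := this
      exact ⟨Sum.inr v, rfl⟩
  constructor
  · intro a b c e hab hbc hce hac hbe
    exact d.2.1.1 _ _ _ _ (hpos _ _ hab) (hpos _ _ hbc) (hpos _ _ hce) hac hbe
  · intro v hv
    obtain ⟨w, hw, hr⟩ := (not_isolated_iff d.1 _).1 (hmem v)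
    obtain ⟨w, rfl⟩ := hsurj w
      ((not_isolated_iff d.1 _).2 ⟨_, hw.symm, d.1.rel.symm hr⟩)
    exact hw (congrArg _ (hv w hr))

end Diagram

variable {K : Type*} [CommRing K]

/-- The Temperley-Lieb diagram obtained by deleting the isolated vertices of `d`, as an element of
`TL_n(δ)`. -/
noncomputable def coreTL (δ : K) (d : Diagram.balancedMotzkinEdges k n) : TL δ n :=
  ⟨PB.diag δ (Diagram.core d), Submodule.subset_span ⟨_, Diagram.core_mem d, rfl⟩⟩

/-- The action of `d̄` on `Q_n ⊗ N`, where `N` is a `TL_n(δ')`-module: if `d` corresponds to the triple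
`(A, t, B)`, then `d̄` acts by the matrix unit `E_{A,B}` on `Q_n` and by `t` on `N`. -/
noncomputable def inflationAction (δ' : K) (N : Type*) [AddCommGroup N] [Module K N]
    [Module (TL δ' n) N] [IsScalarTower K (TL δ' n) N] (d : Diagram.balancedMotzkinEdges k n) :
    TensorProduct K (Q K k n) N →ₗ[K] TensorProduct K (Q K k n) N :=
  TensorProduct.map (matrixUnit K (Diagram.topSet d) (Diagram.botSet d))
    (Algebra.lsmul K K N (coreTL δ' d))

end Inflation

end Algebras

end PartialTL

open PartialTL
open scoped TensorProduct

universe u v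

/-!
The key is the product formula `PB.bar_mul_bar`: if the bottom frame of `d` (the set of its non-isolated
bottom vertices) is the top frame of `e`, then `d̄ ē = (δ - 1) ^ N (d ∘ e)‾`, where `N` is the number of
closed loops; otherwise `d̄ ē = 0`. To see this, write `d̄ = η_A d η_B` and `ē = η_B e η_C` with the
idempotents `η` of the frames, and expand `η_B` as an alternating sum over the subsets `S` of `B`. The
summand of `S` is the product of `d`, with the edges at `S` removed, and `e`, multiplied by `η_A` and
`η_C`. These annihilate it unless all vertices of `S` lie on closed loops, since otherwise the composite
loses an edge. If `S` consists of vertices on loops, only the loops that `S` does not meet remain closed.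
Thus a loop contributes `δ` for the empty set, and `-1` in total for the nonempty sets of its vertices.

Deleting isolated vertices identifies the diagrams with frames `A` and `B` of cardinality `n` with the
Temperley-Lieb diagrams on `2n` vertices, and is compatible with products and with the number of loops
(`Diagram.restrict_comp`; this follows by comparing the matrices of the diagrams on two-valued
colourings). Hence `X(n)` is the algebra of matrices over `TL_n(δ - 1)` whose rows and columns are indexed
by the subsets of cardinality `n` (`X.matrixEquiv`). This index set is nonempty for `n ≤ k`, and the
submodules of `ι → S` over a matrix ring correspond to the submodules of `S`
(`matrixSubmoduleOrderIso`). This gives (a), and (b) because `Q_n ⊗ S` is the module of families of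
elements of `S` indexed by the subsets of cardinality `n`.

Finally the ideals `X(n)` annihilate each other and their identity elements sum up to `1`, so that
`PTL_k(δ)` is a quotient of the product of the `X(n)` with `n ≤ k`, which gives (c).
-/

namespace PartialTL

/-! ### Removing edges at a set of bottom vertices -/

namespace Diagram

variable {k : ℕ}

/-- The diagram obtained from `d` by removing the edges at the vertices of the bottom row with index
in `S`. -/
def cutBot (d : Diagram k) (S : Finset (Fin k)) : Diagram k where
  rel :=
    { r := fun a b => a = b ∨ (d.rel a b ∧ ∀ j ∈ S, ¬ d.rel a (Sum.inr j))
      iseqv := ⟨fun _ => Or.inl rfl,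
        fun {a b} h => h.elim (fun h => Or.inl h.symm) fun h => Or.inr ⟨d.rel.symm h.1,
          fun j hj h2 => h.2 j hj (d.rel.trans h.1 h2)⟩,
        fun {a b c} h h' => by
          rcases h with rfl | h
          · exact h'
          · rcases h' with rfl | h'
            · exact Or.inr h
            · exact Or.inr ⟨d.rel.trans h.1 h'.1, h.2⟩⟩ }
  block_le_two := by
    rintro a b c (h | h) (h' | h')
    · exact Or.inl h
    · exact Or.inl h
    · exact Or.inr (Or.inl h')
    · exact d.block_le_two a b c h.1 h'.1

theorem cutBot_rel (d : Diagram k) (S : Finset (Fin k)) (a b : Vert k) :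
    (d.cutBot S).rel a b ↔ a = b ∨ (d.rel a b ∧ ∀ j ∈ S, ¬ d.rel a (Sum.inr j)) := Iff.rfl

theorem cutBot_empty (d : Diagram k) : d.cutBot ∅ = d := by
  ext a b
  rw [cutBot_rel]
  simp only [Finset.notMem_empty, false_imp_iff, implies_true, and_true, or_iff_right_iff_imp]
  rintro rfl
  exact d.rel.refl _

theorem cutBot_le (d : Diagram k) (S : Finset (Fin k)) : d.cutBot S ≤ d := by
  rintro a b (rfl | h)
  · exact d.rel.refl _
  · exact h.1

theorem cut_cutBot (d : Diagram k) (i : Fin k) (S : Finset (Fin k)) :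
    (d.cut (Sum.inr i)).cutBot S = d.cutBot (insert i S) := by
  ext a b
  simp only [cutBot_rel, cut_rel, Finset.mem_insert, forall_eq_or_imp]
  refine or_congr_right' fun hab => ⟨?_, ?_⟩
  · rintro ⟨(h | h), h2⟩
    · exact absurd h hab
    · exact ⟨h.1, h.2, fun j hj hr => h2 j hj (Or.inr ⟨hr, h.2⟩)⟩
  · rintro ⟨h1, h2, h3⟩
    refine ⟨Or.inr ⟨h1, h2⟩, fun j hj hr => ?_⟩
    rcases hr with rfl | hr
    · exact h3 j hj (d.rel.refl _)
    · exact h3 j hj hr.1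

theorem isolated_cutBot_iff (d : Diagram k) (S : Finset (Fin k)) (v : Vert k) :
    (d.cutBot S).Isolated v ↔ d.Isolated v ∨ ∃ j ∈ S, d.rel v (Sum.inr j) := by
  constructor
  · intro h
    by_contra! hc
    refine hc.1 fun w hw => h w (Or.inr ⟨hw, hc.2⟩)
  · rintro (h | ⟨j, hj, hr⟩)
    · exact isolated_of_le (d.cutBot_le S) h
    · rintro w (rfl | hw)
      · rfl
      · exact absurd hr (hw.2 j hj)

theorem cutBot_rel_of_not_isolated {d : Diagram k} {S : Finset (Fin k)} {v w : Vert k}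
    (hv : ¬ (d.cutBot S).Isolated v) (h : d.rel v w) : (d.cutBot S).rel v w := by
  rw [isolated_cutBot_iff] at hv
  push Not at hv
  exact Or.inr ⟨h, hv.2⟩

/-! ### Closed loops and components after removing edges -/

theorem stack_mono {d d' : Diagram k} (h : d' ≤ d) (e : Diagram k) : stack d' e ≤ stack d e :=
  stack_le _ _ _ (fun _ _ hr => stack_upper d e (h hr)) (fun _ _ hr => stack_lower d e hr)

/-- A component without vertices at which an edge was removed is not affected by the removal. -/
theorem stack_cutBot_of_stack {d e : Diagram k} {S : Finset (Fin k)} {x y : Vert3 k}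
    (hx : ∀ v, stack (d.cutBot S) e x (upper v) → (d.cutBot S).Isolated v → d.Isolated v)
    (h : stack d e x y) : stack (d.cutBot S) e x y := by
  let R : Setoid (Vert3 k) :=
    { r := fun a b => stack (d.cutBot S) e x a ↔ stack (d.cutBot S) e x b
      iseqv := ⟨fun _ => Iff.rfl, Iff.symm, Iff.trans⟩ }
  have step : ∀ v w, d.rel v w → stack (d.cutBot S) e x (upper v) →
      stack (d.cutBot S) e x (upper w) := by
    intro v w hr hv
    by_cases hi : (d.cutBot S).Isolated v
    · rwa [hx v hv hi w hr]
    · exact (stack _ e).trans hv (stack_upper _ e (cutBot_rel_of_not_isolated hi hr))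
  refine (stack_le d e R (fun v w hr => ⟨step v w hr, step w v (d.rel.symm hr)⟩)
    (fun v w hr => ?_) h).1 ((stack _ e).refl x)
  have hvw : stack (d.cutBot S) e (lower v) (lower w) := stack_lower _ e hr
  exact ⟨fun hv => (stack _ e).trans hv hvw, fun hw => (stack _ e).trans hw ((stack _ e).symm hvw)⟩

theorem stack_cutBot_of_forall_notMem {d e : Diagram k} {S : Finset (Fin k)} {x y : Vert3 k}
    (hx : ∀ j ∈ S, ¬ stack d e x (mid j)) (h : stack d e x y) : stack (d.cutBot S) e x y := by
  refine stack_cutBot_of_stack (fun v hv hi => ?_) h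
  rcases (isolated_cutBot_iff d S v).1 hi with hi | ⟨j, hj, hr⟩
  · exact hi
  · exact absurd ((stack d e).trans (stack_mono (d.cutBot_le S) e hv) (stack_upper d e hr)) (hx j hj)

/-- If an outer vertex is still joined to another outer vertex after the removal of edges, then no edge
of its component was removed. -/
theorem stack_cutBot_of_not_isolated {d e : Diagram k} {S : Finset (Fin k)} {v : Vert k}
    {y : Vert3 k} (hv : ¬ (comp (d.cutBot S) e).Isolated v) (h : stack d e (outer v) y) :
    stack (d.cutBot S) e (outer v) y :=
  stack_cutBot_of_stack
    (fun w hw hi => absurd (isolated_of_deadEnd (b := true) ⟨w, rfl, hi⟩ hw) hv) h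

/-- The closed loops that survive the removal of edges are those which do not meet `S`. -/
theorem loops_cutBot (d e : Diagram k) (S : Finset (Fin k)) :
    loops (d.cutBot S) e = {c | c ∈ loops d e ∧ ∀ j ∈ S, mid j ∉ c} := by
  have hle := stack_mono (d.cutBot_le S) e
  ext c
  rw [Set.mem_ofPred_eq, mem_loops_iff, mem_loops_iff]
  constructor
  · rintro ⟨⟨z, rfl⟩, h2, h3⟩
    have hcut : ∀ j ∈ S, mid j ∉ {y | stack (d.cutBot S) e y z} := fun j hj =>
      h3 _ true ⟨Sum.inr j, rfl, (isolated_cutBot_iff d S _).2 (Or.inr ⟨j, hj, d.rel.refl _⟩)⟩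
    refine ⟨⟨⟨z, ?_⟩, h2, fun y b hy => h3 y b ?_⟩, hcut⟩
    · ext y
      refine ⟨fun h => hle h, fun h => (stack _ e).symm
        (stack_cutBot_of_stack (fun v hv hi => ?_) ((stack d e).symm h))⟩
      exact absurd ((stack _ e).symm hv) (h3 _ true ⟨v, rfl, hi⟩)
    · cases b
      · exact hy
      · obtain ⟨v, rfl, hv⟩ := hy
        exact ⟨v, rfl, isolated_of_le (d.cutBot_le S) hv⟩
  · rintro ⟨⟨⟨z, rfl⟩, h2, h3⟩, h4⟩
    refine ⟨⟨z, ?_⟩, h2, ?_⟩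
    · ext y
      refine ⟨fun h => (stack _ e).symm (stack_cutBot_of_forall_notMem (fun j hj hr => ?_)
        ((stack d e).symm h)), fun h => hle h⟩
      exact h4 j hj ((stack d e).symm hr)
    · rintro y (_ | _) hy
      · exact h3 y false hy
      · obtain ⟨v, rfl, hv⟩ := hy
        rcases (isolated_cutBot_iff d S v).1 hv with hi | ⟨j, hj, hr⟩
        · exact h3 _ true ⟨v, rfl, hi⟩
        · exact fun hvz => h4 j hj
            ((stack d e).trans ((stack d e).symm (stack_upper d e hr)) hvz)

/-! ### Products of diagrams with matching frames -/

theorem eq_of_stack_of_fixed {d e : Diagram k} {x y : Vert3 k} (h1 : d.upPerm x = x)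
    (h2 : e.lowPerm x = x) (h : stack d e x y) : y = x := by
  let R : Setoid (Vert3 k) :=
    { r := fun a b => a = x ↔ b = x
      iseqv := ⟨fun _ => Iff.rfl, Iff.symm, Iff.trans⟩ }
  have key : ∀ T : Equiv.Perm (Vert3 k), T x = x → ∀ y, y = x ↔ T y = x := fun T hT y => by
    rw [← T.apply_eq_iff_eq (x := y) (y := x), hT]
  exact ((isGen_stack d e).2.2 R (key _ h1) (key _ h2) h).1 rfl

/-- If the frames match, the component of a dead end consists of this vertex only. -/
theorem eq_of_deadEnd {d e : Diagram k} (hde : d.botFrame = e.topFrame) {x y : Vert3 k} {b : Bool}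
    (hx : DeadEnd d e x b) (h : stack d e x y) : y = x := by
  have hiso : ∀ j, d.Isolated (Sum.inr j) ↔ e.Isolated (Sum.inl j) := fun j => by
    have := Finset.ext_iff.1 hde j
    rw [mem_botFrame, mem_topFrame] at this
    exact not_iff_not.1 this
  have hup : ∀ v, d.Isolated v → d.upPerm (upper v) = upper v := fun v hv => by
    rw [upPerm_upper, (isolated_iff d v).1 hv]
  have hlow : ∀ v, e.Isolated v → e.lowPerm (lower v) = lower v := fun v hv => by
    rw [lowPerm_lower, (isolated_iff e v).1 hv]
  refine eq_of_stack_of_fixed ?_ ?_ h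
  all_goals
    cases b
    · obtain ⟨v | v, rfl, hv⟩ := hx
      · first
        | exact hlow _ hv
        | exact hup _ ((hiso v).2 hv)
      · first
        | exact hlow _ hv
        | rfl
    · obtain ⟨v | v, rfl, hv⟩ := hx
      · first
        | exact hup _ hv
        | rfl
      · first
        | exact hup _ hv
        | exact hlow _ ((hiso v).1 hv)

theorem topFrame_comp {d e : Diagram k} (hde : d.botFrame = e.topFrame) :
    (comp d e).topFrame = d.topFrame := by
  ext i
  rw [mem_topFrame, mem_topFrame, not_iff_not]
  constructor
  · intro h
    obtain ⟨y, b, hy, hr⟩ := exists_deadEnd h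
    have := eq_of_deadEnd hde hy ((stack d e).symm hr)
    subst this
    cases b
    · obtain ⟨v, hv, -⟩ := hy
      simp [outer, lower] at hv
    · obtain ⟨v | v, hv, hi⟩ := hy
      · simp only [outer, upper, Sum.elim_inl, Sum.inl.injEq] at hv
        rwa [hv]
      · simp [outer, upper] at hv
  · exact fun h => isolated_of_deadEnd (b := true) ⟨_, rfl, h⟩ ((stack d e).refl _)

theorem botFrame_comp {d e : Diagram k} (hde : d.botFrame = e.topFrame) :
    (comp d e).botFrame = e.botFrame := by
  ext i
  rw [mem_botFrame, mem_botFrame, not_iff_not]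
  constructor
  · intro h
    obtain ⟨y, b, hy, hr⟩ := exists_deadEnd h
    have := eq_of_deadEnd hde hy ((stack d e).symm hr)
    subst this
    cases b
    · obtain ⟨v | v, hv, hi⟩ := hy
      · simp [outer, lower] at hv
      · simp only [outer, lower, Sum.elim_inr, Sum.inr.injEq] at hv
        rwa [hv]
    · obtain ⟨v | v, hv, -⟩ := hy <;> simp [outer, upper] at hv
  · exact fun h => isolated_of_deadEnd (b := false) ⟨_, rfl, h⟩ ((stack d e).refl _)

/-- Removing edges in the middle row does not affect the product exactly if all these edges belong to
closed loops. -/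
theorem comp_cutBot_eq_iff {d e : Diagram k} (hde : d.botFrame = e.topFrame) {S : Finset (Fin k)}
    (hS : S ⊆ d.botFrame) :
    comp (d.cutBot S) e = comp d e ↔ ∀ j ∈ S, ∃ c ∈ loops d e, mid j ∈ c := by
  have hle := stack_mono (d.cutBot_le S) e
  constructor
  · intro h j hj
    refine ⟨{y | stack d e y (mid j)},
      (mem_loops_iff _ _ _).2 ⟨⟨_, rfl⟩, fun v hv => ?_, fun y b hy hyj => ?_⟩, (stack d e).refl _⟩
    · -- an outer vertex on the component of a removed edge becomes isolated
      have hnot : ¬ (comp d e).Isolated v := by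
        intro hi
        obtain ⟨y, b, hy, hr⟩ := exists_deadEnd hi
        have h1 := eq_of_deadEnd hde hy ((stack d e).symm hr)
        subst h1
        have h2 := eq_of_deadEnd hde hy hv
        rcases v with v | v <;> simp [outer] at h2
      rw [← h] at hnot
      exact hnot (isolated_of_deadEnd (b := true) ⟨Sum.inr j, rfl,
        (isolated_cutBot_iff d S _).2 (Or.inr ⟨j, hj, d.rel.refl _⟩)⟩
        (stack_cutBot_of_not_isolated hnot hv))
    · have h1 := eq_of_deadEnd hde hy hyj
      subst h1
      have hjB := (mem_botFrame d j).1 (hS hj)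
      cases b
      · obtain ⟨v, hv, hi⟩ := hy
        have : v = Sum.inl j := (Sum.inr_injective hv).symm
        subst this
        exact (mem_topFrame e j).1 (hde ▸ hS hj) hi
      · obtain ⟨v, hv, hi⟩ := hy
        have : v = Sum.inr j := upper_injective hv.symm
        subst this
        exact hjB hi
  · intro h
    ext v w
    rw [comp_rel, comp_rel]
    refine ⟨fun hr => hle hr, fun hr => stack_cutBot_of_forall_notMem (fun j hj hvj => ?_) hr⟩
    obtain ⟨c, hc, hjc⟩ := h j hj
    exact ((mem_loops_iff _ _ _).1 hc).2.1 v (mem_of_rel hc.1 hjc ((stack d e).symm hvj))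

/-- A diagram cannot lose an edge without a vertex leaving one of its frames. -/
theorem eq_of_le_of_frames {d e : Diagram k} (h : d ≤ e) (h1 : e.topFrame ⊆ d.topFrame)
    (h2 : e.botFrame ⊆ d.botFrame) : d = e := by
  refine le_antisymm h fun v w hvw => ?_
  by_cases hne : v = w
  · exact hne ▸ d.rel.refl v
  have hv : ¬ e.Isolated v := fun hi => hne (hi w hvw).symm
  have hv' : ¬ d.Isolated v := by
    rcases v with v | v
    · exact (mem_topFrame d v).1 (h1 ((mem_topFrame e v).2 hv))
    · exact (mem_botFrame d v).1 (h2 ((mem_botFrame e v).2 hv))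
  obtain ⟨u, hu, hr⟩ := (not_isolated_iff d v).1 hv'
  rcases e.block_le_two v w u hvw (h hr) with h3 | h3 | h3
  · exact absurd h3 hne
  · exact absurd h3.symm hu
  · exact h3 ▸ hr

end Diagram

/-! ### The product of alternating elements -/

/-- The alternating sum of the powers `δ ^ m(S)` over all sets `S` of points of a disjoint union of
nonempty sets, where `m(S)` is the number of those that `S` does not meet. -/
theorem sum_neg_one_pow_mul_pow_card_disjoint {K : Type*} [CommRing K] {ι α : Type*} [DecidableEq ι]
    [DecidableEq α] (P : Finset ι) (f : ι → Finset α) (hne : ∀ c ∈ P, (f c).Nonempty)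
    (hdisj : ∀ c ∈ P, ∀ c' ∈ P, c ≠ c' → Disjoint (f c) (f c')) (δ : K) :
    ∑ S ∈ (P.biUnion f).powerset, (-1 : K) ^ S.card *
      δ ^ (P.filter fun c => Disjoint (f c) S).card = (δ - 1) ^ P.card := by
  -- expand each power of `δ = (δ - 1) + 1`; only the full set of factors `δ - 1` survives
  have h1 : ∀ S : Finset α, δ ^ (P.filter fun c => Disjoint (f c) S).card =
      ∑ T ∈ P.powerset, if Disjoint (T.biUnion f) S then (δ - 1) ^ T.card else 0 := by
    intro S
    have h := Finset.sum_pow_mul_eq_add_pow (δ - 1) 1 (P.filter fun c => Disjoint (f c) S)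
    rw [sub_add_cancel] at h
    rw [← h, ← Finset.sum_filter]
    refine Finset.sum_congr ?_ fun T _ => by simp
    ext T
    simp only [Finset.mem_powerset, Finset.mem_filter, Finset.disjoint_biUnion_left,
      Finset.subset_iff]
    exact ⟨fun h => ⟨fun c hc => (h hc).1, fun c hc => (h hc).2⟩, fun h c hc => ⟨h.1 hc, h.2 c hc⟩⟩
  simp only [h1, Finset.mul_sum]
  rw [Finset.sum_comm, Finset.sum_eq_single P]
  · rw [Finset.sum_eq_single ∅]
    · simp
    · intro S hS hS0
      rw [if_neg, mul_zero]
      exact fun hd => hS0 (Finset.disjoint_self_iff_empty S |>.1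
        (hd.mono_left (Finset.mem_powerset.1 hS)))
    · simp
  · intro T hT hTP
    rw [Finset.mem_powerset] at hT
    obtain ⟨c, hcP, hcT⟩ : ∃ c ∈ P, c ∉ T := by
      by_contra! hc
      exact hTP (hT.antisymm hc)
    have hne' : (P.biUnion f \ T.biUnion f).Nonempty := by
      obtain ⟨x, hx⟩ := hne c hcP
      refine ⟨x, Finset.mem_sdiff.2 ⟨Finset.mem_biUnion.2 ⟨c, hcP, hx⟩, fun hx' => ?_⟩⟩
      obtain ⟨c', hc', hxc'⟩ := Finset.mem_biUnion.1 hx'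
      exact Finset.disjoint_left.1 (hdisj c hcP c' (hT hc') (by rintro rfl; exact hcT hc')) hx hxc'
    have h2 : (P.biUnion f).powerset.filter (fun S => Disjoint (T.biUnion f) S) =
        (P.biUnion f \ T.biUnion f).powerset := by
      ext S
      rw [Finset.mem_filter, Finset.mem_powerset, Finset.mem_powerset, Finset.subset_sdiff,
        disjoint_comm]
    simp only [mul_ite, mul_zero]
    rw [← Finset.sum_filter, h2, ← Finset.sum_mul]
    have h3 := congrArg (Int.cast (R := K)) (Finset.sum_powerset_neg_one_pow_card_of_nonempty hne')
    push_cast at h3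
    rw [h3, zero_mul]
  · simp

namespace PB

variable {K : Type*} [CommRing K] {δ : K} {k : ℕ}

/-- The idempotents of the frames of `f` turn `f` into `f̄` and annihilate smaller diagrams. -/
theorem eta_mul_diag_mul_eta {f g : Diagram k} [Decidable (g = f)] (h : g ≤ f) :
    eta δ f.topFrame * diag δ g * eta δ f.botFrame = if g = f then bar δ f else 0 := by
  have hbar : ∀ e, eta δ f.topFrame * bar δ e * eta δ f.botFrame =
      if f.topFrame = e.topFrame ∧ f.botFrame = e.botFrame then bar δ e else 0 := fun e => by
    rw [eta_mul_bar]
    by_cases h1 : f.topFrame = e.topFrame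
    · simp only [h1, if_true, bar_mul_eta, true_and]
    · simp [h1]
  have hrest : eta δ f.topFrame * (diag δ g - bar δ g) * eta δ f.botFrame = 0 := by
    let Φ : PB δ k →ₗ[K] PB δ k :=
      LinearMap.mulRight K (eta δ f.botFrame) ∘ₗ LinearMap.mulLeft K (eta δ f.topFrame)
    have h2 : Submodule.span K (bar δ '' {e | e < g}) ≤ LinearMap.ker Φ := by
      rw [Submodule.span_le]
      rintro _ ⟨e, he, rfl⟩
      change eta δ f.topFrame * bar δ e * eta δ f.botFrame = 0
      rw [hbar, if_neg]
      rintro ⟨h3, h4⟩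
      exact (lt_of_lt_of_le he h).ne (Diagram.eq_of_le_of_frames (he.le.trans h) h3.subset h4.subset)
    exact h2 (diag_sub_bar_mem g)
  have h1 : diag δ g = (diag δ g - bar δ g) + bar δ g := by abel
  rw [h1, mul_add, add_mul, hrest, zero_add, hbar]
  split_ifs with h2 h3 h3
  · rw [h3]
  · exact absurd (Diagram.eq_of_le_of_frames h h2.1.subset h2.2.subset) h3
  · exact absurd (by rw [h3]; exact ⟨rfl, rfl⟩) h2
  · rfl

theorem diag_mul_p (d : Diagram k) (i : Fin k) :
    diag δ d * diag δ (Diagram.p i) = diag δ (d.cut (Sum.inr i)) := by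
  rw [mul_p, cutMap, lift_diag]

/-- The part of the expansion of `d * eta B` that comes from a list of columns. The edges at vertices
outside of `B` have to be absent, so that the factors `p i` with `i ∉ B` act trivially. -/
theorem diag_mul_list_prod (B : Finset (Fin k)) (l : List (Fin k)) (hl : l.Nodup) (d : Diagram k)
    (hd : ∀ i, i ∉ B → d.Isolated (Sum.inr i)) :
    diag δ d * (l.map fun i =>
      if i ∈ B then 1 - diag δ (Diagram.p i) else diag δ (Diagram.p i)).prod =
    ∑ S ∈ (l.toFinset ∩ B).powerset, (-1 : K) ^ S.card • diag δ (d.cutBot S) := by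
  induction l generalizing d with
  | nil => simp [Diagram.cutBot_empty]
  | cons a l ih =>
    rw [List.nodup_cons] at hl
    rw [List.map_cons, List.prod_cons, ← mul_assoc, List.toFinset_cons]
    split_ifs with ha
    · have ha' : a ∉ l.toFinset ∩ B := by simp [hl.1]
      rw [mul_sub, mul_one, diag_mul_p, sub_mul, ih hl.2 d hd, ih hl.2 (d.cut (Sum.inr a))
        fun i hi => Diagram.isolated_of_le (d.cut_le _) (hd i hi),
        Finset.insert_inter_of_mem ha, Finset.sum_powerset_insert ha', sub_eq_add_neg,
        ← Finset.sum_neg_distrib]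
      congr 1
      refine Finset.sum_congr rfl fun S hS => ?_
      rw [Finset.card_insert_of_notMem fun h => ha' (Finset.mem_powerset.1 hS h), pow_succ,
        mul_neg_one, neg_smul, Diagram.cut_cutBot]
    · rw [diag_mul_p, Diagram.cut_of_isolated (hd a ha), ih hl.2 d hd,
        Finset.insert_inter_of_notMem ha]

theorem diag_mul_eta (d : Diagram k) :
    diag δ d * eta δ d.botFrame =
      ∑ S ∈ d.botFrame.powerset, (-1 : K) ^ S.card • diag δ (d.cutBot S) := by
  rw [eta, diag_mul_list_prod _ _ (List.nodup_finRange k) d]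
  · simp
  · intro i hi
    rw [Diagram.mem_botFrame] at hi
    exact not_not.1 hi

/-- The product of the alternating elements: every closed loop contributes the factor `δ - 1`. -/
theorem bar_mul_bar {d e : Diagram k} (hde : d.botFrame = e.topFrame) :
    bar δ d * bar δ e = (δ - 1) ^ Diagram.numLoops d e • bar δ (Diagram.comp d e) := by
  classical
  have hd : bar δ d = eta δ d.topFrame * diag δ d * eta δ d.botFrame := by
    rw [eta_mul_diag_mul_eta le_rfl, if_pos rfl]
  have he : bar δ e = eta δ e.topFrame * diag δ e * eta δ e.botFrame := by
    rw [eta_mul_diag_mul_eta le_rfl, if_pos rfl]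
  have h1 : bar δ d * bar δ e =
      eta δ d.topFrame * (diag δ d * eta δ d.botFrame * diag δ e) * eta δ e.botFrame := by
    calc bar δ d * bar δ e = bar δ d * eta δ d.botFrame * bar δ e := by
          rw [bar_mul_eta, if_pos rfl]
      _ = bar δ d * (eta δ d.botFrame * eta δ d.botFrame) * diag δ e * eta δ e.botFrame := by
          rw [he, ← hde]; noncomm_ring
      _ = bar δ d * diag δ e * eta δ e.botFrame := by
          rw [← mul_assoc (bar δ d), bar_mul_eta, if_pos rfl, bar_mul_eta, if_pos rfl]
      _ = _ := by rw [hd]; noncomm_ring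
  -- expanding the middle idempotent removes edges at all subsets `S` of the common frame; the outer
  -- idempotents keep a summand only if removing the edges at `S` does not change the composite
  have hle : ∀ S, Diagram.comp (d.cutBot S) e ≤ Diagram.comp d e := fun S v w h =>
    Diagram.stack_mono (d.cutBot_le S) e h
  set P : Finset (Set (Diagram.Vert3 k)) := (Set.toFinite (Diagram.loops d e)).toFinset with hP
  let f : Set (Diagram.Vert3 k) → Finset (Fin k) := fun c =>
    Finset.univ.filter fun j => Diagram.mid j ∈ c
  have hmemP : ∀ c, c ∈ P ↔ c ∈ Diagram.loops d e := fun c => by simp [hP]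
  have hmemf : ∀ c j, j ∈ f c ↔ Diagram.mid j ∈ c := fun c j => by simp [f]
  have hsub : P.biUnion f ⊆ d.botFrame := by
    intro j hj
    obtain ⟨c, hc, hjc⟩ := Finset.mem_biUnion.1 hj
    obtain ⟨j', hj', hi, -⟩ := ((hmemP c).1 hc).2 _ ((hmemf c j).1 hjc)
    simp only [Sum.inr.injEq, Sum.inl.injEq] at hj'
    exact (Diagram.mem_botFrame d j).2 (hj' ▸ hi)
  have hloops : ∀ S, Diagram.numLoops (d.cutBot S) e =
      (P.filter fun c => Disjoint (f c) S).card := by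
    intro S
    rw [Diagram.numLoops, Diagram.loops_cutBot, ← Set.ncard_coe_finset]
    congr 1
    ext c
    simp only [Set.mem_ofPred_eq, Finset.coe_filter, hmemP, Finset.disjoint_right, hmemf]
  have hcomp : ∀ S ∈ d.botFrame.powerset, Diagram.comp (d.cutBot S) e = Diagram.comp d e ↔
      S ⊆ P.biUnion f := by
    intro S hS
    rw [Diagram.comp_cutBot_eq_iff hde (Finset.mem_powerset.1 hS)]
    simp only [Finset.subset_iff, Finset.mem_biUnion, hmemP, hmemf]
  rw [h1, diag_mul_eta, Finset.sum_mul, Finset.mul_sum, Finset.sum_mul]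
  have h2 : ∀ S ∈ d.botFrame.powerset, eta δ d.topFrame *
      ((-1 : K) ^ S.card • diag δ (d.cutBot S) * diag δ e) * eta δ e.botFrame =
      if S ⊆ P.biUnion f then ((-1 : K) ^ S.card * δ ^ (P.filter fun c => Disjoint (f c) S).card) •
        bar δ (Diagram.comp d e) else 0 := by
    intro S hS
    rw [smul_mul_assoc, diag_mul, smul_smul, mul_smul_comm, smul_mul_assoc,
      ← Diagram.topFrame_comp hde, ← Diagram.botFrame_comp hde, eta_mul_diag_mul_eta (hle S),
      hloops]
    simp only [hcomp S hS]
    split_ifs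
    · rfl
    · rw [smul_zero]
  rw [Finset.sum_congr rfl h2, ← Finset.sum_filter, ← Finset.sum_smul]
  have h3 : d.botFrame.powerset.filter (fun S => S ⊆ P.biUnion f) = (P.biUnion f).powerset := by
    ext S
    simp only [Finset.mem_filter, Finset.mem_powerset]
    exact ⟨fun h => h.2, fun h => ⟨h.trans hsub, h⟩⟩
  rw [h3, sum_neg_one_pow_mul_pow_card_disjoint]
  · rw [Diagram.numLoops, hP, Set.ncard_eq_toFinset_card]
  · intro c hc
    have hcl := (hmemP c).1 hc
    obtain ⟨z, rfl⟩ := hcl.1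
    obtain ⟨j, rfl, -⟩ := hcl.2 z ((Diagram.stack d e).refl z)
    exact ⟨j, (hmemf _ _).2 ((Diagram.stack d e).refl _)⟩
  · intro c hc c' hc' hne
    rw [Finset.disjoint_left]
    intro j hj hj'
    exact hne (Setoid.eq_of_mem_classes ((hmemP c).1 hc).1 ((hmemf _ _).1 hj)
      ((hmemP c').1 hc').1 ((hmemf _ _).1 hj'))

end PB

/-! ### Inserting and deleting isolated vertices -/

namespace Diagram

variable {k n : ℕ}

/-- The embedding of the `2n` vertices into the `2k` vertices whose image consists of the vertices of
the top row with index in `A` and those of the bottom row with index in `B`, preserving the order in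
each row. -/
noncomputable def setEmb (A B : Subsets k n) : Vert n → Vert k :=
  Sum.map (A.1.orderEmbOfFin A.2) (B.1.orderEmbOfFin B.2)

theorem setEmb_injective (A B : Subsets k n) : Function.Injective (setEmb A B) :=
  Sum.map_injective.2 ⟨RelEmbedding.injective _, RelEmbedding.injective _⟩

theorem inl_mem_range_setEmb (A B : Subsets k n) (i : Fin k) :
    Sum.inl i ∈ Set.range (setEmb A B) ↔ i ∈ A.1 := by
  rw [← Finset.mem_coe, ← Finset.range_orderEmbOfFin A.1 A.2]
  simp only [setEmb, Set.mem_range, Sum.exists, Sum.map_inl, Sum.map_inr, Sum.inl.injEq,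
    reduceCtorEq, exists_false, or_false]

theorem inr_mem_range_setEmb (A B : Subsets k n) (i : Fin k) :
    Sum.inr i ∈ Set.range (setEmb A B) ↔ i ∈ B.1 := by
  rw [← Finset.mem_coe, ← Finset.range_orderEmbOfFin B.1 B.2]
  simp only [setEmb, Set.mem_range, Sum.exists, Sum.map_inl, Sum.map_inr, Sum.inr.injEq,
    reduceCtorEq, exists_false, false_or]

theorem pos_setEmb_lt_iff (A B : Subsets k n) (a b : Vert n) :
    pos (setEmb A B a) < pos (setEmb A B b) ↔ pos a < pos b := by
  rcases a with a | a <;> rcases b with b | b <;>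
    simp only [setEmb, Sum.map_inl, Sum.map_inr, pos_inl_lt_inl, pos_inr_lt_inr,
      OrderEmbedding.lt_iff_lt, pos_inl_lt_inr, pos_inr_not_lt_inl]

/-- The restriction of `d` to the vertices given by `A` and `B`, renumbered. -/
noncomputable def restrict (A B : Subsets k n) (d : Diagram k) : Diagram n where
  rel := Setoid.comap (setEmb A B) d.rel
  block_le_two := fun u v w huv huw => by
    have := d.block_le_two _ _ _ huv huw
    simpa only [(setEmb_injective A B).eq_iff] using this

/-- The diagram obtained from `t` by inserting isolated vertices, such that the old vertices become
those given by `A` and `B`. -/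
noncomputable def inflate (A B : Subsets k n) (t : Diagram n) : Diagram k where
  rel :=
    { r := fun v w => v = w ∨ ∃ a b, setEmb A B a = v ∧ setEmb A B b = w ∧ t.rel a b
      iseqv := ⟨fun _ => Or.inl rfl,
        by
          rintro v w (rfl | ⟨a, b, rfl, rfl, h⟩)
          · exact Or.inl rfl
          · exact Or.inr ⟨b, a, rfl, rfl, t.rel.symm h⟩,
        by
          rintro u v w (rfl | ⟨a, b, rfl, rfl, h⟩) (rfl | ⟨c, e, hc, rfl, h'⟩)
          · exact Or.inl rfl
          · exact Or.inr ⟨c, e, hc, rfl, h'⟩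
          · exact Or.inr ⟨a, b, rfl, rfl, h⟩
          · obtain rfl := setEmb_injective A B hc
            exact Or.inr ⟨a, e, rfl, rfl, t.rel.trans h h'⟩⟩ }
  block_le_two := by
    rintro u v w (rfl | ⟨a, b, rfl, rfl, h⟩) (h' | ⟨c, e, hc, rfl, h'⟩)
    · exact Or.inl rfl
    · exact Or.inl rfl
    · exact Or.inr (Or.inl h')
    · obtain rfl := setEmb_injective A B hc
      simpa only [(setEmb_injective A B).eq_iff] using t.block_le_two _ _ _ h h'

theorem restrict_rel (A B : Subsets k n) (d : Diagram k) (a b : Vert n) :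
    (restrict A B d).rel a b ↔ d.rel (setEmb A B a) (setEmb A B b) := Iff.rfl

theorem inflate_rel (A B : Subsets k n) (t : Diagram n) (v w : Vert k) :
    (inflate A B t).rel v w ↔ v = w ∨ ∃ a b, setEmb A B a = v ∧ setEmb A B b = w ∧ t.rel a b :=
  Iff.rfl

theorem restrict_inflate (A B : Subsets k n) (t : Diagram n) :
    restrict A B (inflate A B t) = t := by
  ext a b
  rw [restrict_rel, inflate_rel]
  constructor
  · rintro (h | ⟨a', b', ha, hb, h⟩)
    · exact setEmb_injective A B h ▸ t.rel.refl a
    · rwa [← setEmb_injective A B ha, ← setEmb_injective A B hb]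
  · exact fun h => Or.inr ⟨a, b, rfl, rfl, h⟩

theorem mem_range_setEmb_iff {A B : Subsets k n} {d : Diagram k} (hA : d.topFrame = A.1)
    (hB : d.botFrame = B.1) (v : Vert k) : v ∈ Set.range (setEmb A B) ↔ ¬ d.Isolated v := by
  rcases v with v | v
  · rw [inl_mem_range_setEmb, ← hA, mem_topFrame]
  · rw [inr_mem_range_setEmb, ← hB, mem_botFrame]

theorem inflate_restrict {A B : Subsets k n} {d : Diagram k} (hA : d.topFrame = A.1)
    (hB : d.botFrame = B.1) : inflate A B (restrict A B d) = d := by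
  ext v w
  rw [inflate_rel]
  constructor
  · rintro (rfl | ⟨a, b, rfl, rfl, h⟩)
    · exact d.rel.refl _
    · exact h
  · intro h
    by_cases hne : v = w
    · exact Or.inl hne
    · obtain ⟨a, rfl⟩ := (mem_range_setEmb_iff hA hB v).2 fun hi => hne (hi w h).symm
      obtain ⟨b, rfl⟩ := (mem_range_setEmb_iff hA hB w).2 fun hi => hne (hi _ (d.rel.symm h))
      exact Or.inr ⟨a, b, rfl, rfl, h⟩

theorem isolated_inflate_iff (A B : Subsets k n) {t : Diagram n} (ht : t ∈ temperleyLieb n)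
    (v : Vert k) : (inflate A B t).Isolated v ↔ v ∉ Set.range (setEmb A B) := by
  constructor
  · rintro h ⟨a, rfl⟩
    refine ht.2 a fun b hb => setEmb_injective A B (h _ (Or.inr ⟨a, b, rfl, rfl, hb⟩))
  · rintro h w (rfl | ⟨a, b, rfl, rfl, -⟩)
    · rfl
    · exact absurd ⟨a, rfl⟩ h

theorem topFrame_inflate (A B : Subsets k n) {t : Diagram n} (ht : t ∈ temperleyLieb n) :
    (inflate A B t).topFrame = A.1 := by
  ext i
  rw [mem_topFrame, isolated_inflate_iff A B ht, not_not, inl_mem_range_setEmb]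

theorem botFrame_inflate (A B : Subsets k n) {t : Diagram n} (ht : t ∈ temperleyLieb n) :
    (inflate A B t).botFrame = B.1 := by
  ext i
  rw [mem_botFrame, isolated_inflate_iff A B ht, not_not, inr_mem_range_setEmb]

theorem inflate_isPlanar (A B : Subsets k n) {t : Diagram n} (ht : t.IsPlanar) :
    (inflate A B t).IsPlanar := by
  rintro a b c e hab hbc hce (rfl | ⟨a, c, rfl, rfl, hac⟩) (rfl | ⟨b, e, rfl, rfl, hbe⟩)
  · omega
  · omega
  · omega
  · rw [pos_setEmb_lt_iff] at hab hbc hce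
    exact Or.inr ⟨a, b, rfl, rfl, ht a b c e hab hbc hce hac hbe⟩

theorem inflate_mem (A B : Subsets k n) {t : Diagram n} (ht : t ∈ temperleyLieb n) :
    inflate A B t ∈ balancedMotzkinEdges k n := by
  rw [mem_balancedMotzkinEdges_iff, topFrame_inflate A B ht, botFrame_inflate A B ht]
  exact ⟨inflate_isPlanar A B ht.1, A.2, B.2⟩

theorem core_eq_restrict (d : balancedMotzkinEdges k n) :
    core d = restrict (topSet d) (botSet d) d.1 := rfl

theorem compat_restrict_iff {A B : Subsets k n} {d : Diagram k} (hA : d.topFrame = A.1)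
    (hB : d.botFrame = B.1) (F : Vert k → Prop) (hF : ∀ v, F v → v ∈ Set.range (setEmb A B)) :
    Compat (restrict A B d) (F ∘ setEmb A B) ↔ Compat d F := by
  have hr := mem_range_setEmb_iff hA hB
  constructor
  · rintro ⟨h1, -⟩
    refine ⟨fun v w hvw => ?_, fun v hv hFv => (hr v).1 (hF v hFv) hv⟩
    by_cases hne : v = w
    · rw [hne]
    · obtain ⟨a, rfl⟩ := (hr v).2 fun hi => hne (hi w hvw).symm
      obtain ⟨b, rfl⟩ := (hr w).2 fun hi => hne (hi _ (d.rel.symm hvw))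
      exact h1 a b hvw
  · rintro ⟨h1, h2⟩
    refine ⟨fun a b hab => h1 _ _ hab, fun a ha => ?_⟩
    -- no vertex of the restriction is isolated
    obtain ⟨w, hw, hvw⟩ := (not_isolated_iff d _).1 ((hr _).1 ⟨a, rfl⟩)
    obtain ⟨b, rfl⟩ := (hr w).2 ((not_isolated_iff d _).2 ⟨_, hw.symm, d.rel.symm hvw⟩)
    exact absurd (congrArg _ (ha b hvw)) hw

/-- The extension by `False` of a colouring of `n` points to `k` points along `A`. -/
def extendRow (A : Subsets k n) (f : Fin n → Prop) (i : Fin k) : Prop :=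
  ∃ a, A.1.orderEmbOfFin A.2 a = i ∧ f a

theorem extendRow_apply (A : Subsets k n) (f : Fin n → Prop) (a : Fin n) :
    extendRow A f (A.1.orderEmbOfFin A.2 a) ↔ f a :=
  ⟨fun ⟨_, h, hf⟩ => (A.1.orderEmbOfFin A.2).injective h ▸ hf, fun h => ⟨a, rfl, h⟩⟩

theorem extendRow_injective (A : Subsets k n) : Function.Injective (extendRow A) := by
  intro f g h
  funext a
  rw [← propext (extendRow_apply A f a), h, propext (extendRow_apply A g a)]

/-- The matrix of a diagram on colourings contains that of its restriction as a submatrix. -/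
theorem tens_restrict {A B : Subsets k n} {d : Diagram k} (hA : d.topFrame = A.1)
    (hB : d.botFrame = B.1) (f g : Fin n → Prop) :
    tens (restrict A B d) f g = tens d (extendRow A f) (extendRow B g) := by
  have h := compat_restrict_iff hA hB (Sum.elim (extendRow A f) (extendRow B g)) (by
    rintro (v | v) ⟨a, rfl, -⟩
    · exact ⟨Sum.inl a, rfl⟩
    · exact ⟨Sum.inr a, rfl⟩)
  have h2 : Sum.elim (extendRow A f) (extendRow B g) ∘ setEmb A B = Sum.elim f g := by
    funext v
    rcases v with v | v
    · exact propext (extendRow_apply A f v)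
    · exact propext (extendRow_apply B g v)
  rw [h2] at h
  unfold tens
  by_cases hc : Compat d (Sum.elim (extendRow A f) (extendRow B g))
  · rw [if_pos hc, if_pos (h.2 hc)]
  · rw [if_neg hc, if_neg (mt h.1 hc)]

/-- Deleting isolated vertices is compatible with products of diagrams with matching frames, and does
not change the number of closed loops. -/
theorem restrict_comp {A B C : Subsets k n} {d e : Diagram k} (hdA : d.topFrame = A.1)
    (hdB : d.botFrame = B.1) (heB : e.topFrame = B.1) (heC : e.botFrame = C.1) :
    numLoops (restrict A B d) (restrict B C e) = numLoops d e ∧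
      comp (restrict A B d) (restrict B C e) = restrict A C (comp d e) := by
  classical
  have hde : d.botFrame = e.topFrame := hdB.trans heB.symm
  refine tens_inj ?_
  rw [← tens_mul]
  ext f g
  rw [Matrix.smul_apply, tens_restrict ((topFrame_comp hde).trans hdA)
    ((botFrame_comp hde).trans heC), ← Matrix.smul_apply, ← tens_mul, Matrix.mul_apply,
    Matrix.mul_apply]
  refine Fintype.sum_of_injective (extendRow B) (extendRow_injective B) _ _ ?_ ?_
  · intro h hh
    -- a compatible colouring is trivial off the frame, so it is the extension of its restriction
    have : ¬ Compat d (Sum.elim (extendRow A f) h) := by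
      intro hc
      refine hh ⟨fun a => h (B.1.orderEmbOfFin B.2 a), funext fun i => propext ⟨?_, fun hi => ?_⟩⟩
      · rintro ⟨a, rfl, ha⟩
        exact ha
      · have hiB : Sum.inr i ∈ Set.range (setEmb A B) :=
          (mem_range_setEmb_iff hdA hdB _).2 fun hiso => hc.2 _ hiso hi
        obtain ⟨a | a, ha⟩ := hiB
        · simp [setEmb] at ha
        · obtain rfl := Sum.inr_injective ha
          exact ⟨a, rfl, hi⟩
    rw [tens, if_neg this, zero_mul]
  · intro h
    rw [tens_restrict hdA hdB, tens_restrict heB heC]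

end Diagram

/-! ### The ideal `X(n)` as a matrix algebra -/

section MatrixAlgebra

variable {K : Type*} [CommRing K] {δ : K} {k n : ℕ}

theorem TL.span_range :
    Submodule.span K (Set.range fun t : Diagram.temperleyLieb n =>
      (⟨PB.diag δ t.1, Submodule.subset_span ⟨_, t.2, rfl⟩⟩ : TL δ n)) = ⊤ := by
  have h := Submodule.span_span_coe_preimage (R := K) (s := PB.diag δ '' Diagram.temperleyLieb n)
  refine Eq.trans (congrArg _ ?_) h
  ext ⟨x, hx⟩
  constructor
  · rintro ⟨t, ht⟩
    exact ⟨t.1, t.2, congrArg Subtype.val ht⟩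
  · rintro ⟨t, ht, rfl⟩
    exact ⟨⟨t, ht⟩, rfl⟩

theorem X.span_range_bar : Submodule.span K (Set.range (X.bar δ (k := k) (n := n))) = ⊤ := by
  have h := Submodule.span_span_coe_preimage (R := K)
    (s := PB.bar δ '' Diagram.balancedMotzkinEdges k n)
  refine Eq.trans (congrArg _ ?_) h
  ext ⟨x, hx⟩
  constructor
  · rintro ⟨t, ht⟩
    exact ⟨t.1, t.2, congrArg Subtype.val ht⟩
  · rintro ⟨t, ht, rfl⟩
    exact ⟨⟨t, ht⟩, rfl⟩

open scoped Classical in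
/-- The linear map to `PB_n(δ')` that deletes the isolated vertices of the diagrams with frames `A` and
`B` and annihilates all other diagrams. -/
noncomputable def frameProj (δ δ' : K) (A B : Subsets k n) : PB δ k →ₗ[K] PB δ' n :=
  PB.lift fun d => if d.topFrame = A.1 ∧ d.botFrame = B.1 then
    PB.diag δ' (Diagram.restrict A B d) else 0

open scoped Classical in
/-- The alternating element `d̄` only involves `d` and diagrams with a smaller frame, so that the
projection sees no summand but `d`. -/
theorem frameProj_bar (δ' : K) (A B : Subsets k n) (d : Diagram.balancedMotzkinEdges k n) :
    frameProj δ δ' A B (PB.bar δ d.1) = if Diagram.topSet d = A ∧ Diagram.botSet d = B then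
      PB.diag δ' (Diagram.core d) else 0 := by
  obtain ⟨-, hd1, hd2⟩ := (Diagram.mem_balancedMotzkinEdges_iff d.1 n).1 d.2
  have hdiag : ∀ e ≤ d.1, e ≠ d.1 → frameProj δ δ' A B (PB.diag δ e) = 0 := by
    intro e he hne
    rw [frameProj, PB.lift_diag, if_neg]
    rintro ⟨h1, h2⟩
    have hsub1 : e.topFrame ⊆ d.1.topFrame := fun i hi => by
      rw [Diagram.mem_topFrame] at hi ⊢
      exact fun h => hi (Diagram.isolated_of_le he h)
    have hsub2 : e.botFrame ⊆ d.1.botFrame := fun i hi => by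
      rw [Diagram.mem_botFrame] at hi ⊢
      exact fun h => hi (Diagram.isolated_of_le he h)
    refine hne (Diagram.eq_of_le_of_frames he
      (Finset.eq_of_subset_of_card_le hsub1 ?_).superset
      (Finset.eq_of_subset_of_card_le hsub2 ?_).superset)
    · rw [h1, A.2, hd1]
    · rw [h2, B.2, hd2]
  rw [PB.bar, map_sum, Finset.sum_eq_single d.1]
  · rw [map_smul, ← two_mul, pow_mul, neg_one_sq, one_pow, one_smul, frameProj, PB.lift_diag]
    have h1 : d.1.topFrame = A.1 ↔ Diagram.topSet d = A :=
      ⟨fun h => Subtype.ext h, congrArg Subtype.val⟩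
    have h2 : d.1.botFrame = B.1 ↔ Diagram.botSet d = B :=
      ⟨fun h => Subtype.ext h, congrArg Subtype.val⟩
    simp only [h1, h2]
    split_ifs with h
    · rw [Diagram.core_eq_restrict, h.1, h.2]
    · rfl
  · intro e he hne
    rw [map_smul, hdiag e (Finset.mem_filter.1 he).2 hne, smul_zero]
  · intro h
    simp at h

/-- The matrix of an element of `X(n)`: its entries are obtained by deleting isolated vertices. -/
noncomputable def X.toMatrixLin (δ δ' : K) (k n : ℕ) :
    X δ k n →ₗ[K] Matrix (Subsets k n) (Subsets k n) (TL δ' n) where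
  toFun x A B := ⟨frameProj δ δ' A B x.1, by
    classical
    refine (Submodule.span_le (p := (Submodule.span K
      (PB.diag δ' '' Diagram.temperleyLieb n)).comap (frameProj δ δ' A B))).2 ?_ x.2
    rintro _ ⟨d, hd, rfl⟩
    rw [SetLike.mem_coe, Submodule.mem_comap, frameProj_bar δ' A B ⟨d, hd⟩]
    split_ifs
    · exact Submodule.subset_span ⟨_, Diagram.core_mem _, rfl⟩
    · exact Submodule.zero_mem _⟩
  map_add' x y := by
    ext A B
    exact congrArg (fun z : PB δ' n => z) (map_add (frameProj δ δ' A B) x.1 y.1)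
  map_smul' c x := by
    ext A B
    exact congrArg (fun z : PB δ' n => z) (map_smul (frameProj δ δ' A B) c x.1)

open scoped Classical in
theorem X.toMatrixLin_bar (δ' : K) (d : Diagram.balancedMotzkinEdges k n) :
    X.toMatrixLin δ δ' k n (X.bar δ d) =
      Matrix.single (Diagram.topSet d) (Diagram.botSet d) (coreTL δ' d) := by
  ext A B
  refine congrArg Subtype.val (Subtype.ext (?_) :
    X.toMatrixLin δ δ' k n (X.bar δ d) A B = Matrix.single _ _ _ A B)
  refine (frameProj_bar δ' A B d).trans ?_
  rw [Matrix.single_apply]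
  split_ifs <;> rfl

/-- A left inverse is given by inserting isolated vertices and passing to alternating elements. -/
theorem X.toMatrixLin_injective (δ' : K) : Function.Injective (X.toMatrixLin δ δ' k n) := by
  classical
  let ψ : Matrix (Subsets k n) (Subsets k n) (TL δ' n) →ₗ[K] PB δ k :=
    ∑ A, ∑ B, (PB.lift fun t => PB.bar δ (Diagram.inflate A B t) : PB δ' n →ₗ[K] PB δ k) ∘ₗ
      (TL δ' n).val.toLinearMap ∘ₗ Matrix.entryLinearMap K (TL δ' n) A B
  have h : ψ ∘ₗ X.toMatrixLin δ δ' k n = (X δ k n).toSubmodule.subtype := by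
    refine LinearMap.ext_on_range X.span_range_bar fun d => ?_
    rw [LinearMap.comp_apply, X.toMatrixLin_bar]
    simp only [ψ, LinearMap.sum_apply, LinearMap.comp_apply, Matrix.entryLinearMap_apply]
    rw [Finset.sum_eq_single (Diagram.topSet d), Finset.sum_eq_single (Diagram.botSet d)]
    · rw [Matrix.single_apply_same]
      refine (PB.lift_diag _ _).trans ?_
      rw [Diagram.core_eq_restrict, Diagram.inflate_restrict rfl rfl]
      rfl
    · intro B _ hB
      rw [Matrix.single_apply_of_col_ne _ _ hB.symm, map_zero, map_zero]
    · simp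
    · intro A _ hA
      refine Finset.sum_eq_zero fun B _ => ?_
      rw [Matrix.single_apply_of_row_ne hA.symm, map_zero, map_zero]
    · simp
  refine Function.Injective.of_comp (f := ψ) ?_
  have h2 := Subtype.val_injective (p := fun x => x ∈ X δ k n)
  have h3 : ⇑ψ ∘ ⇑(X.toMatrixLin δ δ' k n) = Subtype.val := by
    funext x
    exact LinearMap.congr_fun h x
  rw [h3]
  exact h2

theorem X.toMatrixLin_surjective (δ' : K) : Function.Surjective (X.toMatrixLin δ δ' k n) := by
  classical
  rw [← LinearMap.range_eq_top, eq_top_iff]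
  rintro M -
  rw [Matrix.matrix_eq_sum_single M]
  refine Submodule.sum_mem _ fun A _ => Submodule.sum_mem _ fun B _ => ?_
  change Matrix.singleLinearMap K A B (M A B) ∈ _
  rw [← Submodule.mem_comap]
  have hM : M A B ∈ (⊤ : Submodule K (TL δ' n)) := Submodule.mem_top
  rw [← TL.span_range] at hM
  refine Submodule.span_le.2 ?_ hM
  rintro _ ⟨t, rfl⟩
  refine ⟨X.bar δ ⟨Diagram.inflate A B t.1, Diagram.inflate_mem A B t.2⟩, ?_⟩
  rw [X.toMatrixLin_bar]
  have h1 : Diagram.topSet ⟨Diagram.inflate A B t.1, Diagram.inflate_mem A B t.2⟩ = A :=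
    Subtype.ext (Diagram.topFrame_inflate A B t.2)
  have h2 : Diagram.botSet ⟨Diagram.inflate A B t.1, Diagram.inflate_mem A B t.2⟩ = B :=
    Subtype.ext (Diagram.botFrame_inflate A B t.2)
  have h3 : Diagram.core ⟨Diagram.inflate A B t.1, Diagram.inflate_mem A B t.2⟩ = t.1 := by
    rw [Diagram.core_eq_restrict, h1, h2, Diagram.restrict_inflate]
  rw [h1, h2]
  change Matrix.single A B _ = Matrix.single A B _
  congr 1
  exact Subtype.ext (congrArg (PB.diag δ') h3)

theorem X.bar_mul_bar_eq (d e : Diagram.balancedMotzkinEdges k n)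
    (h : Diagram.botSet d = Diagram.topSet e)
    (hc : Diagram.comp d.1 e.1 ∈ Diagram.balancedMotzkinEdges k n) :
    X.bar δ d * X.bar δ e = (δ - 1) ^ Diagram.numLoops d.1 e.1 • X.bar δ ⟨_, hc⟩ :=
  Subtype.ext (PB.bar_mul_bar (congrArg Subtype.val h))

theorem X.toMatrixLin_bar_mul_bar (d e : Diagram.balancedMotzkinEdges k n) :
    X.toMatrixLin δ (δ - 1) k n (X.bar δ d * X.bar δ e) =
      X.toMatrixLin δ (δ - 1) k n (X.bar δ d) * X.toMatrixLin δ (δ - 1) k n (X.bar δ e) := by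
  classical
  rw [X.toMatrixLin_bar, X.toMatrixLin_bar]
  by_cases h : Diagram.botSet d = Diagram.topSet e
  · have hde : d.1.botFrame = e.1.topFrame := congrArg Subtype.val h
    have hd := (Diagram.mem_balancedMotzkinEdges_iff d.1 n).1 d.2
    have he := (Diagram.mem_balancedMotzkinEdges_iff e.1 n).1 e.2
    have hc : Diagram.comp d.1 e.1 ∈ Diagram.balancedMotzkinEdges k n := by
      rw [Diagram.mem_balancedMotzkinEdges_iff, Diagram.topFrame_comp hde,
        Diagram.botFrame_comp hde]
      exact ⟨Diagram.comp_isPlanar hd.1 he.1, hd.2.1, he.2.2⟩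
    have h1 : Diagram.topSet ⟨_, hc⟩ = Diagram.topSet d := Subtype.ext (Diagram.topFrame_comp hde)
    have h2 : Diagram.botSet ⟨_, hc⟩ = Diagram.botSet e := Subtype.ext (Diagram.botFrame_comp hde)
    obtain ⟨h3, h4⟩ := Diagram.restrict_comp (A := Diagram.topSet d) (B := Diagram.botSet d)
      (C := Diagram.botSet e) (d := d.1) (e := e.1) rfl rfl hde.symm rfl
    rw [X.bar_mul_bar_eq d e h hc, map_smul, X.toMatrixLin_bar, h1, h2, ← h,
      Matrix.single_mul_single_same, Matrix.smul_single]
    congr 1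
    refine Subtype.ext ?_
    change (δ - 1) ^ Diagram.numLoops d.1 e.1 • PB.diag (δ - 1) (Diagram.core ⟨_, hc⟩) =
      PB.diag (δ - 1) (Diagram.core d) * PB.diag (δ - 1) (Diagram.core e)
    rw [PB.diag_mul, Diagram.core_eq_restrict, Diagram.core_eq_restrict d,
      Diagram.core_eq_restrict e, h1, h2, ← h, h3, h4]
  · have h0 : X.bar δ d * X.bar δ e = 0 :=
      Subtype.ext (PB.bar_mul_bar_zero fun h' => h (Subtype.ext h'))
    rw [h0, map_zero, Matrix.single_mul_single_of_ne _ _ _ _ h]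

theorem X.toMatrixLin_mul (x y : X δ k n) :
    X.toMatrixLin δ (δ - 1) k n (x * y) =
      X.toMatrixLin δ (δ - 1) k n x * X.toMatrixLin δ (δ - 1) k n y := by
  have hx : x ∈ Submodule.span K (Set.range (X.bar δ (k := k) (n := n))) := by
    rw [X.span_range_bar]; exact Submodule.mem_top
  have hy : y ∈ Submodule.span K (Set.range (X.bar δ (k := k) (n := n))) := by
    rw [X.span_range_bar]; exact Submodule.mem_top
  induction hx using Submodule.span_induction with
  | zero => rw [zero_mul, map_zero, zero_mul]
  | add x x' _ _ h h' => rw [add_mul, map_add, h, h', map_add, add_mul]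
  | smul c x _ h => rw [smul_mul_assoc, map_smul, h, map_smul, smul_mul_assoc]
  | mem x hx =>
    obtain ⟨d, rfl⟩ := hx
    induction hy using Submodule.span_induction with
    | zero => rw [mul_zero, map_zero, mul_zero]
    | add y y' _ _ h h' => rw [mul_add, map_add, h, h', map_add, mul_add]
    | smul c y _ h => rw [mul_smul_comm, map_smul, h, map_smul, mul_smul_comm]
    | mem y hy =>
      obtain ⟨e, rfl⟩ := hy
      exact X.toMatrixLin_bar_mul_bar d e

/-- The ideal `X(n)` is isomorphic to the algebra of matrices with entries in `TL_n(δ - 1)` whose rows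
and columns are indexed by the `n`-element subsets of `{1, …, k}`. -/
noncomputable def X.matrixEquiv (δ : K) (k n : ℕ) :
    X δ k n ≃ₐ[K] Matrix (Subsets k n) (Subsets k n) (TL (δ - 1) n) :=
  AlgEquiv.ofBijective
    (AlgHom.ofLinearMap (X.toMatrixLin δ (δ - 1) k n)
      (by
        obtain ⟨x, hx⟩ := X.toMatrixLin_surjective (δ := δ) (k := k) (n := n) (δ - 1) 1
        rw [← mul_one (X.toMatrixLin δ (δ - 1) k n 1), ← hx, ← X.toMatrixLin_mul, one_mul])
      X.toMatrixLin_mul)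
    ⟨X.toMatrixLin_injective (δ - 1), X.toMatrixLin_surjective (δ - 1)⟩

open scoped Classical in
theorem X.matrixEquiv_bar (d : Diagram.balancedMotzkinEdges k n) :
    X.matrixEquiv δ k n (X.bar δ d) =
      Matrix.single (Diagram.topSet d) (Diagram.botSet d) (coreTL (δ - 1) d) :=
  X.toMatrixLin_bar (δ - 1) d

end MatrixAlgebra

/-! ### Modules over matrix rings -/

section MatrixModules

open Matrix.Module

variable {ι R M : Type*} [Fintype ι] [DecidableEq ι] [Ring R] [AddCommGroup M] [Module R M]

/-- The submodules of `ι → M` over the ring of matrices with entries in `R` are those of the form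
`ι → N`, where `N` is an `R`-submodule of `M`. -/
def matrixSubmoduleOrderIso (i₀ : ι) : Submodule R M ≃o Submodule (Matrix ι ι R) (ι → M) where
  toFun N :=
    { carrier := {v | ∀ i, v i ∈ N}
      add_mem' := fun hv hw i => N.add_mem (hv i) (hw i)
      zero_mem' := fun _ => N.zero_mem
      smul_mem' := fun a v hv i => by
        rw [Matrix.Module.smul_apply]
        exact N.sum_mem fun j _ => N.smul_mem _ (hv j) }
  invFun P :=
    { carrier := {x | Pi.single i₀ x ∈ P}
      add_mem' := fun {x y} hx hy => by
        change Pi.single i₀ (x + y) ∈ P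
        rw [Pi.single_add]
        exact P.add_mem hx hy
      zero_mem' := by
        change Pi.single i₀ (0 : M) ∈ P
        rw [Pi.single_zero]
        exact P.zero_mem
      smul_mem' := fun r x hx => by
        have h := P.smul_mem (Matrix.single i₀ i₀ r) hx
        rwa [Matrix.Module.single_smul, Pi.single_eq_same] at h }
  left_inv N := by
    ext x
    constructor
    · intro h
      have := h i₀
      rwa [Pi.single_eq_same] at this
    · intro hx i
      by_cases h : i = i₀
      · subst h
        rwa [Pi.single_eq_same]
      · rw [Pi.single_eq_of_ne h]
        exact N.zero_mem
  right_inv P := by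
    ext v
    constructor
    · intro h
      rw [← Finset.univ_sum_single v]
      refine P.sum_mem fun i _ => ?_
      have h1 := P.smul_mem (Matrix.single i i₀ (1 : R)) (h i)
      rwa [Matrix.Module.single_smul, Pi.single_eq_same, one_smul] at h1
    · intro h i
      have h1 := P.smul_mem (Matrix.single i₀ i (1 : R)) h
      rwa [Matrix.Module.single_smul, one_smul] at h1
  map_rel_iff' {N N'} := by
    refine ⟨fun h x hx => ?_, fun h v hv i => h (hv i)⟩
    exact h (x := fun _ => x) (fun _ => hx) i₀

theorem isSemisimpleRing_matrix_iff [Nonempty ι] :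
    IsSemisimpleRing (Matrix ι ι R) ↔ IsSemisimpleRing R := by
  refine ⟨fun h => ?_, fun h => inferInstance⟩
  have h1 : IsSemisimpleModule (Matrix ι ι R) (ι → R) := inferInstance
  rw [isSemisimpleModule_iff] at h1
  rw [IsSemisimpleRing, isSemisimpleModule_iff]
  exact (matrixSubmoduleOrderIso (Classical.arbitrary ι)).complementedLattice_iff.2 h1

theorem isSimpleModule_matrix_iff [Nonempty ι] :
    IsSimpleModule (Matrix ι ι R) (ι → M) ↔ IsSimpleModule R M := by
  rw [isSimpleModule_iff, isSimpleModule_iff]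
  exact (matrixSubmoduleOrderIso (Classical.arbitrary ι)).isSimpleOrder_iff.symm

/-- Simplicity can be transferred along an isomorphism with a matrix ring and a compatible isomorphism
of modules. -/
theorem isSimpleModule_iff_of_matrix [Nonempty ι] {A N : Type*} [Ring A] [AddCommGroup N]
    [Module A N] (e : A ≃+* Matrix ι ι R) (T : N ≃+ (ι → M))
    (hT : ∀ (a : A) (x : N), T (a • x) = e a • T x) :
    IsSimpleModule A N ↔ IsSimpleModule R M := by
  rw [← isSimpleModule_matrix_iff (ι := ι) (R := R)]
  let f : N →ₛₗ[e.toRingHom] (ι → M) := { T.toAddMonoidHom with map_smul' := hT }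
  have : RingHomSurjective e.toRingHom := ⟨e.surjective⟩
  exact f.isSimpleModule_iff_of_bijective T.bijective

/-- A module over an algebra isomorphic to a matrix algebra over `R` consists of the families of
elements of an `R`-module. -/
theorem exists_linearEquiv_fun {K A : Type*} [Field K] {ι R : Type*} [Fintype ι] [DecidableEq ι]
    [Nonempty ι] [Ring R] [Algebra K R] [Ring A] [Algebra K A] (e : A ≃ₐ[K] Matrix ι ι R)
    (M : Type v) [AddCommGroup M] [Module K M] [Module A M] [IsScalarTower K A M] :
    ∃ (S : Type v) (_ : AddCommGroup S) (_ : Module K S) (_ : Module R S) (_ : IsScalarTower K R S)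
      (φ : M ≃ₗ[K] (ι → S)), ∀ (a : A) (m : M), φ (a • m) = e a • φ m := by
  -- the `R`-module is the image of the matrix unit at a fixed diagonal position
  let i₀ : ι := Classical.arbitrary ι
  let _ : Module (Matrix ι ι R) M := Module.compHom M (e.symm : Matrix ι ι R →+* A)
  let _ : Module R M := Module.compHom M (Matrix.scalar (α := R) ι)
  have h1 : IsScalarTower R (Matrix ι ι R) M :=
    MatrixModCat.isScalarTower_toModuleCat R (ModuleCat.of (Matrix ι ι R) M)
  have h2 : IsScalarTower K (Matrix ι ι R) M :=
    ⟨fun c a m => by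
      change e.symm (c • a) • m = c • (e.symm a • m)
      rw [map_smul, smul_assoc]⟩
  have h3 : IsScalarTower K R M :=
    ⟨fun c r m => by
      change Matrix.scalar ι (c • r) • m = c • (Matrix.scalar ι r • m)
      rw [← smul_assoc c]
      congr 1
      ext i j
      by_cases h : i = j <;> simp [h]⟩
  let ψ := toModuleCatFromModuleCatLinearEquiv R (ModuleCat.of (Matrix ι ι R) M) i₀
  refine ⟨MatrixModCat.toModuleCatObj R M i₀, inferInstance, inferInstance, inferInstance,
    inferInstance, { ψ.toAddEquiv with map_smul' := fun c m => ?_ }, fun a m => ?_⟩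
  · funext i
    refine Subtype.ext ?_
    change Matrix.single i₀ i (1 : R) • (c • m) = c • (Matrix.single i₀ i (1 : R) • m)
    exact smul_comm _ _ _
  · have h := ψ.map_smul (e a) m
    have h4 : e a • m = a • m := by
      change e.symm (e a) • m = a • m
      rw [e.symm_apply_apply]
    exact (congrArg ψ h4).symm.trans h

end MatrixModules

/-! ### The modules `Q_n ⊗ S` -/

section InflationModules

open Matrix.Module

/-- The elements of `Q_n ⊗ S` as families of elements of `S`, indexed by the subsets of
cardinality `n`. -/
noncomputable def tensorFunEquiv (K : Type*) [CommRing K] (k n : ℕ) (S : Type*) [AddCommGroup S]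
    [Module K S] : Q K k n ⊗[K] S ≃ₗ[K] (Subsets k n → S) :=
  TensorProduct.finsuppScalarLeft K S (Subsets k n) ≪≫ₗ
    Finsupp.linearEquivFunOnFinite K S (Subsets k n)

theorem tensorFunEquiv_tmul {K : Type*} [CommRing K] {k n : ℕ} {S : Type*} [AddCommGroup S]
    [Module K S] (q : Q K k n) (s : S) (A : Subsets k n) :
    tensorFunEquiv K k n S (q ⊗ₜ s) A = q A • s :=
  TensorProduct.finsuppScalarLeft_apply_tmul_apply q s A

open scoped Classical in
theorem tensorFunEquiv_inflationAction {K : Type*} [CommRing K] {k n : ℕ} {S : Type*}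
    [AddCommGroup S] [Module K S] (δ' : K) [Module (TL δ' n) S] [IsScalarTower K (TL δ' n) S]
    (d : Diagram.balancedMotzkinEdges k n) (z : Q K k n ⊗[K] S) :
    tensorFunEquiv K k n S (inflationAction δ' S d z) =
      Matrix.single (Diagram.topSet d) (Diagram.botSet d) (coreTL δ' d) •
        tensorFunEquiv K k n S z := by
  induction z using TensorProduct.induction_on with
  | zero => rw [map_zero, map_zero, smul_zero]
  | add x y hx hy => rw [map_add, map_add, hx, hy, map_add, smul_add]
  | tmul q s =>
    funext A
    have h : inflationAction δ' S d (q ⊗ₜ s) =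
      (matrixUnit K (Diagram.topSet d) (Diagram.botSet d) q) ⊗ₜ (coreTL δ' d • s) := rfl
    rw [h, tensorFunEquiv_tmul, Matrix.Module.single_smul, tensorFunEquiv_tmul, matrixUnit,
      LinearMap.comp_apply, Finsupp.lapply_apply, Finsupp.lsingle_apply, Finsupp.single_apply,
      Pi.single_apply, smul_algebra_smul_comm]
    by_cases hA : A = Diagram.topSet d
    · rw [if_pos hA, if_pos hA.symm]
    · rw [if_neg hA, if_neg (Ne.symm hA), zero_smul]

variable {K : Type u} [Field K] (δ : K) {k n : ℕ}

theorem Subsets.nonempty (h : n ≤ k) : Nonempty (Subsets k n) := by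
  obtain ⟨A, -, hA⟩ := Finset.exists_subset_card_eq (s := (Finset.univ : Finset (Fin k)))
    (n := n) (by simpa using h)
  exact ⟨⟨A, hA⟩⟩

/-- Both properties are those of a matrix ring and of its ring of coefficients. The index set is
nonempty because `n ≤ k`. -/
theorem isSemisimpleRing_X_iff (h : n ≤ k) :
    IsSemisimpleRing (X δ k n) ↔ IsSemisimpleRing (TL (δ - 1) n) := by
  classical
  have := Subsets.nonempty h
  rw [(X.matrixEquiv δ k n).toRingEquiv.isSemisimpleRing_iff, isSemisimpleRing_matrix_iff]

theorem exists_equiv_tensor_of_isSimpleModule (h : n ≤ k) (M : Type v) [AddCommGroup M] [Module K M]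
    [Module (X δ k n) M] [IsScalarTower K (X δ k n) M] (hM : IsSimpleModule (X δ k n) M) :
    ∃ (S : Type v) (_ : AddCommGroup S) (_ : Module K S) (_ : Module (TL (δ - 1) n) S)
      (_ : IsScalarTower K (TL (δ - 1) n) S), IsSimpleModule (TL (δ - 1) n) S ∧
      ∃ φ : M ≃ₗ[K] Q K k n ⊗[K] S, ∀ (d : Diagram.balancedMotzkinEdges k n) (m : M),
        φ (X.bar δ d • m) = inflationAction (δ - 1) S d (φ m) := by
  classical
  have := Subsets.nonempty h
  obtain ⟨S, _, _, _, _, φ, hφ⟩ := exists_linearEquiv_fun (X.matrixEquiv δ k n) M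
  refine ⟨S, inferInstance, inferInstance, inferInstance, inferInstance,
    (isSimpleModule_iff_of_matrix (X.matrixEquiv δ k n).toRingEquiv φ.toAddEquiv hφ).1 hM,
    φ ≪≫ₗ (tensorFunEquiv K k n S).symm, fun d m => ?_⟩
  apply (tensorFunEquiv K k n S).injective
  rw [tensorFunEquiv_inflationAction, LinearEquiv.trans_apply, LinearEquiv.trans_apply,
    LinearEquiv.apply_symm_apply, LinearEquiv.apply_symm_apply, hφ, X.matrixEquiv_bar]

theorem exists_module_tensor (h : n ≤ k) (S : Type v) [AddCommGroup S] [Module K S]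
    [Module (TL (δ - 1) n) S] [IsScalarTower K (TL (δ - 1) n) S]
    (hS : IsSimpleModule (TL (δ - 1) n) S) :
    ∃ (_ : Module (X δ k n) (Q K k n ⊗[K] S)) (_ : IsScalarTower K (X δ k n) (Q K k n ⊗[K] S)),
      (∀ (d : Diagram.balancedMotzkinEdges k n) (z : Q K k n ⊗[K] S),
        X.bar δ d • z = inflationAction (δ - 1) S d z) ∧
      IsSimpleModule (X δ k n) (Q K k n ⊗[K] S) := by
  classical
  have := Subsets.nonempty h
  let T := tensorFunEquiv K k n S
  let e := X.matrixEquiv δ k n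
  -- the action of matrices on families of elements of `S`, transported to `Q_n ⊗ S`
  let ρ : X δ k n →ₐ[K] Module.End K (Q K k n ⊗[K] S) :=
    (T.symm.conjAlgEquiv K).toAlgHom.comp
      ((Algebra.lsmul K K (Subsets k n → S)).comp e.toAlgHom)
  let _ : Module (X δ k n) (Q K k n ⊗[K] S) := Module.compHom _ ρ.toRingHom
  have hT : ∀ (a : X δ k n) (z : Q K k n ⊗[K] S), T (a • z) = e a • T z := fun a z =>
    T.apply_symm_apply _
  refine ⟨inferInstance, ⟨fun c a z => ?_⟩, fun d z => ?_,
    (isSimpleModule_iff_of_matrix e.toRingEquiv T.toAddEquiv hT).2 hS⟩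
  · apply T.injective
    rw [hT, map_smul, map_smul, hT, smul_assoc]
  · apply T.injective
    rw [hT, X.matrixEquiv_bar, tensorFunEquiv_inflationAction]

end InflationModules

/-! ### The decomposition of `PTL_k(δ)` -/

section Decomposition

variable {K : Type*} [CommRing K] {δ : K} {k : ℕ}

theorem PTL.mem_iff (x : PB δ k) :
    x ∈ PTL δ k ↔ x ∈ Submodule.span K (PB.bar δ '' Diagram.balancedMotzkin k) := by
  rw [← PB.span_tilde]
  rfl

theorem X.mem_PTL {n : ℕ} {x : PB δ k} (hx : x ∈ X δ k n) : x ∈ PTL δ k := by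
  rw [PTL.mem_iff]
  exact Submodule.span_mono (Set.image_mono fun d hd => hd.1) hx

theorem X.mul_eq_zero {m n : ℕ} (hmn : m ≠ n) {x y : PB δ k} (hx : x ∈ X δ k m)
    (hy : y ∈ X δ k n) : x * y = 0 := by
  rw [X.mem_iff] at hx hy
  induction hx using Submodule.span_induction with
  | zero => rw [zero_mul]
  | add x x' _ _ h h' => rw [add_mul, h, h', add_zero]
  | smul c x _ h => rw [smul_mul_assoc, h, smul_zero]
  | mem x hx =>
    obtain ⟨d, hd, rfl⟩ := hx
    induction hy using Submodule.span_induction with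
    | zero => rw [mul_zero]
    | add y y' _ _ h h' => rw [mul_add, h, h', add_zero]
    | smul c y _ h => rw [mul_smul_comm, h, smul_zero]
    | mem y hy =>
      obtain ⟨e, he, rfl⟩ := hy
      refine PB.bar_mul_bar_zero fun h => hmn ?_
      rw [← ((Diagram.mem_balancedMotzkinEdges_iff d m).1 hd).2.2, h,
        ((Diagram.mem_balancedMotzkinEdges_iff e n).1 he).2.1]

theorem bar_mem_X_card {d : Diagram k} (hd : d ∈ Diagram.balancedMotzkin k) :
    PB.bar δ d ∈ X δ k d.topFrame.card := by
  have h := (Diagram.mem_balancedMotzkin_iff d).1 hd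
  exact Submodule.subset_span
    ⟨d, (Diagram.mem_balancedMotzkinEdges_iff d _).2 ⟨h.1, rfl, h.2.symm⟩, rfl⟩

/-- The identity elements of the ideals `X(n)` sum up to the identity element. -/
theorem X.sum_unit : ∑ n : Fin (k + 1), X.unit δ k n = 1 := by
  have key : ∀ x ∈ PTL δ k, (∑ n : Fin (k + 1), X.unit δ k n) * x = x := by
    intro x hx
    rw [PTL.mem_iff] at hx
    induction hx using Submodule.span_induction with
    | zero => rw [mul_zero]
    | add x y _ _ h h' => rw [mul_add, h, h']
    | smul c x _ h => rw [mul_smul_comm, h]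
    | mem x hx =>
      obtain ⟨d, hd, rfl⟩ := hx
      have hlt : d.topFrame.card < k + 1 :=
        Nat.lt_succ_of_le ((Finset.card_le_univ _).trans_eq (Fintype.card_fin k))
      rw [Finset.sum_mul, Finset.sum_eq_single ⟨_, hlt⟩]
      · exact X.unit_mul (bar_mem_X_card hd)
      · intro n _ hn
        exact X.mul_eq_zero (fun h => hn (Fin.ext h)) X.unit_mem (bar_mem_X_card hd)
      · simp
  have h := key 1 (one_mem _)
  rwa [mul_one] at h

/-- The sum map from the product of the ideals `X(n)`, `n ≤ k`. -/
noncomputable def sumX (δ : K) (k : ℕ) : (∀ n : Fin (k + 1), X δ k n) →+* PTL δ k where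
  toFun x := ⟨∑ n, (x n).1, sum_mem fun n _ => X.mem_PTL (x n).2⟩
  map_one' := Subtype.ext X.sum_unit
  map_zero' := Subtype.ext (by
    change ∑ _ : Fin (k + 1), (0 : PB δ k) = 0
    exact Finset.sum_const_zero)
  map_add' x y := Subtype.ext (by
    change ∑ n, ((x n).1 + (y n).1) = ∑ n, (x n).1 + ∑ n, (y n).1
    exact Finset.sum_add_distrib)
  map_mul' x y := Subtype.ext (by
    change ∑ n, (x n).1 * (y n).1 = (∑ n, (x n).1) * ∑ n, (y n).1
    rw [Finset.sum_mul_sum]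
    refine Finset.sum_congr rfl fun n _ => ?_
    rw [Finset.sum_eq_single n]
    · intro m _ hm
      exact X.mul_eq_zero (fun h => hm (Fin.ext h).symm) (x n).2 (y m).2
    · simp)

theorem sumX_surjective : Function.Surjective (sumX δ k) := by
  rintro ⟨x, hx⟩
  suffices h : ∃ z, (sumX δ k z).1 = x by
    obtain ⟨z, hz⟩ := h
    exact ⟨z, Subtype.ext hz⟩
  rw [PTL.mem_iff] at hx
  induction hx using Submodule.span_induction with
  | zero => exact ⟨0, by rw [map_zero]; rfl⟩
  | add x y _ _ h h' =>
    obtain ⟨z, rfl⟩ := h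
    obtain ⟨z', rfl⟩ := h'
    exact ⟨z + z', by rw [map_add]; rfl⟩
  | smul c x _ h =>
    obtain ⟨z, rfl⟩ := h
    refine ⟨c • z, ?_⟩
    change ∑ n, c • (z n).1 = c • ∑ n, (z n).1
    rw [Finset.smul_sum]
  | mem x hx =>
    obtain ⟨d, hd, rfl⟩ := hx
    have hlt : d.topFrame.card < k + 1 :=
      Nat.lt_succ_of_le ((Finset.card_le_univ _).trans_eq (Fintype.card_fin k))
    refine ⟨Pi.single ⟨_, hlt⟩ ⟨PB.bar δ d, bar_mem_X_card hd⟩, ?_⟩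
    change ∑ n, (Pi.single (M := fun n : Fin (k + 1) => X δ k n) ⟨_, hlt⟩ _ n).1 = _
    rw [Finset.sum_eq_single ⟨_, hlt⟩]
    · rw [Pi.single_eq_same]
    · intro n _ hn
      rw [Pi.single_eq_of_ne hn]
      rfl
    · simp

end Decomposition

end PartialTL

theorem theoremt {K : Type u} [Field K] (δ : K) (k : ℕ) :
    (∀ n ≤ k, IsSemisimpleRing (X δ k n) ↔ IsSemisimpleRing (TL (δ - 1) n)) ∧
    (∀ n ≤ k, IsSemisimpleRing (X δ k n) →
      (∀ (M : Type v) [AddCommGroup M] [Module K M] [Module (X δ k n) M]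
          [IsScalarTower K (X δ k n) M], IsSimpleModule (X δ k n) M →
        ∃ (S : Type v) (_ : AddCommGroup S) (_ : Module K S) (_ : Module (TL (δ - 1) n) S)
          (_ : IsScalarTower K (TL (δ - 1) n) S), IsSimpleModule (TL (δ - 1) n) S ∧
          ∃ φ : M ≃ₗ[K] Q K k n ⊗[K] S, ∀ (d : Diagram.balancedMotzkinEdges k n) (m : M),
            φ (X.bar δ d • m) = inflationAction (δ - 1) S d (φ m)) ∧
      (∀ (S : Type v) [AddCommGroup S] [Module K S] [Module (TL (δ - 1) n) S]
          [IsScalarTower K (TL (δ - 1) n) S], IsSimpleModule (TL (δ - 1) n) S →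
        ∃ (_ : Module (X δ k n) (Q K k n ⊗[K] S))
          (_ : IsScalarTower K (X δ k n) (Q K k n ⊗[K] S)),
          (∀ (d : Diagram.balancedMotzkinEdges k n) (z : Q K k n ⊗[K] S),
            X.bar δ d • z = inflationAction (δ - 1) S d z) ∧
          IsSimpleModule (X δ k n) (Q K k n ⊗[K] S))) ∧
    ((∀ n ≤ k, IsSemisimpleRing (TL (δ - 1) n)) → IsSemisimpleRing (PTL δ k)) := by
  refine ⟨fun n hn => isSemisimpleRing_X_iff δ hn, fun n hn _ =>
    ⟨fun M _ _ _ _ hM => exists_equiv_tensor_of_isSimpleModule δ hn M hM,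
      fun S _ _ _ _ hS => exists_module_tensor δ hn S hS⟩, fun h => ?_⟩
  have : ∀ n : Fin (k + 1), IsSemisimpleRing (X δ k n) := fun n =>
    (isSemisimpleRing_X_iff δ (Nat.le_of_lt_succ n.2)).2 (h n (Nat.le_of_lt_succ n.2))
  exact (sumX δ k).isSemisimpleRing_of_surjective sumX_surjective
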